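/- Let $L>0$, let $m\ge \frac13$, and let $\theta:\mathbb R\to\mathbb R$ be even and continuous with $\upsilon_1|\kappa|^m\le\theta(\kappa)\le\upsilon_2|\kappa|^m$ for all $\kappa\in\mathbb R$, where $\upsilon_1,\upsilon_2>0$. Let $\mathcal M$ be the Fourier multiplier on real $L$-periodic functions given by $\widehat{\mathcal M g}(\kappa)=\theta(\kappa)\hat g(\kappa)$, $\kappa\in\mathbb Z$, where $\hat g(\kappa)=\frac1L\int_0^L g(x)e^{-2\pi i\kappa x/L}\,dx$. For $r\ge0$ let $H^r_{per}$ be the space of real $L$-periodic functions $g$ with $\|g\|_r^2=L\sum_{\kappa\in\mathbb Z}(1+\kappa^2)^r|\hat g(\kappa)|^2<\infty$; write $(\cdot,\cdot)$ and $\|\cdot\|$ for the inner product and norm of $L^2_{per}([0,L])$. Let $s\ge\frac m2$ and assume that the Cauchy problem $$u_t+\Big(\frac{u^2}{2}\Big)_x-(\mathcal Mu)_x=0,\qquad u(0)=u_0, \qquad (1)$$ is globally well-posed in $H^s_{per}$: for each $u_0\in H^s_{per}$ there is a unique solution $u\in C([0,\infty);H^s_{per})$ (in the sense of distributions), it depends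 continuously on $u_0$ in $C([0,T];H^s_{per})$ for every $T>0$, and regularity persists, that is, if $u_0\in C^\infty_{per}$, then $u\in C([0,\infty);H^r_{per})$ for every $r\ge0$. Let $\omega,A\in\mathbb R$, let $\phi$ be a smooth real $L$-periodic solution of $$\mathcal M\phi+\omega\phi-\frac{\phi^2}{2}+A=0,$$ and let $\mathcal L=\mathcal M+\omega-\phi$, an operator on $L^2_{per}([0,L])$ with domain $H^m_{per}$. Assume: - $(H_0)$ $\mathcal L$ has exactly one negative eigenvalue, which is simple, and zero is a simple eigenvalue of $\mathcal L$ with eigenfunction $\phi'$; - $(H_1)$ there are $c_1,c_2>0$ such that $(\mathcal Lv,v)\ge c_1\|v\|_{m/2}^2-c_2\|v\|^2$ for all $v\in C^\infty_{per}$. If $M(\phi):=\int_0^L\phi\,dx>\omega L$, then $\phi$ is orbitally stable in $H^{m/2}_{per}$: for every $\varepsilon>0$ there is $\delta>0$ such that, whenever $u_0\in H^s_{per}$ satisfies $\|u_0-\phi\|_{m/2}<\delta$, the solution $u$ of (1) with $u(0)=u_0$ exists for all $t\ge0$ and satisfies $$\inf_{r\in\mathbb R}\|u(t)-\phi(\cdot+r)\|_{m/2}<\varepsilon\qquad\text{for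 all }t\ge0.$$ -/

import Mathlib

open MeasureTheory Filter Topology

namespace PeriodicWave

noncomputable section

/-! ### Periodic functions, Fourier coefficients and Sobolev spaces -/

/-- Real `L²` functions on the circle `ℝ / Lℤ`, with Lebesgue measure of total mass `L`. -/
abbrev L2per (L : ℝ) [Fact (0 < L)] : Type :=
  Lp ℝ 2 (volume : Measure (AddCircle L))

/-- Smooth real functions on `ℝ` with period `L`. -/
structure SmoothPer (L : ℝ) where
  toFun : ℝ → ℝ
  smooth : ContDiff ℝ ((⊤ : ℕ∞) : WithTop ℕ∞) toFun
  periodic : Function.Periodic toFun L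

namespace SmoothPer

variable {L : ℝ}

/-- The derivative `φ'`. -/
def derivative (φ : SmoothPer L) : SmoothPer L where
  toFun := deriv φ.toFun
  smooth := (contDiff_infty_iff_deriv.mp φ.smooth).2
  periodic := fun x => by
    have h : (fun y => φ.toFun (y + L)) = φ.toFun := funext φ.periodic
    rw [← deriv_comp_add_const φ.toFun L x, h]

/-- The translate `φ(· + r)`. -/
def translate (φ : SmoothPer L) (r : ℝ) : SmoothPer L where
  toFun := fun x => φ.toFun (x + r)
  smooth := φ.smooth.comp (contDiff_id.add contDiff_const)
  periodic := fun x => by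
    have h := φ.periodic (x + r)
    change φ.toFun (x + L + r) = φ.toFun (x + r)
    rw [← h]
    congr 1
    ring

/-- `φ` as a continuous function on the circle. -/
def toCircle (φ : SmoothPer L) : C(AddCircle L, ℝ) where
  toFun := φ.periodic.lift
  continuous_toFun := continuous_coinduced_dom.mpr φ.smooth.continuous

/-- The class of `φ` in `L²`. -/
def toL2 [Fact (0 < L)] (φ : SmoothPer L) : L2per L :=
  ContinuousMap.toLp 2 volume ℝ φ.toCircle

end SmoothPer

variable {L : ℝ} [Fact (0 < L)]

/-- Fourier coefficients `û(k) = (1/L) ∫₀ᴸ u(x) exp(-2πikx/L) dx`. -/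
def coeff (u : L2per L) (k : ℤ) : ℂ :=
  fourierCoeff (fun x : AddCircle L => ((u x : ℝ) : ℂ)) k

/-- The Sobolev space `Hˢ` of `L`-periodic real functions (used for `s ≥ 0`). -/
def Hs (L : ℝ) [Fact (0 < L)] (s : ℝ) : Set (L2per L) :=
  {u | Summable fun k : ℤ => (1 + (k : ℝ) ^ 2) ^ s * ‖coeff u k‖ ^ 2}

/-- The norm of `Hˢ`, meaningful on `Hs L s`; for `s = 0` it is the `L²` norm. -/
def sobolevNorm (s : ℝ) (u : L2per L) : ℝ :=
  Real.sqrt (L * ∑' k : ℤ, (1 + (k : ℝ) ^ 2) ^ s * ‖coeff u k‖ ^ 2)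

/-! ### The equation `u_t + (u²/2)_x - (𝓜 u)_x = 0` -/

/-- The nonlinearity `f(v) = v²/2`. -/
def flux (v : ℝ) : ℝ := v ^ 2 / 2

/-- `w = 𝓜 u` in `L²`, where `𝓜` is the Fourier multiplier with symbol `θ`. -/
def IsMultiplier (θ : ℝ → ℝ) (u w : L2per L) : Prop :=
  ∀ k : ℤ, coeff w k = (θ k : ℂ) * coeff u k

/-- `u : [0, ∞) → Hˢ` is continuous (values at negative times play no role). -/
def ContinuousInHs (s : ℝ) (u : ℝ → L2per L) : Prop :=
  (∀ t, 0 ≤ t → u t ∈ Hs L s) ∧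
    ∀ t₀, 0 ≤ t₀ →
      Tendsto (fun t => sobolevNorm s (u t - u t₀)) (𝓝[Set.Ici 0] t₀) (𝓝 0)

/-- `u ∈ C([0, ∞); Hˢ)` solves `u_t + (f(u))_x - (𝓜 u)_x = 0`, `u(0) = u₀`. The equation is meant
in the sense of periodic distributions in `x`, i.e. coefficient by coefficient on the Fourier side,
where `∂ₓ` has symbol `2πik/L`; note that `f(u(t))` is integrable because `u(t) ∈ L²`. -/
structure IsGlobalSolution (θ : ℝ → ℝ) (s : ℝ) (u₀ : L2per L) (u : ℝ → L2per L) : Prop where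
  continuous : ContinuousInHs s u
  initial : u 0 = u₀
  equation : ∀ k : ℤ, ∀ t, 0 ≤ t →
    HasDerivWithinAt (fun τ => coeff (u τ) k)
      (-(2 * Real.pi * Complex.I * (k : ℂ) / (L : ℂ)) *
        (fourierCoeff (fun x : AddCircle L => ((flux (u t x) : ℝ) : ℂ)) k
          - (θ k : ℂ) * coeff (u t) k))
      (Set.Ici 0) t

/-- Global well-posedness of the Cauchy problem in `Hˢ`: existence, uniqueness, continuous
dependence on the data uniformly on bounded time intervals, and persistence of regularity
(a solution with smooth initial datum remains smooth). -/
structure GloballyWellPosed (L : ℝ) [Fact (0 < L)] (θ : ℝ → ℝ) (s : ℝ) : Prop where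
  exist : ∀ u₀ ∈ Hs L s, ∃ u, IsGlobalSolution θ s u₀ u
  unique : ∀ u₀ ∈ Hs L s, ∀ u v, IsGlobalSolution θ s u₀ u → IsGlobalSolution θ s u₀ v →
    ∀ t, 0 ≤ t → u t = v t
  dependence : ∀ u₀ ∈ Hs L s, ∀ u, IsGlobalSolution θ s u₀ u →
    ∀ T > 0, ∀ ε > 0, ∃ δ > 0, ∀ v₀ ∈ Hs L s, ∀ v, IsGlobalSolution θ s v₀ v →
      sobolevNorm s (v₀ - u₀) < δ → ∀ t, 0 ≤ t → t ≤ T → sobolevNorm s (v t - u t) < ε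
  persistence : ∀ u₀ : L2per L, (∀ r : ℝ, u₀ ∈ Hs L r) → ∀ u, IsGlobalSolution θ s u₀ u →
    ∀ r : ℝ, ContinuousInHs r u

/-! ### Periodic traveling waves -/

/-- `𝓜 φ + ω φ - f(φ) + A = 0`, the profile equation of the wave `φ(x - ωt)`. -/
def IsWaveProfile (θ : ℝ → ℝ) (ω A : ℝ) (φ : SmoothPer L) : Prop :=
  ∃ g : L2per L, IsMultiplier θ φ.toL2 g ∧
    ∀ᵐ x : AddCircle L, g x + ω * φ.toCircle x - flux (φ.toCircle x) + A = 0

/-- `v` lies in the domain `Hᵐ` of the linearized operator `𝓛 = 𝓜 + ω - f'(φ)` and `𝓛 v = w`. -/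
def IsLinearized (θ : ℝ → ℝ) (m ω : ℝ) (φ : SmoothPer L) (v w : L2per L) : Prop :=
  v ∈ Hs L m ∧ ∃ g : L2per L, IsMultiplier θ v g ∧
    ∀ᵐ x : AddCircle L, w x = g x + ω * v x - deriv flux (φ.toCircle x) * v x

/-- `lam` is a simple eigenvalue of `𝓛` with eigenfunction `χ`: the eigenspace is the line
spanned by `χ`. -/
def IsSimpleEigenvalue (θ : ℝ → ℝ) (m ω : ℝ) (φ : SmoothPer L) (lam : ℝ) (χ : L2per L) : Prop :=
  χ ≠ 0 ∧ IsLinearized θ m ω φ χ (lam • χ) ∧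
    ∀ v, IsLinearized θ m ω φ v (lam • v) → ∃ c : ℝ, v = c • χ

/-- `φ` is a wave profile; `𝓛` has exactly one negative eigenvalue, it is simple, and zero is a
simple eigenvalue with eigenfunction `φ'`. -/
structure HypH0 (θ : ℝ → ℝ) (m ω A : ℝ) (φ : SmoothPer L) : Prop where
  profile : IsWaveProfile θ ω A φ
  negative : ∃ lam < 0, ∃ χ, IsSimpleEigenvalue θ m ω φ lam χ ∧
    ∀ lam' < 0, ∀ v, v ≠ 0 → IsLinearized θ m ω φ v (lam' • v) → lam' = lam
  kernel : IsSimpleEigenvalue θ m ω φ 0 φ.derivative.toL2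

/-- `(𝓛 v, v) ≥ c₁ ‖v‖²_{m/2} - c₂ ‖v‖²` for all smooth periodic `v`. -/
def HypH1 (θ : ℝ → ℝ) (m ω : ℝ) (φ : SmoothPer L) : Prop :=
  ∃ c₁ > 0, ∃ c₂ > 0, ∀ (v : SmoothPer L) (w : L2per L), IsLinearized θ m ω φ v.toL2 w →
    c₁ * sobolevNorm (m / 2) v.toL2 ^ 2 - c₂ * ‖v.toL2‖ ^ 2 ≤ inner ℝ w v.toL2

/-- The mass `M(φ) = ∫₀ᴸ φ dx`. -/
def mass (φ : SmoothPer L) : ℝ := ∫ x in (0 : ℝ)..L, φ.toFun x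

/-- Distance in `Hˢ` from `u` to the orbit `{φ(· + r) : r ∈ ℝ}`. -/
def orbitDist (s : ℝ) (u : L2per L) (φ : SmoothPer L) : ℝ :=
  ⨅ r : ℝ, sobolevNorm s (u - (φ.translate r).toL2)

/-- Orbital stability of `φ` in `H^{m/2}` for data in `Hˢ`: if `u₀ ∈ Hˢ` is `H^{m/2}`-close to `φ`,
then the solution issuing from `u₀` is global and stays `H^{m/2}`-close to the orbit of `φ`. -/
def OrbitallyStable (θ : ℝ → ℝ) (m s : ℝ) (φ : SmoothPer L) : Prop :=
  ∀ ε > 0, ∃ δ > 0, ∀ u₀ ∈ Hs L s, sobolevNorm (m / 2) (u₀ - φ.toL2) < δ →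
    (∃ u, IsGlobalSolution θ s u₀ u) ∧
      ∀ u, IsGlobalSolution θ s u₀ u → ∀ t, 0 ≤ t → orbitDist (m / 2) (u t) φ < ε

end

end PeriodicWave

/-! The conserved functional `augmentedEnergy`, G(u) = E(u) + (ω/2)‖u‖² + A∫u, has φ as a critical
point and 𝓛 as its second variation there. Since 𝓛 has a single negative direction and kernel
spanned by φ', φ minimises G modulo translations as soon as a conserved constraint excludes that
direction. The identity 𝓛1 = ω − φ supplies the constraint: (𝓛1, 1) = ωL − M(φ) < 0 makes 1 a
negative vector, while 𝓛1 is minus the gradient at φ of the conserved `momentum`, ½‖u‖² − ω∫u. No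
curve of waves parametrised by ω is needed.

Coercivity: if the Rayleigh quotient of 𝓛 had a minimum ≤ 0 on the vectors orthogonal to 𝓛1 and to
some ψ with (ψ, φ') ≠ 0, the minimiser and 1 would span a plane on which the form is nonpositive.
This plane meets the orthogonal complement of the negative eigenvector, where the form is
nonnegative, and the minimiser would be a multiple of φ', contradicting the condition on ψ
(`coercive_of_index_one`, `SymbolBounds.energyForm_coercive`). Minimisers exist by Rellich
compactness, and Gårding's inequality lifts the bound from L² to H^{m/2}.

Nonlinear step: at the nearest translate of φ the displacement h is orthogonal to ψ = (1 −
∂²)^{m/2}φ', with ∂ normalised to have symbol ik. Conservation of momentum makes (𝓛1, h) of order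
‖h‖², and G(φ + h) − G(φ) = ½(𝓛h, h) − ⅙∫h³. The cubic term is O(‖h‖³) by the embedding of H^{1/6}
in L³, proved on the Fourier side (`norm_mean_cube_trigPoly_le`); this is where m ≥ 1/3 matters. So
G has a barrier on each small sphere around the orbit (`SymbolBounds.exists_barrier`), and a
continuous trajectory cannot cross it.

Dynamics: energy and L² norm are shown to be conserved for smooth solutions only, by differentiating
Fourier truncations of the functionals and letting the cut-off tend to infinity. Rough data are
reached by density and continuous dependence. -/

namespace PeriodicWave

noncomputable section

variable {L : ℝ} [Fact (0 < L)]

/-! ### Fourier coefficients of real square integrable functions -/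

theorem period_pos (L : ℝ) [h : Fact (0 < L)] : 0 < L := h.out

/-- Elements of `L2per` live on the measure of mass L, whereas `fourierCoeff` integrates against the
normalised Haar measure; the two have the same null sets. -/
theorem ae_haar {p : AddCircle L → Prop} (h : ∀ᵐ x : AddCircle L, p x) :
    ∀ᵐ x ∂(AddCircle.haarAddCircle : Measure (AddCircle L)), p x := by
  rw [AddCircle.volume_eq_smul_haarAddCircle] at h
  exact (Measure.ae_ennreal_smul_measure_iff (by simpa using period_pos L)).1 h

theorem memLp_ofReal (u : L2per L) :
    MemLp (fun x : AddCircle L => ((u x : ℝ) : ℂ)) 2 AddCircle.haarAddCircle :=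
  (Lp.memLp u).ofReal.haarAddCircle

/-- A real `L²` function as a complex `L²` function for the normalised measure. -/
def complexify (u : L2per L) : Lp ℂ 2 (AddCircle.haarAddCircle : Measure (AddCircle L)) :=
  (memLp_ofReal u).toLp

theorem complexify_ae (u : L2per L) :
    complexify u =ᵐ[AddCircle.haarAddCircle] fun x => ((u x : ℝ) : ℂ) :=
  (memLp_ofReal u).coeFn_toLp

theorem coeff_eq_fourierCoeff (u : L2per L) (k : ℤ) : coeff u k = fourierCoeff (complexify u) k :=
  (congrFun (fourierCoeff_congr_ae (complexify_ae u)) k).symm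

theorem integrable_ofReal (u : L2per L) :
    Integrable (fun x : AddCircle L => ((u x : ℝ) : ℂ)) AddCircle.haarAddCircle :=
  (memLp_ofReal u).integrable (by norm_num)

theorem fourierCoeff_congr {f g : AddCircle L → ℂ} (h : ∀ᵐ x : AddCircle L, f x = g x) (k : ℤ) :
    fourierCoeff f k = fourierCoeff g k :=
  congrFun (fourierCoeff_congr_ae (ae_haar h)) k

theorem coeff_add (u v : L2per L) (k : ℤ) : coeff (u + v) k = coeff u k + coeff v k := by
  have h := congrFun (fourierCoeff.add (integrable_ofReal u) (integrable_ofReal v)) k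
  rw [Pi.add_apply] at h
  rw [coeff, coeff, coeff, ← h]
  refine fourierCoeff_congr ?_ k
  filter_upwards [Lp.coeFn_add u v] with x hx
  rw [hx, Pi.add_apply, Pi.add_apply, Complex.ofReal_add]

theorem coeff_smul (c : ℝ) (u : L2per L) (k : ℤ) : coeff (c • u) k = c * coeff u k := by
  rw [coeff, coeff, ← fourierCoeff.const_mul]
  refine fourierCoeff_congr ?_ k
  filter_upwards [Lp.coeFn_smul c u] with x hx
  rw [hx, Pi.smul_apply, smul_eq_mul, Complex.ofReal_mul]

theorem coeff_neg_fun (u : L2per L) (k : ℤ) : coeff (-u) k = -coeff u k := by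
  rw [← neg_one_smul ℝ, coeff_smul]; simp

theorem coeff_sub (u v : L2per L) (k : ℤ) : coeff (u - v) k = coeff u k - coeff v k := by
  rw [sub_eq_add_neg, coeff_add, coeff_neg_fun, sub_eq_add_neg]

theorem coeff_zero_fun (k : ℤ) : coeff (0 : L2per L) k = 0 := by
  rw [← zero_smul ℝ (0 : L2per L), coeff_smul]; simp

theorem fourierCoeff_conj (f : AddCircle L → ℂ) (k : ℤ) :
    fourierCoeff (fun x => (starRingEnd ℂ) (f x)) k = (starRingEnd ℂ) (fourierCoeff f (-k)) := by
  rw [fourierCoeff, fourierCoeff, ← integral_conj]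
  refine integral_congr_ae (ae_of_all _ fun x => ?_)
  simp only [smul_eq_mul, map_mul, neg_neg, fourier_neg]

/-- The Fourier coefficients of a real function are conjugate symmetric. -/
theorem coeff_neg (u : L2per L) (k : ℤ) : coeff u (-k) = (starRingEnd ℂ) (coeff u k) := by
  rw [← neg_neg k, coeff, coeff, ← fourierCoeff_conj, neg_neg]
  simp

theorem inner_eq_integral (u v : L2per L) : inner ℝ u v = ∫ x : AddCircle L, u x * v x := by
  rw [L2.inner_def]
  refine integral_congr_ae (ae_of_all _ fun x => ?_)
  simp [mul_comm]

theorem norm_sq_eq_integral (u : L2per L) : ‖u‖ ^ 2 = ∫ x : AddCircle L, u x ^ 2 := by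
  rw [← real_inner_self_eq_norm_sq, inner_eq_integral]
  simp only [sq]

/-- **Parseval's identity** for real functions. -/
theorem hasSum_normSq_coeff (u : L2per L) :
    HasSum (fun k : ℤ => L * ‖coeff u k‖ ^ 2) (‖u‖ ^ 2) := by
  have h := (hasSum_sq_fourierCoeff (complexify u)).mul_left L
  simp only [← coeff_eq_fourierCoeff] at h
  convert! h using 1
  have : ∫ t : AddCircle L, ‖complexify u t‖ ^ 2 ∂AddCircle.haarAddCircle
      = ∫ t : AddCircle L, u t ^ 2 ∂AddCircle.haarAddCircle := by
    refine integral_congr_ae ?_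
    filter_upwards [complexify_ae u] with x hx
    simp [hx]
  rw [this, AddCircle.integral_haarAddCircle, norm_sq_eq_integral, smul_eq_mul,
    mul_inv_cancel_left₀ (period_pos L).ne']

theorem summable_normSq_coeff (u : L2per L) : Summable fun k : ℤ => ‖coeff u k‖ ^ 2 := by
  have h := (hasSum_normSq_coeff u).summable
  exact (summable_mul_left_iff (period_pos L).ne').1 h

theorem re_mul_conj_eq (a b : ℂ) :
    (a * (starRingEnd ℂ) b).re = (‖a + b‖ ^ 2 - ‖a‖ ^ 2 - ‖b‖ ^ 2) / 2 := by
  simp only [← Complex.normSq_eq_norm_sq, Complex.normSq_apply, Complex.mul_re, Complex.conj_re,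
    Complex.conj_im, Complex.add_re, Complex.add_im]
  ring

/-- Polarisation of Parseval's identity. -/
theorem hasSum_inner_coeff (u v : L2per L) :
    HasSum (fun k : ℤ => L * (coeff u k * (starRingEnd ℂ) (coeff v k)).re) (inner ℝ u v) := by
  have h := (((hasSum_normSq_coeff (u + v)).sub (hasSum_normSq_coeff u)).sub
    (hasSum_normSq_coeff v)).div_const 2
  convert! h using 1
  · funext k
    rw [re_mul_conj_eq, coeff_add]
    ring
  · rw [norm_add_sq_real]
    ring

theorem ext_coeff {u v : L2per L} (h : ∀ k, coeff u k = coeff v k) : u = v := by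
  have h0 := hasSum_normSq_coeff (u - v)
  have : (fun k : ℤ => L * ‖coeff (u - v) k‖ ^ 2) = fun _ => 0 := by
    funext k
    simp [coeff_sub, h k]
  rw [this] at h0
  have := h0.unique hasSum_zero
  rw [← sub_eq_zero]
  simpa using this

theorem norm_coeff_le (u : L2per L) (k : ℤ) : L * ‖coeff u k‖ ^ 2 ≤ ‖u‖ ^ 2 :=
  le_hasSum (hasSum_normSq_coeff u) k fun _ _ => mul_nonneg (period_pos L).le (sq_nonneg _)

/-- Every conjugate symmetric square summable sequence is the sequence of Fourier coefficients of a
real `L²` function. -/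
theorem exists_coeff_eq (c : ℤ → ℂ) (hc : ∀ k, c (-k) = (starRingEnd ℂ) (c k))
    (hs : Summable fun k => ‖c k‖ ^ 2) : ∃ u : L2per L, ∀ k, coeff u k = c k := by
  have hm : Memℓp c 2 := by
    rw [memℓp_gen_iff (by norm_num)]
    simpa using hs
  set f := (fourierBasis (T := L)).repr.symm ⟨c, hm⟩ with hf
  have hfc : ∀ k, fourierCoeff f k = c k := fun k => by
    rw [← fourierBasis_repr, hf, LinearIsometryEquiv.apply_symm_apply]
  -- The function with the prescribed coefficients is a priori complex. Conjugate symmetry of `c`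
  -- means that f and its conjugate have the same coefficients, so the real part has them too.
  have hfm : MemLp (fun x => (f x).re) 2 (volume : Measure (AddCircle L)) :=
    (Lp.memLp f).of_haarAddCircle.re
  refine ⟨hfm.toLp, fun k => ?_⟩
  have hfi : Integrable f (AddCircle.haarAddCircle : Measure (AddCircle L)) :=
    (Lp.memLp f).integrable (by norm_num)
  have hfi' : Integrable (fun x => (starRingEnd ℂ) (f x))
      (AddCircle.haarAddCircle : Measure (AddCircle L)) :=
    (LinearIsometryEquiv.integrable_comp_iff Complex.conjLIE).2 hfi
  have h1 := congrFun (fourierCoeff.add hfi hfi') k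
  rw [Pi.add_apply, fourierCoeff_conj, hfc, hfc, hc, Complex.conj_conj] at h1
  have h2 : coeff hfm.toLp k
      = (1 / 2 : ℂ) * fourierCoeff ((f : AddCircle L → ℂ) + fun x => (starRingEnd ℂ) (f x)) k := by
    rw [coeff, ← fourierCoeff.const_mul]
    refine fourierCoeff_congr ?_ k
    filter_upwards [hfm.coeFn_toLp] with x hx
    rw [hx, Pi.add_apply, Complex.add_conj]
    push_cast
    ring
  rw [h2, h1]
  ring

/-! ### Continuous functions on the circle as elements of `L²` -/

/-- A real continuous function on the circle as an element of `L²`. -/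
def ofCont (f : C(AddCircle L, ℝ)) : L2per L := ContinuousMap.toLp 2 volume ℝ f

theorem ofCont_ae (f : C(AddCircle L, ℝ)) : ∀ᵐ x : AddCircle L, ofCont f x = f x :=
  ContinuousMap.coeFn_toLp _ f

theorem coeff_ofCont (f : C(AddCircle L, ℝ)) (k : ℤ) :
    coeff (ofCont f) k = fourierCoeff (fun x => ((f x : ℝ) : ℂ)) k := by
  refine fourierCoeff_congr ?_ k
  filter_upwards [ofCont_ae f] with x hx
  rw [hx]

theorem eq_of_ae {u v : L2per L} (h : ∀ᵐ x : AddCircle L, u x = v x) : u = v := Lp.ext h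

theorem memLp_cont_mul (f : C(AddCircle L, ℝ)) (u : L2per L) :
    MemLp (fun x : AddCircle L => f x * u x) 2 volume := by
  refine (Lp.memLp u).of_le_mul (c := ‖f‖)
    (f.continuous.aestronglyMeasurable.mul (Lp.aestronglyMeasurable u)) (ae_of_all _ fun x => ?_)
  rw [norm_mul]
  exact mul_le_mul_of_nonneg_right (f.norm_coe_le_norm x) (norm_nonneg _)

/-- Multiplication by a continuous function as a bounded operator on `L²`. -/
def mulCont (f : C(AddCircle L, ℝ)) : L2per L →L[ℝ] L2per L :=
  LinearMap.mkContinuous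
    { toFun := fun u => (memLp_cont_mul f u).toLp
      map_add' := fun u v => by
        refine eq_of_ae ?_
        filter_upwards [(memLp_cont_mul f (u + v)).coeFn_toLp, (memLp_cont_mul f u).coeFn_toLp,
          (memLp_cont_mul f v).coeFn_toLp, Lp.coeFn_add u v,
          Lp.coeFn_add (memLp_cont_mul f u).toLp (memLp_cont_mul f v).toLp] with x h1 h2 h3 h4 h5
        rw [h5, Pi.add_apply, h1, h2, h3, h4, Pi.add_apply, mul_add]
      map_smul' := fun c u => by
        refine eq_of_ae ?_
        filter_upwards [(memLp_cont_mul f (c • u)).coeFn_toLp, (memLp_cont_mul f u).coeFn_toLp,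
          Lp.coeFn_smul c u, Lp.coeFn_smul c (memLp_cont_mul f u).toLp] with x h1 h2 h3 h4
        simp only [RingHom.id_apply]
        rw [h4, Pi.smul_apply, h1, h2, h3, Pi.smul_apply, smul_eq_mul, smul_eq_mul]
        ring }
    ‖f‖ fun u => by
      refine Lp.norm_le_mul_norm_of_ae_le_mul ?_
      filter_upwards [(memLp_cont_mul f u).coeFn_toLp] with x hx
      simp only [LinearMap.coe_mk, AddHom.coe_mk]
      rw [hx, norm_mul]
      exact mul_le_mul_of_nonneg_right (f.norm_coe_le_norm x) (norm_nonneg _)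

theorem mulCont_ae (f : C(AddCircle L, ℝ)) (u : L2per L) :
    ∀ᵐ x : AddCircle L, mulCont f u x = f x * u x :=
  (memLp_cont_mul f u).coeFn_toLp

theorem inner_mulCont (f : C(AddCircle L, ℝ)) (u v : L2per L) :
    inner ℝ (mulCont f u) v = ∫ x : AddCircle L, f x * (u x * v x) := by
  rw [inner_eq_integral]
  refine integral_congr_ae ?_
  filter_upwards [mulCont_ae f u] with x hx
  rw [hx, mul_assoc]

theorem inner_mulCont_comm (f : C(AddCircle L, ℝ)) (u v : L2per L) :
    inner ℝ (mulCont f u) v = inner ℝ u (mulCont f v) := by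
  rw [real_inner_comm (mulCont f v), inner_mulCont, inner_mulCont]
  simp only [mul_comm]

theorem mulCont_ofCont (f g : C(AddCircle L, ℝ)) : mulCont f (ofCont g) = ofCont (f * g) := by
  refine eq_of_ae ?_
  filter_upwards [mulCont_ae f (ofCont g), ofCont_ae g, ofCont_ae (f * g)] with x h1 h2 h3
  rw [h1, h2, h3, ContinuousMap.mul_apply]

/-- The constant function `1`. -/
def oneL2 (L : ℝ) [Fact (0 < L)] : L2per L := ofCont 1

theorem oneL2_ae : ∀ᵐ x : AddCircle L, oneL2 L x = 1 := ofCont_ae 1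

theorem coeff_oneL2 (k : ℤ) : coeff (oneL2 L) k = if k = 0 then 1 else 0 := by
  have h := congrFun (fourierCoeff_fourier (T := L) 0) k
  rw [oneL2, coeff_ofCont]
  simp only [ContinuousMap.one_apply, Complex.ofReal_one]
  rw [Pi.single_apply] at h
  rw [← h]
  refine fourierCoeff_congr (ae_of_all _ fun x => ?_) k
  simp

theorem inner_oneL2 (u : L2per L) : inner ℝ u (oneL2 L) = ∫ x : AddCircle L, u x := by
  rw [inner_eq_integral]
  refine integral_congr_ae ?_
  filter_upwards [oneL2_ae (L := L)] with x hx
  rw [hx, mul_one]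

/-! ### Coercivity of a quadratic form of index one under a constraint -/

section Abstract

variable {E : Type*} [NormedAddCommGroup E] [InnerProductSpace ℝ E] {V : Submodule ℝ E}

/-- A symmetric form that is nonnegative on a subspace vanishes against its null vectors there. -/
theorem apply_eq_zero_of_isotropic (R : V →ₗ[ℝ] V →ₗ[ℝ] ℝ) (hsymm : ∀ x y, R x y = R y x)
    (Y : Submodule ℝ V) (hpos : ∀ y ∈ Y, 0 ≤ R y y) {v : V} (hv : v ∈ Y) (hvv : R v v = 0)
    {w : V} (hw : w ∈ Y) : R v w = 0 := by
  -- Because R(v, v) = 0, the form at w + tv is affine in t; being bounded below, it must have slope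
  -- zero. The value of t chosen below would make it equal to −1.
  have key : ∀ t : ℝ, 0 ≤ R w w + 2 * t * R v w := fun t => by
    have h := hpos (w + t • v) (Y.add_mem hw (Y.smul_mem t hv))
    simp only [map_add, map_smul, LinearMap.add_apply, LinearMap.smul_apply, smul_eq_mul] at h
    rw [hvv, hsymm w v] at h
    linarith
  by_contra hne
  have h := key (-(R w w + 1) / (2 * R v w))
  have : 2 * (-(R w w + 1) / (2 * R v w)) * R v w = -(R w w + 1) := by
    field_simp
  linarith

/-- The inner product of `E` as a form on `V`. -/
def innerForm (V : Submodule ℝ E) : V →ₗ[ℝ] V →ₗ[ℝ] ℝ :=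
  LinearMap.mk₂ ℝ (fun x y => inner ℝ (x : E) y)
    (fun x y z => by simp [inner_add_left]) (fun c x y => by simp [inner_smul_left])
    (fun x y z => by simp [inner_add_right]) (fun c x y => by simp [inner_smul_right])

theorem innerForm_apply (x y : V) : innerForm V x y = inner ℝ (x : E) (y : E) := rfl

/-- The vectors of `V` orthogonal to `a`. -/
def orthTo (V : Submodule ℝ E) (a : E) : Submodule ℝ V where
  carrier := {v | inner ℝ a (v : E) = 0}
  add_mem' := fun {x y} hx hy => by
    simp only [Set.mem_ofPred_eq] at hx hy ⊢
    simp [inner_add_right, hx, hy]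
  zero_mem' := by simp
  smul_mem' := fun c x hx => by
    simp only [Set.mem_ofPred_eq] at hx ⊢
    simp [inner_smul_right, hx]

theorem mem_orthTo {a : E} {v : V} : v ∈ orthTo V a ↔ inner ℝ a (v : E) = 0 := Iff.rfl

/-- The quotients `Q(v, v) / ‖v‖²` attain their infimum on the vectors of `V` orthogonal to any two
given vectors. -/
def HasConstrainedMinimizers (Q : V →ₗ[ℝ] V →ₗ[ℝ] ℝ) : Prop :=
  ∀ a b : E, (∃ v : V, v ≠ 0 ∧ v ∈ orthTo V a ⊓ orthTo V b) →
    ∃ v : V, v ≠ 0 ∧ v ∈ orthTo V a ⊓ orthTo V b ∧ ∃ μ : ℝ, Q v v = μ * ‖(v : E)‖ ^ 2 ∧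
      ∀ w ∈ orthTo V a ⊓ orthTo V b, μ * ‖(w : E)‖ ^ 2 ≤ Q w w

variable {Q : V →ₗ[ℝ] V →ₗ[ℝ] ℝ}

/-- A vector that is stationary on the orthogonal complement of an eigenvector is an eigenvector. -/
theorem eigen_of_eigen_on_orthTo (hsymm : ∀ x y, Q x y = Q y x) {lam μ : ℝ} {χ v : V} (hχ : χ ≠ 0)
    (hχe : ∀ w, Q χ w = lam * inner ℝ (χ : E) (w : E)) (hv : v ∈ orthTo V (χ : E))
    (h : ∀ w ∈ orthTo V (χ : E), Q v w = μ * inner ℝ (v : E) (w : E)) (w : V) :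
    Q v w = μ * inner ℝ (v : E) (w : E) := by
  have hn : ‖(χ : E)‖ ^ 2 ≠ 0 := by simpa using hχ
  -- Removing the χ-component of w changes neither side: v is orthogonal to χ, and Q(v, χ) = lam (χ,
  -- v) = 0.
  set c := inner ℝ (χ : E) (w : E) / ‖(χ : E)‖ ^ 2 with hc
  have hw : w - c • χ ∈ orthTo V (χ : E) := by
    rw [mem_orthTo]
    simp only [Submodule.coe_sub, Submodule.coe_smul, inner_sub_right, inner_smul_right,
      real_inner_self_eq_norm_sq]
    rw [hc, div_mul_cancel₀ _ hn, sub_self]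
  have h1 := h _ hw
  have h2 : inner ℝ (v : E) (χ : E) = 0 := by rw [real_inner_comm]; exact hv
  have h3 : Q v χ = 0 := by rw [hsymm, hχe, real_inner_comm, h2, mul_zero]
  simp only [map_sub, map_smul, Submodule.coe_sub, Submodule.coe_smul, inner_sub_right,
    inner_smul_right, h2, h3, smul_eq_mul, mul_zero, sub_zero] at h1
  exact h1

variable (hsymm : ∀ x y, Q x y = Q y x) (hmin : HasConstrainedMinimizers Q)
  {lam : ℝ} {χ : V} (hχ : χ ≠ 0) (hχe : ∀ w, Q χ w = lam * inner ℝ (χ : E) (w : E))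
  (huniq : ∀ μ < 0, ∀ v : V, (∀ w, Q v w = μ * inner ℝ (v : E) (w : E)) → ∃ c : ℝ, v = c • χ)

include hsymm hmin hχ hχe huniq

/-- If the negative eigenvalue is unique and simple, the form is nonnegative on the orthogonal
complement of its eigenvector. -/
theorem nonneg_on_orthTo {w : V} (hw : w ∈ orthTo V (χ : E)) : 0 ≤ Q w w := by
  by_cases hw0 : w = 0
  · simp [hw0]
  -- Repeating χ reduces the two constraints to one. If the minimum μ were negative, Q − μ(·,·)
  -- would be nonnegative on the complement of χ and vanish at v, so v would be an eigenvector for μ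
  -- < 0, hence both parallel and orthogonal to χ.
  obtain ⟨v, hv0, hv, μ, hvμ, hμ⟩ := hmin χ χ ⟨w, hw0, hw, hw⟩
  have hn : ‖(χ : E)‖ ^ 2 ≠ 0 := by simpa using hχ
  have hμ0 : 0 ≤ μ := by
    by_contra hlt
    push Not at hlt
    have hst : ∀ w ∈ orthTo V (χ : E), Q v w = μ * inner ℝ (v : E) (w : E) := fun w hw => by
      have := apply_eq_zero_of_isotropic (Q - μ • innerForm V)
        (fun x y => by
          simp only [LinearMap.sub_apply, LinearMap.smul_apply, innerForm_apply]
          rw [hsymm, real_inner_comm])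
        (orthTo V (χ : E))
        (fun y hy => by
          have := hμ y ⟨hy, hy⟩
          simp only [LinearMap.sub_apply, LinearMap.smul_apply, innerForm_apply,
            real_inner_self_eq_norm_sq, smul_eq_mul]
          linarith) hv.1
        (by
          simp only [LinearMap.sub_apply, LinearMap.smul_apply, innerForm_apply,
            real_inner_self_eq_norm_sq, smul_eq_mul]
          linarith) hw
      simp only [LinearMap.sub_apply, LinearMap.smul_apply, innerForm_apply, smul_eq_mul] at this
      linarith
    obtain ⟨c, hc⟩ := huniq μ hlt v (eigen_of_eigen_on_orthTo hsymm hχ hχe hv.1 hst)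
    have h2 : inner ℝ (χ : E) (v : E) = 0 := hv.1
    rw [hc, Submodule.coe_smul, inner_smul_right, real_inner_self_eq_norm_sq] at h2
    rcases mul_eq_zero.1 h2 with h | h
    · exact hv0 (by rw [hc, h, zero_smul])
    · exact hn h
  exact (mul_nonneg hμ0 (sq_nonneg _)).trans (hμ w ⟨hw, hw⟩)

/-- Isotropic vectors orthogonal to the negative eigenvector lie in the kernel of the form. -/
theorem kernel_of_isotropic {v : V} (hv : v ∈ orthTo V (χ : E)) (hvv : Q v v = 0) (w : V) :
    Q v w = 0 := by
  have h := eigen_of_eigen_on_orthTo (μ := 0) hsymm hχ hχe hv (fun w hw => by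
    rw [zero_mul]
    exact apply_eq_zero_of_isotropic Q hsymm _
      (fun y hy => nonneg_on_orthTo hsymm hmin hχ hχe huniq hy) hv hvv hw) w
  rwa [zero_mul] at h

/-- Coercivity of a form of index one with one-dimensional kernel, under the constraints dual to a
negative vector and transversal to the kernel. -/
theorem coercive_of_index_one {p e : V} {z ψ : E}
    (hker : ∀ v : V, (∀ w, Q v w = 0) → ∃ c : ℝ, v = c • p)
    (hez : ∀ w, Q e w = inner ℝ z (w : E)) (hee : Q e e < 0) (hpψ : inner ℝ ψ (p : E) ≠ 0) :
    ∃ c > 0, ∀ w ∈ orthTo V z ⊓ orthTo V ψ, c * ‖(w : E)‖ ^ 2 ≤ Q w w := by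
  by_cases hex : ∃ v : V, v ≠ 0 ∧ v ∈ orthTo V z ⊓ orthTo V ψ
  swap
  · refine ⟨1, one_pos, fun w hw => ?_⟩
    have : w = 0 := by
      by_contra h
      exact hex ⟨w, h, hw⟩
    simp [this]
  obtain ⟨v, hv0, hv, μ, hvμ, hμ⟩ := hmin z ψ hex
  have hvn : 0 < ‖(v : E)‖ ^ 2 := by
    have : (v : E) ≠ 0 := by simpa using hv0
    positivity
  refine ⟨μ, ?_, hμ⟩
  by_contra hle
  push Not at hle
  have hQv : Q v v ≤ 0 := by rw [hvμ]; exact mul_nonpos_of_nonpos_of_nonneg hle hvn.le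
  have hev : Q e v = 0 := by rw [hez]; exact hv.1
  set α := inner ℝ (χ : E) (v : E) with hα
  set β := inner ℝ (χ : E) (e : E) with hβ
  have hQ : ∀ a b : ℝ, Q (a • e + b • v) (a • e + b • v) = a ^ 2 * Q e e + b ^ 2 * Q v v :=
    fun a b => by
      simp only [map_add, map_smul, LinearMap.add_apply, LinearMap.smul_apply, smul_eq_mul]
      rw [hsymm v e, hev]
      ring
  -- The plane spanned by `e` and `v` is diagonal for Q with Q ≤ 0 on it. This combination is its
  -- intersection with the complement of χ, where Q ≥ 0; since Q(e, e) < 0, the coefficient α must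
  -- vanish.
  have hmem : α • e + (-β) • v ∈ orthTo V (χ : E) := by
    rw [mem_orthTo]
    simp only [Submodule.coe_add, Submodule.coe_smul, inner_add_right, inner_smul_right]
    rw [← hα, ← hβ]
    ring
  have hge := nonneg_on_orthTo hsymm hmin hχ hχe huniq hmem
  rw [hQ] at hge
  have hα0 : α = 0 := by
    by_contra h
    have : 0 < α ^ 2 := by positivity
    nlinarith [mul_nonpos_of_nonneg_of_nonpos (sq_nonneg (-β)) hQv,
      mul_neg_of_pos_of_neg this hee]
  have hvχ : v ∈ orthTo V (χ : E) := hα0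
  have hQv0 : Q v v = 0 := le_antisymm hQv (nonneg_on_orthTo hsymm hmin hχ hχe huniq hvχ)
  obtain ⟨c, hc⟩ := hker v (kernel_of_isotropic hsymm hmin hχ hχe huniq hvχ hQv0)
  have h2 : inner ℝ ψ (v : E) = 0 := hv.2
  rw [hc, Submodule.coe_smul, inner_smul_right] at h2
  rcases mul_eq_zero.1 h2 with h | h
  · exact hv0 (by rw [hc, h, zero_smul])
  · exact hpψ h

end Abstract

/-! ### Sobolev spaces -/

/-- The Sobolev weight `(1 + k²)ˢ`. -/
def weight (s : ℝ) (k : ℤ) : ℝ := (1 + (k : ℝ) ^ 2) ^ s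

theorem weight_pos (s : ℝ) (k : ℤ) : 0 < weight s k := Real.rpow_pos_of_pos (by positivity) s

theorem one_le_weight {s : ℝ} (hs : 0 ≤ s) (k : ℤ) : 1 ≤ weight s k :=
  Real.one_le_rpow (by nlinarith [sq_nonneg (k : ℝ)]) hs

theorem weight_mono {s t : ℝ} (h : s ≤ t) (k : ℤ) : weight s k ≤ weight t k :=
  Real.rpow_le_rpow_of_exponent_le (by nlinarith [sq_nonneg (k : ℝ)]) h

theorem weight_add (s t : ℝ) (k : ℤ) : weight (s + t) k = weight s k * weight t k :=
  Real.rpow_add (by positivity) s t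

theorem weight_half_sq (s : ℝ) (k : ℤ) : weight (s / 2) k ^ 2 = weight s k := by
  rw [sq, ← weight_add, add_halves]

theorem weight_neg_index (s : ℝ) (k : ℤ) : weight s (-k) = weight s k := by
  simp [weight]

theorem tendsto_weight {s : ℝ} (hs : 0 < s) : Tendsto (weight s) cofinite atTop := by
  have h1 : Tendsto (fun k : ℤ => 1 + (k : ℝ) ^ 2) cofinite atTop := by
    refine tendsto_atTop_add_const_left _ _ ?_
    have h2 : Tendsto (fun k : ℤ => ‖(k : ℝ)‖) cofinite atTop :=
      tendsto_norm_cocompact_atTop.comp Int.tendsto_coe_cofinite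
    refine ((tendsto_pow_atTop two_ne_zero).comp h2).congr fun k => ?_
    simp
  exact (tendsto_rpow_atTop hs).comp h1

theorem mem_Hs {s : ℝ} {u : L2per L} :
    u ∈ Hs L s ↔ Summable fun k => weight s k * ‖coeff u k‖ ^ 2 := Iff.rfl

theorem norm_add_sq_le_two_mul (a b : ℂ) : ‖a + b‖ ^ 2 ≤ 2 * ‖a‖ ^ 2 + 2 * ‖b‖ ^ 2 := by
  have h := norm_add_le a b
  have h0 := norm_nonneg (a + b)
  nlinarith [sq_nonneg (‖a‖ - ‖b‖)]

/-- `Hˢ` as a linear subspace of `L²`. -/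
def sobolevSpace (L : ℝ) [Fact (0 < L)] (s : ℝ) : Submodule ℝ (L2per L) where
  carrier := Hs L s
  add_mem' := fun {u v} hu hv => by
    rw [mem_Hs] at hu hv ⊢
    refine Summable.of_nonneg_of_le (fun k => mul_nonneg (weight_pos s k).le (sq_nonneg _))
      (fun k => ?_) ((hu.mul_left 2).add (hv.mul_left 2))
    rw [coeff_add]
    have := mul_le_mul_of_nonneg_left (norm_add_sq_le_two_mul (coeff u k) (coeff v k))
      (weight_pos s k).le
    linarith
  zero_mem' := by
    rw [mem_Hs]
    simp [coeff_zero_fun]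
  smul_mem' := fun c u hu => by
    rw [mem_Hs] at hu ⊢
    refine (hu.mul_left (c ^ 2)).congr fun k => ?_
    rw [coeff_smul, norm_mul, mul_pow]
    simp only [Complex.norm_real, Real.norm_eq_abs, sq_abs]
    ring

theorem Hs_sub {s : ℝ} {u v : L2per L} (hu : u ∈ Hs L s) (hv : v ∈ Hs L s) : u - v ∈ Hs L s :=
  (sobolevSpace L s).sub_mem hu hv

theorem Hs_add {s : ℝ} {u v : L2per L} (hu : u ∈ Hs L s) (hv : v ∈ Hs L s) : u + v ∈ Hs L s :=
  (sobolevSpace L s).add_mem hu hv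

theorem Hs_smul {s : ℝ} (c : ℝ) {u : L2per L} (hu : u ∈ Hs L s) : c • u ∈ Hs L s :=
  (sobolevSpace L s).smul_mem c hu

theorem Hs_mono {s t : ℝ} (h : s ≤ t) {u : L2per L} (hu : u ∈ Hs L t) : u ∈ Hs L s :=
  Summable.of_nonneg_of_le (fun k => mul_nonneg (weight_pos s k).le (sq_nonneg _))
    (fun k => mul_le_mul_of_nonneg_right (weight_mono h k) (sq_nonneg _)) hu

theorem hasSum_sobolevNorm_sq {s : ℝ} {u : L2per L} (hu : u ∈ Hs L s) :
    HasSum (fun k => L * (weight s k * ‖coeff u k‖ ^ 2)) (sobolevNorm s u ^ 2) := by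
  have h := (mem_Hs.1 hu).hasSum.mul_left L
  convert! h using 1
  exact Real.sq_sqrt (mul_nonneg (period_pos L).le
    (tsum_nonneg fun k => mul_nonneg (weight_pos s k).le (sq_nonneg _)))

theorem sobolevNorm_nonneg (s : ℝ) (u : L2per L) : 0 ≤ sobolevNorm s u := Real.sqrt_nonneg _

/-- The lift of `u ∈ Hˢ` to `L²` by the operator `(1 - ∂²)^{s/2}`. -/
theorem exists_lift {s : ℝ} {u : L2per L} (hu : u ∈ Hs L s) :
    ∃ a : L2per L, (∀ k, coeff a k = (weight (s / 2) k : ℝ) * coeff u k) ∧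
      ‖a‖ = sobolevNorm s u := by
  have hsq : ∀ k, ‖((weight (s / 2) k : ℝ) : ℂ) * coeff u k‖ ^ 2
      = weight s k * ‖coeff u k‖ ^ 2 := fun k => by
    rw [norm_mul, mul_pow, Complex.norm_real, Real.norm_eq_abs, sq_abs, weight_half_sq]
  obtain ⟨a, ha⟩ := exists_coeff_eq (L := L) (fun k => (weight (s / 2) k : ℝ) * coeff u k)
    (fun k => by rw [weight_neg_index, coeff_neg, map_mul, Complex.conj_ofReal])
    ((mem_Hs.1 hu).congr fun k => (hsq k).symm)
  refine ⟨a, ha, ?_⟩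
  have h1 := hasSum_normSq_coeff a
  simp only [ha, hsq] at h1
  have h2 := h1.unique (hasSum_sobolevNorm_sq hu)
  exact (sq_eq_sq₀ (norm_nonneg _) (sobolevNorm_nonneg s u)).1 h2

theorem sobolevNorm_add_le {s : ℝ} {u v : L2per L} (hu : u ∈ Hs L s) (hv : v ∈ Hs L s) :
    sobolevNorm s (u + v) ≤ sobolevNorm s u + sobolevNorm s v := by
  obtain ⟨a, ha, hna⟩ := exists_lift hu
  obtain ⟨b, hb, hnb⟩ := exists_lift hv
  obtain ⟨c, hc, hnc⟩ := exists_lift (Hs_add hu hv)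
  have : c = a + b := ext_coeff fun k => by
    rw [hc, coeff_add, coeff_add, ha, hb, mul_add]
  rw [← hna, ← hnb, ← hnc, this]
  exact norm_add_le a b

theorem sobolevNorm_smul {s : ℝ} (c : ℝ) {u : L2per L} (hu : u ∈ Hs L s) :
    sobolevNorm s (c • u) = |c| * sobolevNorm s u := by
  obtain ⟨a, ha, hna⟩ := exists_lift hu
  obtain ⟨b, hb, hnb⟩ := exists_lift (Hs_smul c hu)
  have : b = c • a := ext_coeff fun k => by
    rw [hb, coeff_smul, coeff_smul, ha]
    ring
  rw [← hna, ← hnb, this, norm_smul, Real.norm_eq_abs]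

theorem sobolevNorm_neg (s : ℝ) (u : L2per L) : sobolevNorm s (-u) = sobolevNorm s u := by
  simp only [sobolevNorm, coeff_neg_fun, norm_neg]

theorem sobolevNorm_sub_comm (s : ℝ) (u v : L2per L) :
    sobolevNorm s (u - v) = sobolevNorm s (v - u) := by
  rw [← sobolevNorm_neg, neg_sub]

theorem sobolevNorm_sub_le {s : ℝ} {u v w : L2per L} (hu : u ∈ Hs L s) (hv : v ∈ Hs L s)
    (hw : w ∈ Hs L s) : sobolevNorm s (u - w) ≤ sobolevNorm s (u - v) + sobolevNorm s (v - w) := by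
  rw [← sub_add_sub_cancel u v w]
  exact sobolevNorm_add_le (Hs_sub hu hv) (Hs_sub hv hw)

theorem sobolevNorm_mono {s t : ℝ} (h : s ≤ t) {u : L2per L} (hu : u ∈ Hs L t) :
    sobolevNorm s u ≤ sobolevNorm t u := by
  refine (sq_le_sq₀ (sobolevNorm_nonneg s u) (sobolevNorm_nonneg t u)).1 ?_
  exact hasSum_le (fun k => mul_le_mul_of_nonneg_left (mul_le_mul_of_nonneg_right
    (weight_mono h k) (sq_nonneg _)) (period_pos L).le)
    (hasSum_sobolevNorm_sq (Hs_mono h hu)) (hasSum_sobolevNorm_sq hu)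

theorem norm_le_sobolevNorm {s : ℝ} (hs : 0 ≤ s) {u : L2per L} (hu : u ∈ Hs L s) :
    ‖u‖ ≤ sobolevNorm s u := by
  refine (sq_le_sq₀ (norm_nonneg u) (sobolevNorm_nonneg s u)).1 ?_
  refine hasSum_le (fun k => ?_) (hasSum_normSq_coeff u) (hasSum_sobolevNorm_sq hu)
  refine mul_le_mul_of_nonneg_left ?_ (period_pos L).le
  exact le_mul_of_one_le_left (sq_nonneg _) (one_le_weight hs k)

theorem mem_Hs_of_finite {u : L2per L} {F : Finset ℤ} (h : ∀ k ∉ F, coeff u k = 0) (s : ℝ) :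
    u ∈ Hs L s :=
  mem_Hs.2 (summable_of_ne_finset_zero (s := F) fun k hk => by simp [h k hk])

theorem continuous_coeff (k : ℤ) : Continuous fun u : L2per L => coeff u k := by
  have hL := period_pos L
  refine LipschitzWith.continuous (K := Real.toNNReal (Real.sqrt L)⁻¹)
    (LipschitzWith.of_dist_le_mul fun u v => ?_)
  rw [Real.coe_toNNReal _ (by positivity), dist_eq_norm, dist_eq_norm, ← coeff_sub,
    ← div_eq_inv_mul, le_div_iff₀ (Real.sqrt_pos.2 hL)]
  refine (sq_le_sq₀ (by positivity) (norm_nonneg _)).1 ?_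
  rw [mul_pow, Real.sq_sqrt hL.le, mul_comm]
  exact norm_coeff_le (u - v) k

/-- **Rellich's theorem**: closed balls of `Hˢ`, `s > 0`, are compact in `L²`. -/
theorem isCompact_sobolevBall {s : ℝ} (hs : 0 < s) (R : ℝ) :
    IsCompact {u : L2per L | u ∈ Hs L s ∧ sobolevNorm s u ^ 2 ≤ R} := by
  have hL := period_pos L
  rw [isCompact_iff_ultrafilter_le_nhds]
  intro 𝒰 h𝒰
  have hmem : ∀ᶠ u in (𝒰 : Filter (L2per L)), u ∈ Hs L s ∧ sobolevNorm s u ^ 2 ≤ R :=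
    le_principal_iff.1 h𝒰
  -- Each coefficient is bounded on the ball, so it converges along the ultrafilter. The limits
  -- define the candidate u, and bounds on finite partial sums pass to the limit.
  have hlim : ∀ k, ∃ c : ℂ, Tendsto (fun u : L2per L => coeff u k) 𝒰 (𝓝 c) := fun k => by
    have hb : ((𝒰.map fun u : L2per L => coeff u k : Ultrafilter ℂ) : Filter ℂ)
        ≤ 𝓟 (Metric.closedBall 0 (Real.sqrt (R / L))) := by
      rw [le_principal_iff, Ultrafilter.coe_map, mem_map]
      filter_upwards [hmem] with u hu
      have h1 := (norm_coeff_le u k).trans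
        ((pow_le_pow_left₀ (norm_nonneg _) (norm_le_sobolevNorm hs.le hu.1) 2).trans hu.2)
      rw [Set.mem_preimage, mem_closedBall_zero_iff]
      refine Real.le_sqrt_of_sq_le ?_
      rwa [le_div_iff₀ hL, mul_comm]
    obtain ⟨c, -, hc⟩ := isCompact_iff_ultrafilter_le_nhds.1
      (isCompact_closedBall (0 : ℂ) (Real.sqrt (R / L))) _ hb
    exact ⟨c, hc⟩
  choose c hc using hlim
  have hfin : ∀ F : Finset ℤ, ∑ k ∈ F, L * (weight s k * ‖c k‖ ^ 2) ≤ R := fun F => by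
    refine le_of_tendsto (x := (𝒰 : Filter (L2per L)))
      (f := fun u => ∑ k ∈ F, L * (weight s k * ‖coeff u k‖ ^ 2))
      (tendsto_finsetSum F fun k _ => (((hc k).norm.pow 2).const_mul _).const_mul _) ?_
    filter_upwards [hmem] with u hu
    exact (sum_le_hasSum F (fun k _ => mul_nonneg hL.le (mul_nonneg (weight_pos s k).le
      (sq_nonneg _))) (hasSum_sobolevNorm_sq hu.1)).trans hu.2
  have hsum : Summable fun k => L * (weight s k * ‖c k‖ ^ 2) :=
    summable_of_sum_le (fun k => mul_nonneg hL.le (mul_nonneg (weight_pos s k).le (sq_nonneg _)))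
      hfin
  have hsum' : Summable fun k => weight s k * ‖c k‖ ^ 2 :=
    (summable_mul_left_iff hL.ne').1 hsum
  obtain ⟨u, hu⟩ := exists_coeff_eq (L := L) c
    (fun k => tendsto_nhds_unique (hc (-k)) (by
      simp only [coeff_neg]
      exact (Complex.continuous_conj.tendsto _).comp (hc k)))
    (Summable.of_nonneg_of_le (fun _ => sq_nonneg _)
      (fun k => le_mul_of_one_le_left (sq_nonneg _) (one_le_weight hs.le k)) hsum')
  have huH : u ∈ Hs L s := mem_Hs.2 (by simpa only [hu] using hsum')
  have huR : sobolevNorm s u ^ 2 ≤ R := by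
    refine hasSum_le_of_sum_le (hasSum_sobolevNorm_sq huH) fun F => ?_
    simpa only [hu] using hfin F
  have hR : 0 ≤ R := (sq_nonneg _).trans huR
  refine ⟨u, ⟨huH, huR⟩, ?_⟩
  have htend : Tendsto (fun v : L2per L => ‖v - u‖ ^ 2) 𝒰 (𝓝 0) := by
    rw [Metric.tendsto_nhds]
    intro ε hε
    -- Outside F the weights exceed M = 8R/ε + 1, so the tail of ‖v − u‖² is at most 4R/M ≤ ε/2. The
    -- summand 1 keeps M positive when R = 0.
    obtain ⟨F, hF⟩ : ∃ F : Finset ℤ, ∀ k ∉ F, 8 * R / ε + 1 ≤ weight s k := by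
      have h := (tendsto_weight hs).eventually_ge_atTop (8 * R / ε + 1)
      rw [eventually_cofinite] at h
      exact ⟨h.toFinset, fun k hk => by simpa using hk⟩
    set M := 8 * R / ε + 1 with hM
    have hM0 : 0 < M := by positivity
    have hlow : Tendsto (fun v : L2per L => ∑ k ∈ F, L * ‖coeff v k - c k‖ ^ 2) 𝒰 (𝓝 0) := by
      have h := tendsto_finsetSum (f := fun (k : ℤ) (v : L2per L) => L * ‖coeff v k - c k‖ ^ 2)
        (x := (𝒰 : Filter (L2per L))) (a := fun _ => 0) F fun k _ => by
          have h1 := (((hc k).sub_const (c k)).norm.pow 2).const_mul L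
          simpa using h1
      simpa using h
    filter_upwards [hmem, hlow.eventually (gt_mem_nhds (half_pos hε))] with v hv hvF
    have hd := Hs_sub hv.1 huH
    have h1 : ‖v - u‖ ^ 2 ≤ ∑ k ∈ F, L * ‖coeff v k - c k‖ ^ 2 + M⁻¹ * sobolevNorm s (v - u) ^ 2 := by
      have h2 : HasSum (fun k => if k ∈ F then L * ‖coeff v k - c k‖ ^ 2 else 0)
          (∑ k ∈ F, L * ‖coeff v k - c k‖ ^ 2) := by
        have h : HasSum (fun k => if k ∈ F then L * ‖coeff v k - c k‖ ^ 2 else 0)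
            (∑ k ∈ F, if k ∈ F then L * ‖coeff v k - c k‖ ^ 2 else 0) :=
          hasSum_sum_of_ne_finset_zero fun k hk => if_neg hk
        rwa [Finset.sum_congr rfl fun k hk => if_pos hk] at h
      refine hasSum_le (fun k => ?_) (hasSum_normSq_coeff (v - u))
        (h2.add ((hasSum_sobolevNorm_sq hd).mul_left M⁻¹))
      have hnn : 0 ≤ M⁻¹ * (L * (weight s k * ‖coeff (v - u) k‖ ^ 2)) :=
        mul_nonneg (inv_nonneg.2 hM0.le) (mul_nonneg hL.le (mul_nonneg (weight_pos s k).le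
          (sq_nonneg _)))
      by_cases hk : k ∈ F
      · rw [if_pos hk]
        have : L * ‖coeff (v - u) k‖ ^ 2 = L * ‖coeff v k - c k‖ ^ 2 := by rw [coeff_sub, hu]
        linarith
      · rw [if_neg hk, zero_add, ← div_eq_inv_mul, le_div_iff₀ hM0]
        have := hF k hk
        have h3 : 0 ≤ L * ‖coeff (v - u) k‖ ^ 2 := by positivity
        nlinarith
    have h4 : sobolevNorm s (v - u) ^ 2 ≤ 4 * R := by
      have h5 : sobolevNorm s (v - u) ≤ sobolevNorm s v + sobolevNorm s u := by
        have := sobolevNorm_add_le hv.1 ((sobolevSpace L s).neg_mem huH)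
        rwa [sobolevNorm_neg, ← sub_eq_add_neg] at this
      nlinarith [sq_nonneg (sobolevNorm s v - sobolevNorm s u), hv.2, huR,
        sobolevNorm_nonneg s (v - u), sobolevNorm_nonneg s v, sobolevNorm_nonneg s u]
    have h6 : M⁻¹ * (4 * R) ≤ ε / 2 := by
      rw [← div_eq_inv_mul, div_le_iff₀ hM0, hM]
      have : ε / 2 * (8 * R / ε + 1) = 4 * R + ε / 2 := by field_simp; ring
      linarith
    have h7 := mul_le_mul_of_nonneg_left h4 (inv_nonneg.2 hM0.le)
    rw [Real.dist_eq, sub_zero, abs_of_nonneg (sq_nonneg _)]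
    linarith
  have hnorm : Tendsto (fun v : L2per L => ‖v - u‖) 𝒰 (𝓝 0) := by
    have h := (Real.continuous_sqrt.tendsto 0).comp htend
    simpa [Function.comp_def, Real.sqrt_sq] using h
  exact tendsto_iff_norm_sub_tendsto_zero.2 hnorm

/-! ### Quadratic forms given by a Fourier symbol and a bounded operator -/

/-- The sesquilinear pairing with symbol `w`, restricted to real functions. -/
def symbolForm (w : ℤ → ℝ) (u v : L2per L) : ℝ :=
  ∑' k, L * (w k * (coeff u k * (starRingEnd ℂ) (coeff v k)).re)

theorem abs_re_mul_conj_le (a b : ℂ) : |(a * (starRingEnd ℂ) b).re| ≤ ‖a‖ ^ 2 + ‖b‖ ^ 2 := by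
  have h := Complex.abs_re_le_norm (a * (starRingEnd ℂ) b)
  rw [norm_mul, RCLike.norm_conj] at h
  nlinarith [sq_nonneg (‖a‖ - ‖b‖), sq_nonneg (‖a‖ + ‖b‖)]

theorem re_mul_conj_self (a : ℂ) : (a * (starRingEnd ℂ) a).re = ‖a‖ ^ 2 := by
  rw [Complex.mul_conj, Complex.ofReal_re, Complex.normSq_eq_norm_sq]

theorem re_mul_conj_comm (a b : ℂ) :
    (a * (starRingEnd ℂ) b).re = (b * (starRingEnd ℂ) a).re := by
  simp only [Complex.mul_re, Complex.conj_re, Complex.conj_im]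
  ring

section Symbol

variable {w : ℤ → ℝ} {s C : ℝ} (hw : ∀ k, |w k| ≤ C * weight s k)

include hw

theorem summable_symbolForm {u v : L2per L} (hu : u ∈ Hs L s) (hv : v ∈ Hs L s) :
    Summable fun k => L * (w k * (coeff u k * (starRingEnd ℂ) (coeff v k)).re) := by
  refine Summable.mul_left L (Summable.of_norm_bounded
    (((mem_Hs.1 hu).add (mem_Hs.1 hv)).mul_left C) fun k => ?_)
  rw [Real.norm_eq_abs, abs_mul, ← mul_add, ← mul_assoc]
  exact mul_le_mul (hw k) (abs_re_mul_conj_le _ _) (abs_nonneg _) ((abs_nonneg _).trans (hw k))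

theorem hasSum_symbolForm {u v : L2per L} (hu : u ∈ Hs L s) (hv : v ∈ Hs L s) :
    HasSum (fun k => L * (w k * (coeff u k * (starRingEnd ℂ) (coeff v k)).re)) (symbolForm w u v) :=
  (summable_symbolForm hw hu hv).hasSum

theorem hasSum_symbolForm_self {u : L2per L} (hu : u ∈ Hs L s) :
    HasSum (fun k => L * (w k * ‖coeff u k‖ ^ 2)) (symbolForm w u u) := by
  simpa only [re_mul_conj_self] using hasSum_symbolForm hw hu hu

omit hw in
theorem symbolForm_comm (u v : L2per L) : symbolForm w u v = symbolForm w v u :=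
  tsum_congr fun k => by rw [re_mul_conj_comm]

theorem symbolForm_add_left {u u' v : L2per L} (hu : u ∈ Hs L s) (hu' : u' ∈ Hs L s)
    (hv : v ∈ Hs L s) : symbolForm w (u + u') v = symbolForm w u v + symbolForm w u' v := by
  refine HasSum.tsum_eq ?_
  have h := (hasSum_symbolForm hw hu hv).add (hasSum_symbolForm hw hu' hv)
  refine h.congr_fun ?_
  intro k
  rw [coeff_add, add_mul, Complex.add_re]
  ring

omit hw in
theorem symbolForm_smul_left (c : ℝ) (u v : L2per L) :
    symbolForm w (c • u) v = c * symbolForm w u v := by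
  rw [symbolForm, symbolForm, ← tsum_mul_left]
  refine tsum_congr fun k => ?_
  rw [coeff_smul, mul_assoc, Complex.re_ofReal_mul]
  ring

theorem abs_symbolForm_self_le {u : L2per L} (hu : u ∈ Hs L s) :
    |symbolForm w u u| ≤ C * sobolevNorm s u ^ 2 := by
  have hL := period_pos L
  have h1 := hasSum_symbolForm_self hw hu
  have h2 := (hasSum_sobolevNorm_sq hu).mul_left C
  have key : ∀ k, |L * (w k * ‖coeff u k‖ ^ 2)| ≤ C * (L * (weight s k * ‖coeff u k‖ ^ 2)) :=
    fun k => by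
      rw [abs_mul, abs_mul, abs_of_pos hL, abs_of_nonneg (sq_nonneg ‖coeff u k‖)]
      have := mul_le_mul_of_nonneg_right (hw k) (mul_nonneg hL.le (sq_nonneg ‖coeff u k‖))
      linarith
  rw [abs_le]
  exact ⟨by
    rw [← neg_le_neg_iff, neg_neg]
    exact hasSum_le (fun k => (neg_le_abs _).trans (key k)) h1.neg h2,
    hasSum_le (fun k => (le_abs_self _).trans (key k)) h1 h2⟩

/-- The form `u, v ↦ (w(D) u, v) + (S u, v)` on `Hˢ`. -/
def quadForm (S : L2per L →L[ℝ] L2per L) : sobolevSpace L s →ₗ[ℝ] sobolevSpace L s →ₗ[ℝ] ℝ :=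
  LinearMap.mk₂ ℝ (fun u v => symbolForm w (u : L2per L) v + inner ℝ (S u) (v : L2per L))
    (fun x y z => by
      rw [Submodule.coe_add, symbolForm_add_left hw x.2 y.2 z.2, map_add, inner_add_left]; ring)
    (fun c x y => by
      rw [Submodule.coe_smul, symbolForm_smul_left, map_smul, real_inner_smul_left, smul_eq_mul]
      ring)
    (fun x y z => by
      rw [Submodule.coe_add, symbolForm_comm, symbolForm_add_left hw y.2 z.2 x.2, inner_add_right,
        symbolForm_comm, symbolForm_comm (z : L2per L)]; ring)
    (fun c x y => by
      rw [Submodule.coe_smul, symbolForm_comm, symbolForm_smul_left, real_inner_smul_right,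
        smul_eq_mul, symbolForm_comm]; ring)

theorem quadForm_apply (S : L2per L →L[ℝ] L2per L) (u v : sobolevSpace L s) :
    quadForm hw S u v = symbolForm w (u : L2per L) v + inner ℝ (S u) (v : L2per L) := rfl

theorem quadForm_symm {S : L2per L →L[ℝ] L2per L} (hS : ∀ u v, inner ℝ (S u) v = inner ℝ u (S v))
    (u v : sobolevSpace L s) : quadForm hw S u v = quadForm hw S v u := by
  rw [quadForm_apply, quadForm_apply, symbolForm_comm, hS, real_inner_comm]

omit hw in
theorem abs_inner_apply_le (S : L2per L →L[ℝ] L2per L) (u : L2per L) :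
    |inner ℝ (S u) u| ≤ ‖S‖ * ‖u‖ ^ 2 := by
  have h1 := abs_real_inner_le_norm (S u) u
  have h2 := mul_le_mul_of_nonneg_right (S.le_opNorm u) (norm_nonneg u)
  nlinarith

variable {A B : ℝ} (hw0 : ∀ k, 0 ≤ w k) (hAB : ∀ k, weight s k ≤ A + B * w k)

include hAB in
/-- **Gårding's inequality.** -/
theorem sobolevNorm_sq_le {u : L2per L} (hu : u ∈ Hs L s) :
    sobolevNorm s u ^ 2 ≤ A * ‖u‖ ^ 2 + B * symbolForm w u u := by
  refine hasSum_le (fun k => ?_) (hasSum_sobolevNorm_sq hu)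
    (((hasSum_normSq_coeff u).mul_left A).add ((hasSum_symbolForm_self hw hu).mul_left B))
  have := mul_le_mul_of_nonneg_right (hAB k)
    (mul_nonneg (period_pos L).le (sq_nonneg ‖coeff u k‖))
  linarith

include hw0 hAB in
-- The direct method. Gårding's inequality bounds a sublevel set of the form on the unit sphere in
-- Hˢ, Rellich's theorem makes it compact in L², and the form is lower semicontinuous for L²
-- convergence: the symbol part is a supremum of finite sums of nonnegative terms, the part from S
-- is continuous.
theorem hasConstrainedMinimizers (hs : 0 < s) (hB : 0 ≤ B) (S : L2per L →L[ℝ] L2per L) :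
    HasConstrainedMinimizers (quadForm hw S) := by
  have hL := period_pos L
  rintro a b ⟨v₀, hv₀, hv₀ab⟩
  set q : L2per L → ℝ := fun u => symbolForm w u u + inner ℝ (S u) u with hq
  have hv₀n : ‖(v₀ : L2per L)‖ ≠ 0 := by simpa using hv₀
  set v₁ : sobolevSpace L s := ‖(v₀ : L2per L)‖⁻¹ • v₀ with hv₁
  have hv₁n : ‖(v₁ : L2per L)‖ = 1 := by
    rw [hv₁, Submodule.coe_smul, norm_smul, norm_inv, norm_norm, inv_mul_cancel₀ hv₀n]
  have hv₁ab : v₁ ∈ orthTo (sobolevSpace L s) a ⊓ orthTo (sobolevSpace L s) b :=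
    Submodule.smul_mem _ _ hv₀ab
  set R := A + B * (q v₁ + ‖S‖) with hR
  have hball : ∀ u ∈ Hs L s, ‖u‖ = 1 → q u ≤ q v₁ → sobolevNorm s u ^ 2 ≤ R := by
    intro u hu hn hle
    have h1 := sobolevNorm_sq_le hw hAB hu
    have h2 := (abs_le.1 (abs_inner_apply_le S u)).1
    rw [hn] at h1 h2
    have h3 : symbolForm w u u ≤ q v₁ + ‖S‖ := by simp only [hq] at hle ⊢; linarith
    have := mul_le_mul_of_nonneg_left h3 hB
    rw [hR]
    linarith
  set K := {u : L2per L | u ∈ Hs L s ∧ sobolevNorm s u ^ 2 ≤ R}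
    ∩ {u | ‖u‖ = 1 ∧ inner ℝ a u = 0 ∧ inner ℝ b u = 0} with hK
  have hKc : IsCompact K := by
    refine (isCompact_sobolevBall hs R).inter_right ?_
    exact (isClosed_eq continuous_norm continuous_const).inter
      ((isClosed_eq (by fun_prop) continuous_const).inter
        (isClosed_eq (by fun_prop) continuous_const))
  have hv₁K : (v₁ : L2per L) ∈ K :=
    ⟨⟨v₁.2, hball _ v₁.2 hv₁n le_rfl⟩, hv₁n, hv₁ab.1, hv₁ab.2⟩
  have hlsc : LowerSemicontinuousOn q K := by
    intro u hu y hy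
    set S₀ := fun u : L2per L => (inner ℝ (S u) u : ℝ) with hS₀
    have hSc : Continuous S₀ := by fun_prop
    obtain ⟨F, hF⟩ : ∃ F : Finset ℤ, y - S₀ u < ∑ k ∈ F, L * (w k * ‖coeff u k‖ ^ 2) := by
      have h := (hasSum_symbolForm_self hw hu.1.1)
      have h2 : y - S₀ u < symbolForm w u u := by
        simp only [hq] at hy; simp only [hS₀]; linarith
      exact (h.eventually (lt_mem_nhds h2)).exists
    have hc : Continuous fun u : L2per L => ∑ k ∈ F, L * (w k * ‖coeff u k‖ ^ 2) + S₀ u := by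
      refine Continuous.add (continuous_finsetSum _ fun k _ => ?_) hSc
      exact (((continuous_coeff k).norm.pow 2).const_mul _).const_mul _
    have h3 := (hc.tendsto u).eventually (lt_mem_nhds (show y < _ by linarith))
    filter_upwards [h3.filter_mono nhdsWithin_le_nhds, self_mem_nhdsWithin] with x hx hxK
    have := sum_le_hasSum F (fun k _ => mul_nonneg hL.le (mul_nonneg (hw0 k)
      (sq_nonneg ‖coeff x k‖))) (hasSum_symbolForm_self hw hxK.1.1)
    simp only [hq]
    simp only [hS₀] at hx
    linarith
  obtain ⟨v, hvK, hv⟩ := hlsc.exists_isMinOn ⟨_, hv₁K⟩ hKc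
  have hvn : ‖v‖ = 1 := hvK.2.1
  refine ⟨⟨v, hvK.1.1⟩, ?_, ⟨hvK.2.2.1, hvK.2.2.2⟩, q v, ?_, ?_⟩
  · intro h
    have : v = 0 := congrArg Subtype.val h
    rw [this, norm_zero] at hvn
    exact zero_ne_one hvn
  · rw [hvn, quadForm_apply]
    simp [hq]
  · intro x hx
    by_cases hx0 : x = 0
    · simp [hx0]
    have hxn : ‖(x : L2per L)‖ ≠ 0 := by simpa using hx0
    set x₁ : sobolevSpace L s := ‖(x : L2per L)‖⁻¹ • x with hx₁
    have hx₁n : ‖(x₁ : L2per L)‖ = 1 := by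
      rw [hx₁, Submodule.coe_smul, norm_smul, norm_inv, norm_norm, inv_mul_cancel₀ hxn]
    have hx₁ab : x₁ ∈ orthTo (sobolevSpace L s) a ⊓ orthTo (sobolevSpace L s) b :=
      Submodule.smul_mem _ _ hx
    have hge : q v ≤ q x₁ := by
      -- The set K is only known to contain the normalised competitors that do at least as well as
      -- `v₁`; any other competitor already loses to `v₁`.
      by_cases hle : q x₁ ≤ q v₁
      · exact hv (show (x₁ : L2per L) ∈ K from
          ⟨⟨x₁.2, hball _ x₁.2 hx₁n hle⟩, hx₁n, hx₁ab.1, hx₁ab.2⟩)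
      · exact (show q v ≤ q v₁ from hv hv₁K).trans (not_le.1 hle).le
    have hq₁ : q x₁ = quadForm hw S x₁ x₁ := rfl
    rw [hq₁, hx₁, map_smul, map_smul, LinearMap.smul_apply, smul_eq_mul, smul_eq_mul,
      ← mul_assoc, ← mul_inv, ← sq, ← div_eq_inv_mul, le_div_iff₀ (by positivity)] at hge
    exact hge

end Symbol

/-! ### Fourier coefficients of smooth periodic functions -/

/-- The frequency `2πk/L`. -/
def freq (L : ℝ) (k : ℤ) : ℝ := 2 * Real.pi * k / L

omit [Fact (0 < L)] in
theorem freq_neg (k : ℤ) : freq L (-k) = -freq L k := by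
  simp [freq, neg_div]

omit [Fact (0 < L)] in
theorem freq_zero : freq L 0 = 0 := by simp [freq]

theorem abs_freq (k : ℤ) : |freq L k| = 2 * Real.pi / L * |(k : ℝ)| := by
  rw [freq, abs_div, abs_mul, abs_of_pos (period_pos L), abs_of_pos Real.two_pi_pos]
  ring

namespace SmoothPer

theorem toL2_eq_ofCont (φ : SmoothPer L) : φ.toL2 = ofCont φ.toCircle := rfl

theorem coeff_toL2 (φ : SmoothPer L) (k : ℤ) (a : ℝ) :
    coeff φ.toL2 k
      = (1 / L : ℝ) • ∫ x in a..a + L, fourier (-k) (x : AddCircle L) * (φ.toFun x : ℂ) := by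
  rw [toL2_eq_ofCont, coeff_ofCont, fourierCoeff_eq_intervalIntegral _ _ a]
  rfl

/-- Integration by parts over one period; periodicity cancels the boundary terms. -/
theorem coeff_derivative (φ : SmoothPer L) (k : ℤ) :
    coeff φ.derivative.toL2 k = Complex.I * freq L k * coeff φ.toL2 k := by
  have hL := period_pos L
  rw [coeff_toL2 _ k 0, coeff_toL2 _ k 0, zero_add]
  have hd : ∀ x : ℝ, HasDerivAt (fun y : ℝ => fourier (-k) (y : AddCircle L) * (φ.toFun y : ℂ))
      (-(Complex.I * freq L k) * (fourier (-k) (x : AddCircle L) * (φ.toFun x : ℂ))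
        + fourier (-k) (x : AddCircle L) * (φ.derivative.toFun x : ℂ)) x := fun x => by
    have h1 := hasDerivAt_fourier_neg L k x
    have h2 : HasDerivAt φ.toFun (φ.derivative.toFun x) x :=
      (φ.smooth.differentiable (by simp)).differentiableAt.hasDerivAt
    have h3 := h1.mul h2.ofReal_comp
    refine h3.congr_deriv ?_
    simp only [freq]
    push_cast
    ring
  have hc1 : Continuous fun x : ℝ => fourier (-k) (x : AddCircle L) * (φ.toFun x : ℂ) :=
    continuous_iff_continuousAt.2 fun x => (hd x).continuousAt
  have hc2 : Continuous fun x : ℝ => fourier (-k) (x : AddCircle L) * (φ.derivative.toFun x : ℂ) := by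
    have h1 : Continuous fun x : ℝ => fourier (-k) (x : AddCircle L) :=
      (fourier (-k)).continuous.comp (AddCircle.continuous_mk' L)
    exact h1.mul (Complex.continuous_ofReal.comp φ.derivative.smooth.continuous)
  have hint := intervalIntegral.integral_eq_sub_of_hasDerivAt (a := 0) (b := L)
    (fun x _ => hd x) (((hc1.const_mul _).add hc2).intervalIntegrable _ _)
  rw [intervalIntegral.integral_add ((hc1.const_mul _).intervalIntegrable _ _)
    (hc2.intervalIntegrable _ _), intervalIntegral.integral_const_mul] at hint
  have hp : φ.toFun L = φ.toFun 0 := by simpa using φ.periodic 0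
  have hq : ((L : ℝ) : AddCircle L) = ((0 : ℝ) : AddCircle L) := by
    simp [AddCircle.coe_period]
  rw [hp, hq, sub_self] at hint
  have h4 : ∫ x in (0 : ℝ)..L, fourier (-k) (x : AddCircle L) * (φ.derivative.toFun x : ℂ)
      = Complex.I * freq L k * ∫ x in (0 : ℝ)..L, fourier (-k) (x : AddCircle L) * (φ.toFun x : ℂ) := by
    linear_combination hint
  rw [h4, mul_smul_comm]

theorem coeff_translate (φ : SmoothPer L) (r : ℝ) (k : ℤ) :
    coeff (φ.translate r).toL2 k = Complex.exp (Complex.I * freq L k * r) * coeff φ.toL2 k := by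
  have hL := (period_pos L).ne'
  -- The translate is integrated over [−r, L − r], so that the substitution x ↦ x + r lands exactly
  -- on [0, L].
  rw [coeff_toL2 _ k (-r), coeff_toL2 _ k 0, zero_add, mul_smul_comm,
    ← intervalIntegral.integral_const_mul]
  congr 1
  have h := intervalIntegral.integral_comp_add_right (a := -r) (b := -r + L)
    (fun x : ℝ => Complex.exp (Complex.I * freq L k * r)
      * (fourier (-k) (x : AddCircle L) * (φ.toFun x : ℂ))) r
  rw [neg_add_cancel, show -r + L + r = L by ring] at h
  rw [← h]
  refine intervalIntegral.integral_congr fun x _ => ?_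
  simp only [translate]
  rw [← mul_assoc]
  congr 1
  rw [fourier_coe_apply, fourier_coe_apply, ← Complex.exp_add]
  congr 1
  simp only [freq]
  push_cast
  field_simp
  ring

/-- Each step splits the new factor 1 + k²: the 1 is paid by φ, and k² by φ' through |freq k|² =
(2π/L)² k². -/
theorem toL2_mem_Hs_nat (n : ℕ) : ∀ φ : SmoothPer L, φ.toL2 ∈ Hs L n := by
  have hL := period_pos L
  induction n with
  | zero =>
    intro φ
    rw [mem_Hs]
    simpa [weight] using summable_normSq_coeff φ.toL2
  | succ n ih =>
    intro φ
    have h1 := mem_Hs.1 (ih φ)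
    have h2 := (mem_Hs.1 (ih φ.derivative)).mul_left ((L / (2 * Real.pi)) ^ 2)
    refine mem_Hs.2 ((h1.add h2).congr fun k => ?_)
    rw [coeff_derivative, norm_mul, norm_mul, Complex.norm_I, one_mul, Complex.norm_real,
      Real.norm_eq_abs, mul_pow, sq_abs]
    push_cast
    rw [weight_add]
    simp only [weight, freq, Real.rpow_one]
    have := Real.pi_pos.ne'
    field_simp

theorem toL2_mem_Hs (φ : SmoothPer L) (s : ℝ) : φ.toL2 ∈ Hs L s := by
  obtain ⟨n, hn⟩ := exists_nat_ge s
  exact Hs_mono hn (toL2_mem_Hs_nat n φ)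

end SmoothPer

/-! ### The linearized operator -/

theorem weight_zero_index (s : ℝ) : weight s 0 = 1 := by simp [weight]

theorem abs_rpow_eq (m : ℝ) (k : ℤ) : |(k : ℝ)| ^ m = ((k : ℝ) ^ 2) ^ (m / 2) := by
  rw [← sq_abs, ← Real.rpow_natCast, ← Real.rpow_mul (abs_nonneg _)]
  congr 1
  push_cast
  ring

theorem abs_rpow_le_weight {m : ℝ} (hm : 0 ≤ m) (k : ℤ) : |(k : ℝ)| ^ m ≤ weight (m / 2) k := by
  rw [abs_rpow_eq]
  exact Real.rpow_le_rpow (sq_nonneg _) (by linarith) (by linarith)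

/-- For a nonzero integer 1 + k² ≤ 2k²; the summand 1 covers k = 0. -/
theorem weight_le_abs_rpow {m : ℝ} (hm : 0 ≤ m) (k : ℤ) :
    weight (m / 2) k ≤ 1 + 2 ^ (m / 2) * |(k : ℝ)| ^ m := by
  have h0 : 0 ≤ |(k : ℝ)| ^ m := Real.rpow_nonneg (abs_nonneg _) _
  by_cases hk : k = 0
  · have := mul_nonneg (Real.rpow_nonneg two_pos.le (m / 2)) h0
    rw [hk, weight_zero_index]
    rw [hk] at this
    linarith
  · have h1 : (1 : ℝ) ≤ (k : ℝ) ^ 2 := by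
      have : 1 ≤ k ^ 2 := by have := sq_nonneg k; have : k ^ 2 ≠ 0 := by positivity
                             omega
      exact_mod_cast this
    have : weight (m / 2) k ≤ 2 ^ (m / 2) * |(k : ℝ)| ^ m := by
      rw [abs_rpow_eq, ← Real.mul_rpow two_pos.le (sq_nonneg _)]
      exact Real.rpow_le_rpow (by positivity) (by linarith) (by linarith)
    linarith

/-- Two-sided bounds of a Fourier symbol by `|κ|ᵐ`, at the integers. -/
structure SymbolBounds (θ : ℝ → ℝ) (m υ₁ υ₂ : ℝ) : Prop where
  even : ∀ k : ℤ, θ (-k : ℤ) = θ k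
  pos : 0 < m
  lower_pos : 0 < υ₁
  lower : ∀ k : ℤ, υ₁ * |(k : ℝ)| ^ m ≤ θ k
  upper : ∀ k : ℤ, θ k ≤ υ₂ * |(k : ℝ)| ^ m

namespace SymbolBounds

variable {θ : ℝ → ℝ} {m υ₁ υ₂ : ℝ} (hθ : SymbolBounds θ m υ₁ υ₂)

include hθ

theorem nonneg (k : ℤ) : 0 ≤ θ k :=
  (mul_nonneg hθ.lower_pos.le (Real.rpow_nonneg (abs_nonneg _) _)).trans (hθ.lower k)

theorem zero : θ (0 : ℤ) = 0 := by
  have h1 := hθ.lower 0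
  have h2 := hθ.upper 0
  simp only [Int.cast_zero, abs_zero, Real.zero_rpow hθ.pos.ne', mul_zero] at h1 h2 ⊢
  linarith

theorem abs_le (k : ℤ) : |θ k| ≤ |υ₂| * weight (m / 2) k := by
  rw [abs_of_nonneg (hθ.nonneg k)]
  refine (hθ.upper k).trans (mul_le_mul (le_abs_self _) (abs_rpow_le_weight hθ.pos.le k)
    (Real.rpow_nonneg (abs_nonneg _) _) (abs_nonneg _))

theorem weight_le (k : ℤ) : weight (m / 2) k ≤ 1 + 2 ^ (m / 2) / υ₁ * θ k := by
  have h1 : |(k : ℝ)| ^ m ≤ θ k / υ₁ := by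
    rw [le_div_iff₀ hθ.lower_pos, mul_comm]
    exact hθ.lower k
  have h2 := mul_le_mul_of_nonneg_left h1 (Real.rpow_nonneg two_pos.le (m / 2))
  have h3 := weight_le_abs_rpow hθ.pos.le k
  rw [div_mul_eq_mul_div, ← mul_div_assoc'] at *
  linarith

omit hθ in
theorem _root_.PeriodicWave.symbolForm_of_isMultiplier {u g : L2per L} (hg : IsMultiplier θ u g) (v : L2per L) :
    symbolForm (fun k : ℤ => θ k) u v = inner ℝ g v := by
  refine HasSum.tsum_eq ((hasSum_inner_coeff g v).congr_fun ?_)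
  intro k
  rw [hg k, mul_assoc, Complex.re_ofReal_mul]

/-- The weak identity is tested on the trigonometric polynomial whose coefficients are the defect
itself at ±k; both signs are needed for the test function to be real. The pairing is then a sum of
squares equal to zero. -/
theorem isMultiplier_of_symbolForm {u y : L2per L} (hu : u ∈ Hs L (m / 2))
    (h : ∀ v ∈ Hs L (m / 2), symbolForm (fun k : ℤ => θ k) u v = inner ℝ y v) :
    IsMultiplier θ u y := by
  intro k
  set d : ℤ → ℂ := fun j => if j = k ∨ j = -k then coeff y j - (θ j : ℂ) * coeff u j else 0 with hd
  have hd0 : ∀ j ∉ ({k, -k} : Finset ℤ), d j = 0 := fun j hj => by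
    simp only [Finset.mem_insert, Finset.mem_singleton] at hj
    simp [hd, hj]
  obtain ⟨v, hv⟩ := exists_coeff_eq (L := L) d
    (fun j => by
      simp only [hd]
      by_cases hj : j = k ∨ j = -k
      · rw [if_pos hj, if_pos (by omega), coeff_neg, coeff_neg, hθ.even, map_sub, map_mul,
          Complex.conj_ofReal]
      · rw [if_neg hj, if_neg (by omega), map_zero])
    (summable_of_ne_finset_zero (s := {k, -k}) fun j hj => by simp [hd0 j hj])
  have hvH : v ∈ Hs L (m / 2) := mem_Hs_of_finite (F := {k, -k}) (fun j hj => by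
    rw [hv, hd0 j hj]) _
  have h1 := (hasSum_inner_coeff y v).sub (hasSum_symbolForm hθ.abs_le hu hvH)
  rw [h v hvH, sub_self] at h1
  have h2 : ∀ j, L * (coeff y j * (starRingEnd ℂ) (coeff v j)).re
      - L * (θ j * (coeff u j * (starRingEnd ℂ) (coeff v j)).re) = L * ‖d j‖ ^ 2 := fun j => by
    rw [hv, ← mul_sub, ← Complex.re_ofReal_mul, ← Complex.sub_re, ← mul_assoc, ← sub_mul,
      ← re_mul_conj_self]
    by_cases hj : j = k ∨ j = -k
    · simp only [hd, if_pos hj]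
    · simp only [hd, if_neg hj, map_zero, mul_zero]
  simp only [h2] at h1
  have h3 := (hasSum_zero_iff_of_nonneg fun j =>
    mul_nonneg (period_pos L).le (sq_nonneg ‖d j‖)).1 h1
  have h4 := congrFun h3 k
  simp only [Pi.zero_apply, mul_eq_zero, (period_pos L).ne', false_or] at h4
  have h5 : d k = 0 := by simpa using h4
  simp only [hd, true_or, if_true] at h5
  exact sub_eq_zero.1 h5

/-- `L²` functions whose image under the multiplier is in `L²` are in `Hᵐ`. -/
theorem mem_Hs_of_isMultiplier {u g : L2per L} (hg : IsMultiplier θ u g) : u ∈ Hs L m := by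
  have h1 := (summable_normSq_coeff u).mul_left 2
  have h2 := (summable_normSq_coeff g).mul_left (2 * (2 ^ (m / 2) / υ₁) ^ 2)
  refine Summable.of_nonneg_of_le (fun k => mul_nonneg (weight_pos m k).le (sq_nonneg _))
    (fun k => ?_) (h1.add h2)
  change weight m k * _ ≤ _
  rw [hg k, norm_mul, mul_pow, Complex.norm_real, Real.norm_eq_abs, sq_abs, ← mul_assoc, ← add_mul,
    ← weight_half_sq]
  refine mul_le_mul_of_nonneg_right ?_ (sq_nonneg _)
  -- With B = 2^{m/2}/υ₁, the weight of order m is the square of the one of order m/2, hence at most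
  -- (1 + Bθ)² ≤ 2 + 2B²θ².
  have h3 := pow_le_pow_left₀ (weight_pos _ k).le (hθ.weight_le k) 2
  nlinarith [sq_nonneg (1 - 2 ^ (m / 2) / υ₁ * θ k)]

omit hθ in
/-- The bounded part `v ↦ ω v - f v` of the linearized operator. -/
def _root_.PeriodicWave.potential (ω : ℝ) (f : C(AddCircle L, ℝ)) : L2per L →L[ℝ] L2per L :=
  ω • ContinuousLinearMap.id ℝ (L2per L) - mulCont f

omit hθ in
theorem _root_.PeriodicWave.potential_apply (ω : ℝ) (f : C(AddCircle L, ℝ)) (u : L2per L) :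
    potential ω f u = ω • u - mulCont f u := rfl

omit hθ in
theorem _root_.PeriodicWave.inner_potential_comm (ω : ℝ) (f : C(AddCircle L, ℝ)) (u v : L2per L) :
    inner ℝ (potential ω f u) v = inner ℝ u (potential ω f v) := by
  rw [potential_apply, potential_apply, inner_sub_left, inner_sub_right, inner_mulCont_comm,
    real_inner_smul_left, real_inner_smul_right]

omit hθ in
theorem _root_.PeriodicWave.deriv_flux (x : ℝ) : deriv flux x = x := by
  have h : HasDerivAt flux (2 * x / 2) x := by
    have := ((hasDerivAt_id x).pow 2).div_const 2
    simpa [flux] using! this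
  rw [h.deriv]
  ring

omit hθ in
theorem _root_.PeriodicWave.isLinearized_iff {ω : ℝ} {φ : SmoothPer L} {v w : L2per L} :
    IsLinearized θ m ω φ v w
      ↔ v ∈ Hs L m ∧ IsMultiplier θ v (w - potential ω φ.toCircle v) := by
  constructor
  · rintro ⟨hv, g, hg, hw⟩
    refine ⟨hv, ?_⟩
    have : w - potential ω φ.toCircle v = g := by
      rw [sub_eq_iff_eq_add, potential_apply]
      refine eq_of_ae ?_
      filter_upwards [hw, mulCont_ae φ.toCircle v, Lp.coeFn_smul ω v,
        Lp.coeFn_sub (ω • v) (mulCont φ.toCircle v),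
        Lp.coeFn_add g (ω • v - mulCont φ.toCircle v)] with x h1 h2 h3 h4 h5
      rw [h1, h5, Pi.add_apply, h4, Pi.sub_apply, h3, Pi.smul_apply, h2, smul_eq_mul, deriv_flux]
      ring
    rwa [this]
  · rintro ⟨hv, hg⟩
    refine ⟨hv, _, hg, ?_⟩
    rw [potential_apply]
    filter_upwards [mulCont_ae φ.toCircle v, Lp.coeFn_smul ω v,
        Lp.coeFn_sub (ω • v) (mulCont φ.toCircle v),
        Lp.coeFn_sub w (ω • v - mulCont φ.toCircle v)] with x h2 h3 h4 h5
    rw [h5, Pi.sub_apply, h4, Pi.sub_apply, h3, Pi.smul_apply, h2, smul_eq_mul, deriv_flux]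
    ring

/-- The energy form `(𝓛 v, w)` of the linearized operator on `H^{m/2}`. -/
def energyForm (ω : ℝ) (φ : SmoothPer L) :
    sobolevSpace L (m / 2) →ₗ[ℝ] sobolevSpace L (m / 2) →ₗ[ℝ] ℝ :=
  quadForm hθ.abs_le (potential ω φ.toCircle)

theorem energyForm_apply (ω : ℝ) (φ : SmoothPer L) (v w : sobolevSpace L (m / 2)) :
    hθ.energyForm ω φ v w = symbolForm (fun k : ℤ => θ k) (v : L2per L) w
      + inner ℝ (potential ω φ.toCircle v) (w : L2per L) := rfl

theorem energyForm_symm (ω : ℝ) (φ : SmoothPer L) (v w : sobolevSpace L (m / 2)) :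
    hθ.energyForm ω φ v w = hθ.energyForm ω φ w v :=
  quadForm_symm hθ.abs_le (inner_potential_comm ω φ.toCircle) v w

theorem energyForm_of_isLinearized {ω : ℝ} {φ : SmoothPer L} {v : sobolevSpace L (m / 2)}
    {y : L2per L} (h : IsLinearized θ m ω φ v y) (w : sobolevSpace L (m / 2)) :
    hθ.energyForm ω φ v w = inner ℝ y (w : L2per L) := by
  rw [energyForm_apply, symbolForm_of_isMultiplier (isLinearized_iff.1 h).2, inner_sub_left]
  ring

/-- Elliptic regularity: a weak solution in H^{m/2} lies in the domain Hᵐ. This lets the spectral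
hypotheses on 𝓛 be applied to eigenvectors found variationally. -/
theorem isLinearized_of_energyForm {ω : ℝ} {φ : SmoothPer L} {v : sobolevSpace L (m / 2)}
    {y : L2per L} (h : ∀ w, hθ.energyForm ω φ v w = inner ℝ y (w : L2per L)) :
    IsLinearized θ m ω φ v y := by
  have hm : IsMultiplier θ (v : L2per L) (y - potential ω φ.toCircle v) :=
    hθ.isMultiplier_of_symbolForm v.2 fun w hw => by
      have h1 := h ⟨w, hw⟩
      rw [energyForm_apply] at h1
      rw [inner_sub_left]
      linarith
  exact isLinearized_iff.2 ⟨hθ.mem_Hs_of_isMultiplier hm, hm⟩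

theorem mem_half {u : L2per L} (hu : u ∈ Hs L m) : u ∈ Hs L (m / 2) :=
  Hs_mono (by linarith [hθ.pos]) hu

omit hθ in
theorem _root_.PeriodicWave.oneL2_mem_Hs (s : ℝ) : oneL2 L ∈ Hs L s :=
  mem_Hs_of_finite (F := {0}) (fun k hk => by
    rw [coeff_oneL2, if_neg (by simpa using hk)]) _

theorem isMultiplier_one : IsMultiplier θ (oneL2 L) 0 := fun k => by
  rw [coeff_zero_fun, coeff_oneL2]
  by_cases hk : k = 0
  · rw [hk, hθ.zero]; simp
  · simp [hk]

omit hθ in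
theorem _root_.PeriodicWave.mulCont_one (f : C(AddCircle L, ℝ)) : mulCont f (oneL2 L) = ofCont f := by
  rw [oneL2, mulCont_ofCont, mul_one]

/-- `𝓛 1 = ω - φ`. -/
theorem isLinearized_one (ω : ℝ) (φ : SmoothPer L) :
    IsLinearized θ m ω φ (oneL2 L) (ω • oneL2 L - φ.toL2) := by
  refine isLinearized_iff.2 ⟨oneL2_mem_Hs _, ?_⟩
  rw [potential_apply, mulCont_one, SmoothPer.toL2_eq_ofCont, sub_self]
  exact hθ.isMultiplier_one

/-- `𝓛` is coercive in `H^{m/2}` on the orthogonal complement of `φ - ω` and of any vector that is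
not orthogonal to the kernel, provided that `(𝓛 1, 1) < 0`. -/
theorem energyForm_coercive {ω A : ℝ} {φ : SmoothPer L} (h0 : HypH0 θ m ω A φ)
    (hneg : inner ℝ (ω • oneL2 L - φ.toL2) (oneL2 L) < 0) {ψ : L2per L}
    (hψ : inner ℝ ψ φ.derivative.toL2 ≠ 0) :
    ∃ c > 0, ∀ w : sobolevSpace L (m / 2), inner ℝ (ω • oneL2 L - φ.toL2) (w : L2per L) = 0 →
      inner ℝ ψ (w : L2per L) = 0 →
      c * sobolevNorm (m / 2) (w : L2per L) ^ 2 ≤ hθ.energyForm ω φ w w := by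
  obtain ⟨lam, hlam, χ, ⟨hχ0, hχe, hχs⟩, huniq⟩ := h0.negative
  have hB : 0 < 2 ^ (m / 2) / υ₁ := div_pos (Real.rpow_pos_of_pos two_pos _) hθ.lower_pos
  have hχH : χ ∈ sobolevSpace L (m / 2) := hθ.mem_half hχe.1
  set p : sobolevSpace L (m / 2) := ⟨φ.derivative.toL2, φ.derivative.toL2_mem_Hs _⟩ with hp
  set e : sobolevSpace L (m / 2) := ⟨oneL2 L, oneL2_mem_Hs _⟩ with he
  have hez : ∀ w, hθ.energyForm ω φ e w = inner ℝ (ω • oneL2 L - φ.toL2) (w : L2per L) :=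
    fun w => hθ.energyForm_of_isLinearized (v := e) (hθ.isLinearized_one ω φ) w
  -- Here p = φ' spans the kernel, e = 1 is the negative vector and z = 𝓛1 = ω − φ is its dual
  -- constraint. The outcome is coercivity in L² only.
  obtain ⟨c, hc, hcw⟩ := coercive_of_index_one (Q := hθ.energyForm ω φ) (χ := ⟨χ, hχH⟩) (lam := lam)
    (p := p) (e := e) (z := ω • oneL2 L - φ.toL2) (ψ := ψ)
    (hθ.energyForm_symm ω φ)
    (hasConstrainedMinimizers hθ.abs_le hθ.nonneg hθ.weight_le (by linarith [hθ.pos]) hB.le _)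
    (fun h => hχ0 (congrArg Subtype.val h))
    (fun w => by
      rw [hθ.energyForm_of_isLinearized (v := ⟨χ, hχH⟩) hχe w, real_inner_smul_left])
    (fun μ hμ v hv => by
      by_cases hv0 : v = 0
      · exact ⟨0, by rw [hv0, zero_smul]⟩
      have hlin : IsLinearized θ m ω φ v (μ • (v : L2per L)) :=
        hθ.isLinearized_of_energyForm fun w => by rw [hv w, real_inner_smul_left]
      have := huniq μ hμ v (by simpa using hv0) hlin
      rw [this] at hlin
      obtain ⟨c, hc⟩ := hχs v hlin
      exact ⟨c, Subtype.ext hc⟩)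
    (fun v hv => by
      have hlin : IsLinearized θ m ω φ v ((0 : ℝ) • (v : L2per L)) :=
        hθ.isLinearized_of_energyForm fun w => by rw [hv w, zero_smul, inner_zero_left]
      obtain ⟨c, hc⟩ := h0.kernel.2.2 v hlin
      exact ⟨c, Subtype.ext hc⟩)
    hez (by rw [hez]; exact hneg) hψ
  set S := potential ω φ.toCircle with hS
  set B := 2 ^ (m / 2) / υ₁ with hBdef
  -- Gårding: ‖w‖²_{m/2} ≤ ‖w‖² + B(q + ‖S‖‖w‖²). Inserting ‖w‖² ≤ q/c bounds this by Dq.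
  set D := (1 + B * ‖S‖) / c + B with hD
  have hD0 : 0 < D := by positivity
  refine ⟨1 / D, by positivity, fun w hz hw => ?_⟩
  have h1 := hcw w ⟨hz, hw⟩
  have h2 := sobolevNorm_sq_le hθ.abs_le hθ.weight_le w.2
  have h3 := (_root_.abs_le.1 (abs_inner_apply_le S w)).1
  have h4 := hθ.energyForm_apply ω φ w w
  rw [← hS] at h4
  set q := hθ.energyForm ω φ w w
  rw [div_mul_eq_mul_div, one_mul, div_le_iff₀ hD0]
  have h5 : symbolForm (fun k : ℤ => θ k) (w : L2per L) w ≤ q + ‖S‖ * ‖(w : L2per L)‖ ^ 2 := by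
    linarith
  have h6 := mul_le_mul_of_nonneg_left h5 hB.le
  have h7 : ‖(w : L2per L)‖ ^ 2 ≤ q / c := by rw [le_div_iff₀ hc]; linarith
  have h8 := mul_le_mul_of_nonneg_left h7 (show 0 ≤ 1 + B * ‖S‖ by positivity)
  have h9 : q * D = (1 + B * ‖S‖) * (q / c) + B * q := by rw [hD]; ring
  rw [h9]
  linarith

end SymbolBounds

/-! ### Trigonometric polynomials -/

/-- The mean value of a continuous function on the circle. -/
def mean (L : ℝ) [Fact (0 < L)] : C(AddCircle L, ℂ) →L[ℂ] ℂ :=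
  LinearMap.mkContinuous
    { toFun := fun f => ∫ x, f x ∂(AddCircle.haarAddCircle : Measure (AddCircle L))
      map_add' := fun f g => integral_add (f.continuous.integrable_of_hasCompactSupport
        (HasCompactSupport.of_compactSpace _)) (g.continuous.integrable_of_hasCompactSupport
        (HasCompactSupport.of_compactSpace _))
      map_smul' := fun c f => integral_const_mul c _ }
    1 fun f => by
      refine (norm_integral_le_of_norm_le_const (ae_of_all _ f.norm_coe_le_norm)).trans ?_
      simp

theorem mean_apply (f : C(AddCircle L, ℂ)) : mean L f = ∫ x, f x ∂AddCircle.haarAddCircle := rfl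

theorem norm_mean_le (f : C(AddCircle L, ℂ)) : ‖mean L f‖ ≤ ‖f‖ := by
  have h := (mean L).le_of_opNorm_le (LinearMap.mkContinuous_norm_le _ zero_le_one _) f
  rwa [one_mul] at h

theorem fourierCoeff_eq_mean (f : C(AddCircle L, ℂ)) (k : ℤ) :
    fourierCoeff f k = mean L (fourier (-k) * f) := rfl

theorem norm_fourierCoeff_le (f : C(AddCircle L, ℂ)) (k : ℤ) : ‖fourierCoeff f k‖ ≤ ‖f‖ := by
  rw [fourierCoeff_eq_mean]
  refine (norm_mean_le _).trans ((norm_mul_le _ _).trans ?_)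
  rw [fourier_norm, one_mul]

/-- The frequencies of size at most `N`. -/
def band (N : ℕ) : Finset ℤ := Finset.Icc (-(N : ℤ)) N

theorem mem_band {N : ℕ} {k : ℤ} : k ∈ band N ↔ |k| ≤ N := by
  rw [band, Finset.mem_Icc, abs_le]

theorem neg_mem_band {N : ℕ} {k : ℤ} : -k ∈ band N ↔ k ∈ band N := by
  rw [mem_band, mem_band, abs_neg]

theorem tendsto_band : Tendsto band atTop atTop := by
  refine tendsto_atTop_finset_of_monotone (fun M N h k hk => ?_) fun k => ⟨k.natAbs, ?_⟩
  · rw [mem_band] at hk ⊢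
    exact hk.trans (by exact_mod_cast h)
  · rw [mem_band]
    simp

theorem sum_band_neg {M : Type*} [AddCommMonoid M] (N : ℕ) (g : ℤ → M) :
    ∑ k ∈ band N, g (-k) = ∑ k ∈ band N, g k :=
  Finset.sum_nbij' (fun k => -k) (fun k => -k) (fun _ hk => neg_mem_band.2 hk)
    (fun _ hk => neg_mem_band.2 hk) (fun k _ => neg_neg k) (fun k _ => neg_neg k) fun _ _ => rfl

/-- The trigonometric polynomial with the coefficients `a k`, `|k| ≤ N`. -/
def trigPoly (L : ℝ) (N : ℕ) (a : ℤ → ℂ) : C(AddCircle L, ℂ) :=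
  ∑ k ∈ band N, a k • (fourier k : C(AddCircle L, ℂ))

theorem mean_mul_trigPoly (f : C(AddCircle L, ℂ)) (N : ℕ) (a : ℤ → ℂ) :
    mean L (f * trigPoly L N a) = ∑ k ∈ band N, a k * fourierCoeff f (-k) := by
  rw [trigPoly, Finset.mul_sum, map_sum]
  refine Finset.sum_congr rfl fun k _ => ?_
  rw [mul_smul_comm, map_smul, fourierCoeff_eq_mean, neg_neg, smul_eq_mul, mul_comm f]

theorem fourierCoeff_trigPoly (N : ℕ) (a : ℤ → ℂ) (k : ℤ) :
    fourierCoeff (trigPoly L N a) k = if k ∈ band N then a k else 0 := by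
  rw [fourierCoeff_eq_mean, mean_mul_trigPoly]
  simp only [fourierCoeff_fourier, Pi.single_apply, mul_ite, mul_one, mul_zero, neg_inj]
  rw [Finset.sum_ite_eq']

theorem fourierCoeff_sq_trigPoly (N : ℕ) (a : ℤ → ℂ) (k : ℤ) :
    fourierCoeff (trigPoly L N a * trigPoly L N a : C(AddCircle L, ℂ)) k
      = ∑ j ∈ band N, a j * if k - j ∈ band N then a (k - j) else 0 := by
  rw [fourierCoeff_eq_mean, ← mul_assoc, mean_mul_trigPoly]
  refine Finset.sum_congr rfl fun j _ => ?_
  rw [← fourierCoeff_trigPoly (L := L), fourierCoeff_eq_mean, fourierCoeff_eq_mean, ← mul_assoc]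
  congr 4
  ext x
  rw [ContinuousMap.mul_apply, ← fourier_add]
  congr 2
  ring

theorem mean_cube_trigPoly (N : ℕ) (a : ℤ → ℂ) :
    mean L (trigPoly L N a ^ 3) = ∑ k ∈ band N, ∑ j ∈ band N,
      a k * (a j * if -k - j ∈ band N then a (-k - j) else 0) := by
  rw [pow_succ, sq, mean_mul_trigPoly]
  refine Finset.sum_congr rfl fun k _ => ?_
  rw [fourierCoeff_sq_trigPoly, Finset.mul_sum]

/-! ### The cubic estimate -/

/-- Shifting a nonnegative function supported in the band can only push mass out of it. -/
theorem sum_band_shift_le {N : ℕ} {g : ℤ → ℝ} (h0 : ∀ k, 0 ≤ g k) (h1 : ∀ k ∉ band N, g k = 0)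
    (j : ℤ) : ∑ k ∈ band N, g (j + k) ≤ ∑ k ∈ band N, g k := by
  have h2 : ∑ k ∈ band N, g (j + k) = ∑ l ∈ (band N).map (addLeftEmbedding j), g l := by
    rw [Finset.sum_map]
    rfl
  rw [h2, ← Finset.sum_filter_add_sum_filter_not _ (· ∈ band N)]
  rw [Finset.sum_eq_zero (s := Finset.filter (fun k => ¬ k ∈ band N) _)
    fun k hk => h1 k (Finset.mem_filter.1 hk).2, add_zero]
  exact Finset.sum_le_sum_of_subset_of_nonneg (fun k hk => (Finset.mem_filter.1 hk).2)
    fun k _ _ => h0 k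

/-- The product of three terms is controlled by the terms with the smallest index appearing
linearly. -/
theorem triple_sum_le {N : ℕ} {X : ℤ → ℝ} (h0 : ∀ k, 0 ≤ X k) (h1 : ∀ k ∉ band N, X k = 0) :
    ∑ j ∈ band N, ∑ k ∈ band N, X j * X k * X (j + k)
      ≤ 3 * ∑ a ∈ band N, ∑ c ∈ band N, if |c| ≤ |a| then X c * X a ^ 2 else 0 := by
  set P : ℤ → ℤ → ℝ := fun c a => if |c| ≤ |a| then X c * X a ^ 2 else 0 with hP
  have hP0 : ∀ c a, 0 ≤ P c a := fun c a => by
    simp only [hP]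
    split_ifs
    · exact mul_nonneg (h0 c) (sq_nonneg _)
    · exact le_rfl
  have hPc : ∀ c a, c ∉ band N → P c a = 0 := fun c a hc => by simp [hP, h1 c hc]
  have hPa : ∀ c a, a ∉ band N → P c a = 0 := fun c a ha => by simp [hP, h1 a ha]
  have hsmall : ∀ c a b : ℤ, |c| ≤ |a| → |c| ≤ |b| → X c * X a * X b ≤ (P c a + P c b) / 2 :=
    fun c a b ha hb => by
      simp only [hP, if_pos ha, if_pos hb]
      nlinarith [mul_nonneg (h0 c) (sq_nonneg (X a - X b))]
  -- Whichever of j, k, j + k has the smallest modulus is kept linear and the other two are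
  -- separated by 2xy ≤ x² + y². All six ordered pairs are added to avoid distinguishing cases; each
  -- sums to at most S, whence the factor 6/2 = 3.
  have hterm : ∀ j k : ℤ, X j * X k * X (j + k) ≤
      (P j k + P j (j + k) + P k j + P k (j + k) + P (j + k) j + P (j + k) k) / 2 := fun j k => by
    have g1 := hP0 j k
    have g2 := hP0 j (j + k)
    have g3 := hP0 k j
    have g4 := hP0 k (j + k)
    have g5 := hP0 (j + k) j
    have g6 := hP0 (j + k) k
    rcases le_total |j| |k| with hjk | hjk
    · rcases le_total |j| |j + k| with hl | hl
      · have := hsmall j k (j + k) hjk hl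
        linarith
      · have := hsmall (j + k) j k hl (hl.trans hjk)
        nlinarith
    · rcases le_total |k| |j + k| with hl | hl
      · have := hsmall k j (j + k) hjk hl
        nlinarith
      · have := hsmall (j + k) j k (hl.trans hjk) hl
        nlinarith
  set S := ∑ a ∈ band N, ∑ c ∈ band N, P c a with hS
  have hS' : ∑ c ∈ band N, ∑ a ∈ band N, P c a = S := Finset.sum_comm
  have e1 : ∑ j ∈ band N, ∑ k ∈ band N, P j (j + k) ≤ S := by
    rw [← hS']
    exact Finset.sum_le_sum fun j _ => sum_band_shift_le (hP0 j) (hPa j) j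
  have e2 : ∑ j ∈ band N, ∑ k ∈ band N, P k (j + k) ≤ S := by
    rw [← hS', Finset.sum_comm]
    refine Finset.sum_le_sum fun k _ => ?_
    simp only [add_comm _ k]
    exact sum_band_shift_le (hP0 k) (hPa k) k
  have e3 : ∑ j ∈ band N, ∑ k ∈ band N, P (j + k) j ≤ S :=
    Finset.sum_le_sum fun j _ =>
      sum_band_shift_le (fun c => hP0 c j) (fun c hc => hPc c j hc) j
  have e4 : ∑ j ∈ band N, ∑ k ∈ band N, P (j + k) k ≤ S := by
    rw [Finset.sum_comm]
    refine Finset.sum_le_sum fun k _ => ?_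
    simp only [add_comm _ k]
    exact sum_band_shift_le (fun c => hP0 c k) (fun c hc => hPc c k hc) k
  have h := Finset.sum_le_sum fun j (_ : j ∈ band N) =>
    Finset.sum_le_sum fun k (_ : k ∈ band N) => hterm j k
  refine h.trans ?_
  simp only [← Finset.sum_div, Finset.sum_add_distrib]
  linarith

/-- Comparison of x^{−1/3} with the increment of its primitive (3/2)x^{2/3}, made to telescope. In
terms of the cube roots x, y of n and n + 1 it is a polynomial inequality under y³ − x³ = 1. -/
theorem rpow_neg_third_le (n : ℕ) :
    ((n : ℝ) + 1) ^ (-(1 / 3) : ℝ) ≤ 3 / 2 * (((n : ℝ) + 1) ^ (2 / 3 : ℝ) - (n : ℝ) ^ (2 / 3 : ℝ)) := by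
  set x := (n : ℝ) ^ (1 / 3 : ℝ) with hx
  set y := ((n : ℝ) + 1) ^ (1 / 3 : ℝ) with hy
  have hn : (0 : ℝ) ≤ n := n.cast_nonneg
  have hx0 : 0 ≤ x := Real.rpow_nonneg hn _
  have hy0 : 0 < y := Real.rpow_pos_of_pos (by linarith) _
  have hx3 : x ^ 3 = n := by
    rw [hx, ← Real.rpow_natCast, ← Real.rpow_mul hn]; norm_num
  have hy3 : y ^ 3 = n + 1 := by
    rw [hy, ← Real.rpow_natCast, ← Real.rpow_mul (by linarith)]; norm_num
  have hx2 : (n : ℝ) ^ (2 / 3 : ℝ) = x ^ 2 := by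
    rw [hx, ← Real.rpow_natCast, ← Real.rpow_mul hn]; norm_num
  have hy2 : ((n : ℝ) + 1) ^ (2 / 3 : ℝ) = y ^ 2 := by
    rw [hy, ← Real.rpow_natCast, ← Real.rpow_mul (by linarith)]; norm_num
  have hxy : x ≤ y := Real.rpow_le_rpow hn (by linarith) (by norm_num)
  rw [Real.rpow_neg (by linarith), ← hy, hx2, hy2, inv_le_iff_one_le_mul₀ hy0]
  have h1 : (y - x) * (y ^ 2 + x * y + x ^ 2) = 1 := by nlinarith
  have h2 : 3 * (x ^ 2 * (y - x)) ≤ 1 := by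
    rw [← h1]
    nlinarith [mul_nonneg (sub_nonneg.2 hxy) hx0,
      mul_nonneg (mul_nonneg (sub_nonneg.2 hxy) (sub_nonneg.2 hxy)) hx0,
      mul_nonneg (mul_nonneg (sub_nonneg.2 hxy) (sub_nonneg.2 hxy)) hy0.le]
  nlinarith

theorem sum_band_succ (n : ℕ) (g : ℤ → ℝ) :
    ∑ k ∈ band (n + 1), g k = ∑ k ∈ band n, g k + g (n + 1) + g (-(n + 1)) := by
  have h : band (n + 1) = insert ((n : ℤ) + 1) (insert (-((n : ℤ) + 1)) (band n)) := by
    ext k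
    simp only [Finset.mem_insert, band, Finset.mem_Icc]
    push_cast
    omega
  rw [h, Finset.sum_insert, Finset.sum_insert]
  · ring
  · simp only [band, Finset.mem_Icc]; omega
  · simp only [Finset.mem_insert, band, Finset.mem_Icc]; omega

/-- The frequency 0 contributes 1, and each of the two half-lines at most (3/2)n^{2/3} by
telescoping. -/
theorem sum_weight_neg_sixth_le (n : ℕ) :
    ∑ c ∈ band n, weight (-(1 / 6)) c ≤ 1 + 3 * (n : ℝ) ^ (2 / 3 : ℝ) := by
  induction n with
  | zero => simp [band, weight_zero_index]
  | succ n ih =>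
    have h1 : weight (-(1 / 6)) ((n : ℤ) + 1) ≤ ((n : ℝ) + 1) ^ (-(1 / 3) : ℝ) := by
      have h2 : ((n : ℝ) + 1) ^ (-(1 / 3) : ℝ) = (((n : ℝ) + 1) ^ 2) ^ (-(1 / 6) : ℝ) := by
        rw [← Real.rpow_natCast, ← Real.rpow_mul (by positivity)]
        norm_num
      rw [h2, weight]
      push_cast
      exact Real.rpow_le_rpow_of_nonpos (by positivity) (by linarith) (by norm_num)
    have h3 := rpow_neg_third_le n
    rw [sum_band_succ, weight_neg_index]
    push_cast
    linarith

theorem sum_weight_neg_sixth_Icc_le (a : ℤ) :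
    ∑ c ∈ band a.natAbs, weight (-(1 / 6)) c ≤ 4 * weight (1 / 6) a ^ 2 := by
  have h1 : (1 : ℝ) ≤ weight (1 / 3) a := one_le_weight (by norm_num) a
  have h2 : ((a.natAbs : ℕ) : ℝ) ^ (2 / 3 : ℝ) ≤ weight (1 / 3) a := by
    have h := abs_rpow_le_weight (m := 2 / 3) (by norm_num) a
    rw [Nat.cast_natAbs, Int.cast_abs]
    norm_num at h ⊢
    exact h
  have h3 : weight (1 / 6) a ^ 2 = weight (1 / 3) a := by
    rw [← weight_half_sq (1 / 3)]; norm_num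
  have := sum_weight_neg_sixth_le a.natAbs
  rw [h3]
  linarith

/-- Cauchy–Schwarz with the weights of order ±1/6. The inverse weights over |c| ≤ |a| sum to
O(|a|^{2/3}) for a ≠ 0, so the loss is one factor `weight (1 / 6) a`, exactly what the two remaining
factors at frequency a can absorb; the endpoint costs no logarithm. -/
theorem sum_small_le {N : ℕ} {X : ℤ → ℝ} (h0 : ∀ k, 0 ≤ X k) (a : ℤ) :
    ∑ c ∈ band N, (if |c| ≤ |a| then X c else 0)
      ≤ 2 * weight (1 / 6) a * Real.sqrt (∑ c ∈ band N, weight (1 / 6) c * X c ^ 2) := by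
  have hw : ∀ c : ℤ, weight (-(1 / 6)) c * weight (1 / 6) c = 1 := fun c => by
    rw [← weight_add]; simp [weight]
  have hcs := Finset.sum_mul_sq_le_sq_mul_sq ((band N).filter fun c => |c| ≤ |a|)
    (fun c => Real.sqrt (weight (-(1 / 6)) c)) (fun c => Real.sqrt (weight (1 / 6) c) * X c)
  have e1 : ∀ c, Real.sqrt (weight (-(1 / 6)) c) * (Real.sqrt (weight (1 / 6) c) * X c) = X c :=
    fun c => by
      rw [← mul_assoc, ← Real.sqrt_mul (weight_pos _ c).le, hw, Real.sqrt_one, one_mul]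
  have e2 : ∀ c, (Real.sqrt (weight (1 / 6) c) * X c) ^ 2 = weight (1 / 6) c * X c ^ 2 :=
    fun c => by rw [mul_pow, Real.sq_sqrt (weight_pos _ c).le]
  have e3 : ∀ c, Real.sqrt (weight (-(1 / 6)) c) ^ 2 = weight (-(1 / 6)) c :=
    fun c => Real.sq_sqrt (weight_pos _ c).le
  simp only [e1, e2, e3] at hcs
  rw [← Finset.sum_filter]
  have h1 : ∑ c ∈ (band N).filter (fun c => |c| ≤ |a|), weight (-(1 / 6)) c
      ≤ 4 * weight (1 / 6) a ^ 2 := by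
    refine le_trans (Finset.sum_le_sum_of_subset_of_nonneg (fun c hc => ?_)
      fun c _ _ => (weight_pos _ c).le) (sum_weight_neg_sixth_Icc_le a)
    rw [mem_band]
    simpa using (Finset.mem_filter.1 hc).2
  have h2 : ∑ c ∈ (band N).filter (fun c => |c| ≤ |a|), weight (1 / 6) c * X c ^ 2
      ≤ ∑ c ∈ band N, weight (1 / 6) c * X c ^ 2 :=
    Finset.sum_le_sum_of_subset_of_nonneg (Finset.filter_subset _ _)
      fun c _ _ => mul_nonneg (weight_pos _ c).le (sq_nonneg _)
  have h3 : 0 ≤ ∑ c ∈ band N, weight (1 / 6) c * X c ^ 2 :=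
    Finset.sum_nonneg fun c _ => mul_nonneg (weight_pos _ c).le (sq_nonneg _)
  refine (sq_le_sq₀ (Finset.sum_nonneg fun c _ => h0 c)
    (mul_nonneg (by linarith [weight_pos (1 / 6) a]) (Real.sqrt_nonneg _))).1 ?_
  rw [mul_pow, mul_pow, Real.sq_sqrt h3]
  refine hcs.trans ((mul_le_mul h1 h2 (Finset.sum_nonneg fun c _ =>
    mul_nonneg (weight_pos _ c).le (sq_nonneg _)) (by positivity)).trans_eq ?_)
  norm_num

/-- The endpoint Sobolev inequality for the cubic term: `|∫ w³| ≲ ‖w‖³` in `H^{1/6}`. -/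
theorem norm_mean_cube_trigPoly_le {N : ℕ} {a : ℤ → ℂ} (ha : ∀ k, ‖a (-k)‖ = ‖a k‖) :
    ‖mean L (trigPoly L N a ^ 3)‖
      ≤ 6 * Real.sqrt (∑ k ∈ band N, weight (1 / 6) k * ‖a k‖ ^ 2) ^ 3 := by
  set X : ℤ → ℝ := fun k => if k ∈ band N then ‖a k‖ else 0 with hX
  have hX0 : ∀ k, 0 ≤ X k := fun k => by simp only [hX]; split_ifs <;> simp
  have hX1 : ∀ k ∉ band N, X k = 0 := fun k hk => if_neg hk
  have hXb : ∀ k ∈ band N, X k = ‖a k‖ := fun k hk => if_pos hk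
  have h1 : ‖mean L (trigPoly L N a ^ 3)‖ ≤ ∑ j ∈ band N, ∑ k ∈ band N, X j * X k * X (j + k) := by
    rw [mean_cube_trigPoly]
    refine (norm_sum_le _ _).trans (Finset.sum_le_sum fun j hj => (norm_sum_le _ _).trans
      (Finset.sum_le_sum fun k hk => ?_))
    -- Only triples of frequencies with zero sum contribute to the mean of the cube; the symmetry of
    -- |a| replaces −j − k by j + k.
    have h2 : ‖if -j - k ∈ band N then a (-j - k) else 0‖ = X (j + k) := by
      simp only [show -j - k = -(j + k) by ring, neg_mem_band, hX]
      split_ifs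
      · exact ha _
      · exact norm_zero
    rw [norm_mul, norm_mul, h2, hXb j hj, hXb k hk, mul_assoc]
  have hY : ∑ c ∈ band N, weight (1 / 6) c * X c ^ 2 = ∑ k ∈ band N, weight (1 / 6) k * ‖a k‖ ^ 2 :=
    Finset.sum_congr rfl fun k hk => by rw [hXb k hk]
  set Y := ∑ k ∈ band N, weight (1 / 6) k * ‖a k‖ ^ 2 with hYdef
  have hY0 : 0 ≤ Y := Finset.sum_nonneg fun c _ => mul_nonneg (weight_pos _ c).le (sq_nonneg _)
  refine h1.trans ((triple_sum_le hX0 hX1).trans ?_)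
  have h3 : ∀ b ∈ band N, ∑ c ∈ band N, (if |c| ≤ |b| then X c * X b ^ 2 else 0)
      ≤ 2 * Real.sqrt Y * (weight (1 / 6) b * X b ^ 2) := fun b _ => by
    have h4 : ∑ c ∈ band N, (if |c| ≤ |b| then X c * X b ^ 2 else 0)
        = (∑ c ∈ band N, if |c| ≤ |b| then X c else 0) * X b ^ 2 := by
      rw [Finset.sum_mul]
      exact Finset.sum_congr rfl fun c _ => by rw [ite_mul (|c| ≤ |b|), zero_mul]
    rw [h4]
    refine (mul_le_mul_of_nonneg_right (sum_small_le hX0 b) (sq_nonneg _)).trans_eq ?_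
    rw [hY]
    ring
  -- The final constant 6 is 3 from `triple_sum_le` times 2 from `sum_small_le`.
  have h5 := Finset.sum_le_sum h3
  rw [← Finset.mul_sum, hY] at h5
  have h6 : Real.sqrt Y ^ 3 = Real.sqrt Y * Y := by
    rw [pow_succ, Real.sq_sqrt hY0, mul_comm]
  rw [h6]
  linarith

/-! ### Functions with summable Fourier coefficients -/

theorem summable_weight_neg_one : Summable (weight (-1)) := by
  have h : Summable fun k : ℤ => 1 / (k : ℝ) ^ 2 := Real.summable_one_div_int_pow.2 one_lt_two
  refine Summable.of_norm_bounded_eventually h ?_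
  rw [Filter.eventually_cofinite]
  refine (Set.finite_singleton (0 : ℤ)).subset fun k hk => ?_
  by_contra hk0
  refine hk ?_
  have hk1 : (0 : ℝ) < (k : ℝ) ^ 2 := by
    have : (k : ℝ) ≠ 0 := by exact_mod_cast hk0
    positivity
  rw [Real.norm_of_nonneg (weight_pos _ k).le, weight, Real.rpow_neg_one, one_div]
  exact inv_anti₀ hk1 (by linarith)

theorem norm_coeff_le_weight {s : ℝ} {u : L2per L} (hu : u ∈ Hs L s) (k : ℤ) :
    ‖coeff u k‖ ≤ sobolevNorm s u / Real.sqrt L * weight (-(s / 2)) k := by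
  have hL := period_pos L
  have h1 := le_hasSum (hasSum_sobolevNorm_sq hu) k fun j _ =>
    mul_nonneg hL.le (mul_nonneg (weight_pos s j).le (sq_nonneg ‖coeff u j‖))
  have h2 : weight (-(s / 2)) k = (weight (s / 2) k)⁻¹ := by
    rw [weight, weight, Real.rpow_neg (by positivity)]
  have hw := weight_pos (s / 2) k
  have hL' := Real.sqrt_pos.2 hL
  rw [h2, ← div_eq_mul_inv, le_div_iff₀ hw, le_div_iff₀ hL']
  refine (sq_le_sq₀ (by positivity) (sobolevNorm_nonneg s u)).1 ?_
  rw [mul_pow, mul_pow, weight_half_sq, Real.sq_sqrt hL.le]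
  linarith

theorem summable_norm_coeff {u : L2per L} (hu : u ∈ Hs L 2) : Summable fun k => ‖coeff u k‖ := by
  refine Summable.of_nonneg_of_le (fun _ => norm_nonneg _) (fun k => ?_)
    (summable_weight_neg_one.mul_left (sobolevNorm 2 u / Real.sqrt L))
  have := norm_coeff_le_weight hu k
  rwa [div_self two_ne_zero] at this

/-- A real continuous function as a complex continuous function. -/
def toComplex (f : C(AddCircle L, ℝ)) : C(AddCircle L, ℂ) :=
  ⟨fun x => (f x : ℂ), Complex.continuous_ofReal.comp f.continuous⟩

theorem fourierCoeff_toComplex (f : C(AddCircle L, ℝ)) (k : ℤ) :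
    fourierCoeff (toComplex f) k = coeff (ofCont f) k :=
  (coeff_ofCont f k).symm

omit [Fact (0 < L)] in
theorem toComplex_mul (f g : C(AddCircle L, ℝ)) :
    toComplex (f * g) = toComplex f * toComplex g := by
  ext x
  simp [toComplex]

theorem mean_toComplex (f : C(AddCircle L, ℝ)) :
    mean L (toComplex f) = ((L⁻¹ * ∫ x : AddCircle L, f x : ℝ) : ℂ) := by
  rw [mean_apply, AddCircle.integral_haarAddCircle]
  simp only [toComplex, ContinuousMap.coe_mk, integral_complex_ofReal, Complex.real_smul]
  push_cast
  rfl

/-- The Fourier series converges uniformly, and conjugate symmetry lets the real part be taken.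
Members of H² can thus be handled as continuous functions, for which squares and cubes are harmless.
-/
theorem exists_eq_ofCont {u : L2per L} (hu : Summable fun k => ‖coeff u k‖) :
    ∃ f : C(AddCircle L, ℝ), u = ofCont f := by
  have hs : Summable fun k => coeff u k • (fourier k : C(AddCircle L, ℂ)) := by
    refine Summable.of_norm (hu.congr fun k => ?_)
    rw [norm_smul, fourier_norm, mul_one]
  obtain ⟨U, hU⟩ := hs
  have hUc : ∀ k, fourierCoeff U k = coeff u k := fun k => by
    have h1 := (hU.mul_left (fourier (-k))).mapL (mean L)
    rw [← fourierCoeff_eq_mean] at h1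
    refine h1.unique ?_
    have h2 : ∀ j, mean L (fourier (-k) * (coeff u j • fourier j))
        = if j = k then coeff u k else 0 := fun j => by
      rw [mul_smul_comm, map_smul, ← fourierCoeff_eq_mean, fourierCoeff_fourier, Pi.single_apply,
        smul_eq_mul]
      by_cases h : k = j
      · rw [if_pos h, if_pos h.symm, mul_one, h]
      · rw [if_neg h, if_neg (fun h' => h h'.symm), mul_zero]
    simp only [h2]
    exact hasSum_ite_eq k _
  refine ⟨⟨fun x => (U x).re, Complex.continuous_re.comp U.continuous⟩, ext_coeff fun k => ?_⟩
  have hi : Integrable U (AddCircle.haarAddCircle : Measure (AddCircle L)) :=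
    U.continuous.integrable_of_hasCompactSupport (HasCompactSupport.of_compactSpace _)
  have hi' : Integrable (fun x => (starRingEnd ℂ) (U x))
      (AddCircle.haarAddCircle : Measure (AddCircle L)) :=
    (LinearIsometryEquiv.integrable_comp_iff Complex.conjLIE).2 hi
  have h1 := congrFun (fourierCoeff.add hi hi') k
  rw [Pi.add_apply, fourierCoeff_conj, hUc, hUc, coeff_neg, Complex.conj_conj] at h1
  have h2 : coeff (ofCont ⟨fun x => (U x).re, Complex.continuous_re.comp U.continuous⟩) k
      = (1 / 2 : ℂ) * fourierCoeff ((U : AddCircle L → ℂ) + fun x => (starRingEnd ℂ) (U x)) k := by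
    rw [coeff_ofCont, ← fourierCoeff.const_mul]
    refine fourierCoeff_congr (ae_of_all _ fun x => ?_) k
    rw [Pi.add_apply, Complex.add_conj, ContinuousMap.coe_mk]
    push_cast
    ring
  rw [h2, h1]
  ring

theorem hasSum_toComplex {f : C(AddCircle L, ℝ)} (hf : Summable fun k => ‖coeff (ofCont f) k‖) :
    HasSum (fun k => coeff (ofCont f) k • (fourier k : C(AddCircle L, ℂ))) (toComplex f) := by
  have h := hasSum_fourier_series_of_summable (f := toComplex f)
    (Summable.of_norm (by simpa only [fourierCoeff_toComplex] using hf))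
  simpa only [fourierCoeff_toComplex] using h

theorem tendsto_trigPoly {f : C(AddCircle L, ℝ)} (hf : Summable fun k => ‖coeff (ofCont f) k‖) :
    Tendsto (fun N => trigPoly L N (coeff (ofCont f))) atTop (𝓝 (toComplex f)) :=
  (hasSum_toComplex hf).comp tendsto_band

/-! ### The cubic functional -/

/-- The cubic functional `∫ u³`. -/
def cube (u : L2per L) : ℝ := ∫ x : AddCircle L, u x ^ 3

theorem cube_ofCont (f : C(AddCircle L, ℝ)) : cube (ofCont f) = ∫ x : AddCircle L, f x ^ 3 := by
  refine integral_congr_ae ?_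
  filter_upwards [ofCont_ae f] with x hx
  rw [hx]

theorem mean_toComplex_cube (f : C(AddCircle L, ℝ)) :
    mean L (toComplex f ^ 3) = ((L⁻¹ * cube (ofCont f) : ℝ) : ℂ) := by
  rw [cube_ofCont, pow_succ, sq, ← toComplex_mul, ← toComplex_mul, mean_toComplex]
  have : ∀ x, (f * f * f) x = f x ^ 3 := fun x => by
    simp only [ContinuousMap.mul_apply]
    ring
  simp only [this]

/-- Uniform convergence of the truncations carries the endpoint estimate over. Membership in H² is
qualitative: only the H^{1/6} norm enters the bound. -/
theorem abs_cube_le {u : L2per L} (hu : u ∈ Hs L 2) :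
    |cube u| ≤ 6 * L * (sobolevNorm (1 / 6) u / Real.sqrt L) ^ 3 := by
  have hL := period_pos L
  have hs := summable_norm_coeff hu
  have hu6 : u ∈ Hs L (1 / 6) := Hs_mono (by norm_num) hu
  obtain ⟨f, rfl⟩ := exists_eq_ofCont hs
  have h1 : Tendsto (fun N => ‖mean L (trigPoly L N (coeff (ofCont f)) ^ 3)‖) atTop
      (𝓝 ‖mean L (toComplex f ^ 3)‖) :=
    (((mean L).continuous.tendsto _).comp ((tendsto_trigPoly hs).pow 3)).norm
  have h2 : ‖mean L (toComplex f ^ 3)‖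
      ≤ 6 * (sobolevNorm (1 / 6) (ofCont f) / Real.sqrt L) ^ 3 := by
    refine le_of_tendsto' h1 fun N => ?_
    refine (norm_mean_cube_trigPoly_le fun k => by rw [coeff_neg, RCLike.norm_conj]).trans ?_
    refine mul_le_mul_of_nonneg_left (pow_le_pow_left₀ (Real.sqrt_nonneg _) ?_ 3) (by norm_num)
    rw [Real.sqrt_le_left (div_nonneg (sobolevNorm_nonneg _ _) (Real.sqrt_nonneg _)), div_pow,
      Real.sq_sqrt hL.le, le_div_iff₀ hL, mul_comm, Finset.mul_sum]
    exact sum_le_hasSum _ (fun k _ => mul_nonneg hL.le (mul_nonneg (weight_pos _ k).le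
      (sq_nonneg _))) (hasSum_sobolevNorm_sq hu6)
  rw [mean_toComplex_cube, Complex.norm_real, Real.norm_eq_abs, abs_mul, abs_inv, abs_of_pos hL,
    inv_mul_le_iff₀ hL] at h2
  linarith

theorem integrable_cont (f : C(AddCircle L, ℝ)) : Integrable (fun x : AddCircle L => f x) :=
  f.continuous.integrable_of_hasCompactSupport (HasCompactSupport.of_compactSpace _)

theorem cube_add_ofCont (f h : C(AddCircle L, ℝ)) :
    cube (ofCont f + ofCont h) = cube (ofCont f) + 3 * inner ℝ (ofCont (f * f)) (ofCont h)
      + 3 * inner ℝ (mulCont f (ofCont h)) (ofCont h) + cube (ofCont h) := by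
  have h1 : cube (ofCont f + ofCont h) = ∫ x : AddCircle L,
      ((f * f * f) x + 3 * (f * f * h) x + 3 * (f * (h * h)) x + (h * h * h) x) := by
    refine integral_congr_ae ?_
    filter_upwards [ofCont_ae f, ofCont_ae h, Lp.coeFn_add (ofCont f) (ofCont h)] with x h1 h2 h3
    rw [h3, Pi.add_apply, h1, h2]
    simp only [ContinuousMap.mul_apply]
    ring
  have h2 : inner ℝ (ofCont (f * f)) (ofCont h) = ∫ x : AddCircle L, (f * f * h) x := by
    rw [inner_eq_integral]
    refine integral_congr_ae ?_
    filter_upwards [ofCont_ae (f * f), ofCont_ae h] with x h1 h2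
    rw [h1, h2, ← ContinuousMap.mul_apply]
  have h3 : inner ℝ (mulCont f (ofCont h)) (ofCont h) = ∫ x : AddCircle L, (f * (h * h)) x := by
    rw [inner_mulCont]
    refine integral_congr_ae ?_
    filter_upwards [ofCont_ae h] with x h1
    rw [h1, ContinuousMap.mul_apply, ContinuousMap.mul_apply]
  have h4 : ∀ g : C(AddCircle L, ℝ), cube (ofCont g) = ∫ x : AddCircle L, (g * g * g) x := fun g => by
    rw [cube_ofCont]
    refine integral_congr_ae (ae_of_all _ fun x => ?_)
    simp only [ContinuousMap.mul_apply]
    ring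
  rw [h1, h2, h3, h4, h4, integral_add, integral_add, integral_add, integral_const_mul,
    integral_const_mul]
  · exact integrable_cont _
  · exact (integrable_cont _).const_mul 3
  · exact (integrable_cont _).add ((integrable_cont _).const_mul 3)
  · exact (integrable_cont _).const_mul 3
  · exact ((integrable_cont _).add ((integrable_cont _).const_mul 3)).add
      ((integrable_cont _).const_mul 3)
  · exact integrable_cont _

/-! ### Translations -/

theorem measurePreserving_add (r : AddCircle L) :
    MeasurePreserving (fun x : AddCircle L => x + r) volume volume :=
  measurePreserving_add_right volume r

/-- The translate `u(· + r)`. -/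
def shift (r : ℝ) (u : L2per L) : L2per L :=
  Lp.compMeasurePreserving (fun x : AddCircle L => x + (r : AddCircle L))
    (measurePreserving_add _) u

theorem shift_ae (r : ℝ) (u : L2per L) : ∀ᵐ x : AddCircle L, shift r u x = u (x + r) :=
  Lp.coeFn_compMeasurePreserving u (measurePreserving_add _)

theorem coeff_shift (r : ℝ) (u : L2per L) (k : ℤ) :
    coeff (shift r u) k = Complex.exp (Complex.I * freq L k * r) * coeff u k := by
  have h1 : coeff (shift r u) k = fourierCoeff (fun x : AddCircle L => ((u (x + r) : ℝ) : ℂ)) k := by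
    refine fourierCoeff_congr ?_ k
    filter_upwards [shift_ae r u] with x hx
    rw [hx]
  have h2 : fourier k (r : AddCircle L) = Complex.exp (Complex.I * freq L k * r) := by
    rw [fourier_coe_apply]
    congr 1
    simp only [freq]
    push_cast
    ring
  rw [h1, coeff, fourierCoeff, fourierCoeff, ← integral_const_mul, ← h2,
    ← integral_add_right_eq_self (μ := AddCircle.haarAddCircle)
      (fun x : AddCircle L => fourier k (r : AddCircle L) * fourier (-k) x • ((u x : ℝ) : ℂ))
      (r : AddCircle L)]
  refine integral_congr_ae (ae_of_all _ fun x => ?_)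
  have h3 : fourier (-k) (x : AddCircle L)
      = fourier k (r : AddCircle L) * fourier (-k) (x + r : AddCircle L) := by
    simp only [fourier_apply, neg_smul, smul_add, AddCircle.toCircle_add, Circle.coe_mul]
    rw [mul_left_comm, ← Circle.coe_mul, ← AddCircle.toCircle_add, add_neg_cancel,
      AddCircle.toCircle_zero, Circle.coe_one, mul_one]
  simp only [smul_eq_mul]
  rw [h3, mul_assoc]

omit [Fact (0 < L)] in
theorem norm_exp_freq (k : ℤ) (r : ℝ) : ‖Complex.exp (Complex.I * freq L k * r)‖ = 1 := by
  rw [mul_assoc, mul_comm, ← Complex.ofReal_mul, Complex.norm_exp_ofReal_mul_I]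

theorem norm_coeff_shift (r : ℝ) (u : L2per L) (k : ℤ) : ‖coeff (shift r u) k‖ = ‖coeff u k‖ := by
  rw [coeff_shift, norm_mul, norm_exp_freq, one_mul]

theorem cube_shift (r : ℝ) (u : L2per L) : cube (shift r u) = cube u := by
  rw [cube, cube, ← integral_add_right_eq_self (μ := volume) (fun x : AddCircle L => u x ^ 3)
    (r : AddCircle L)]
  refine integral_congr_ae ?_
  filter_upwards [shift_ae r u] with x hx
  rw [hx]

theorem shift_mem_Hs {s r : ℝ} {u : L2per L} (hu : u ∈ Hs L s) : shift r u ∈ Hs L s := by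
  rw [mem_Hs] at hu ⊢
  simpa only [norm_coeff_shift] using hu

theorem norm_shift (r : ℝ) (u : L2per L) : ‖shift r u‖ = ‖u‖ :=
  Lp.norm_compMeasurePreserving u (measurePreserving_add _)

theorem symbolForm_shift (w : ℤ → ℝ) (r : ℝ) (u : L2per L) :
    symbolForm w (shift r u) (shift r u) = symbolForm w u u :=
  tsum_congr fun k => by rw [re_mul_conj_self, re_mul_conj_self, norm_coeff_shift]

theorem inner_oneL2_eq_coeff (u : L2per L) : inner ℝ u (oneL2 L) = L * (coeff u 0).re := by
  refine (hasSum_inner_coeff u (oneL2 L)).unique ?_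
  have h : ∀ k : ℤ, L * (coeff u k * (starRingEnd ℂ) (coeff (oneL2 L) k)).re
      = if k = 0 then L * (coeff u 0).re else 0 := fun k => by
    rw [coeff_oneL2]
    by_cases hk : k = 0 <;> simp [hk]
  simp only [h]
  exact hasSum_ite_eq 0 _

theorem inner_oneL2_shift (r : ℝ) (u : L2per L) :
    inner ℝ (shift r u) (oneL2 L) = inner ℝ u (oneL2 L) := by
  rw [inner_oneL2_eq_coeff, inner_oneL2_eq_coeff, coeff_shift, freq_zero]
  simp

/-! ### Derivatives of functionals of trigonometric polynomials -/

theorem hasDerivWithinAt_trigPoly {N : ℕ} {a : ℝ → ℤ → ℂ} {a' : ℤ → ℂ} {s : Set ℝ} {t : ℝ}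
    (h : ∀ k, HasDerivWithinAt (fun τ => a τ k) (a' k) s t) :
    HasDerivWithinAt (fun τ => trigPoly L N (a τ)) (trigPoly L N a') s t := by
  unfold trigPoly
  exact HasDerivWithinAt.fun_sum fun k _ => (h k).smul_const (fourier k : C(AddCircle L, ℂ))

theorem hasDerivWithinAt_mean_cube {N : ℕ} {a : ℝ → ℤ → ℂ} {a' : ℤ → ℂ} {s : Set ℝ} {t : ℝ}
    (h : ∀ k, HasDerivWithinAt (fun τ => a τ k) (a' k) s t) :
    HasDerivWithinAt (fun τ => mean L (trigPoly L N (a τ) ^ 3))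
      (3 * ∑ k ∈ band N, a' k
        * fourierCoeff (trigPoly L N (a t) * trigPoly L N (a t) : C(AddCircle L, ℂ)) (-k)) s t := by
  have h1 := (hasDerivWithinAt_trigPoly (L := L) (N := N) h)
  have h2 := ((h1.mul h1).mul h1)
  have h3 := (((mean L).restrictScalars ℝ).hasFDerivAt
    (x := trigPoly L N (a t) * trigPoly L N (a t) * trigPoly L N (a t))).comp_hasDerivWithinAt t h2
  rw [← mean_mul_trigPoly]
  convert! h3 using 1
  · funext τ
    simp only [Function.comp, ContinuousLinearMap.coe_restrictScalars', Pi.mul_apply]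
    rw [pow_succ, sq]
  · rw [ContinuousLinearMap.coe_restrictScalars', ← smul_eq_mul, ← map_smul]
    congr 1
    ext x
    simp only [ContinuousMap.smul_apply, ContinuousMap.mul_apply, ContinuousMap.add_apply,
      smul_eq_mul, Pi.mul_apply]
    ring

/-- Translation invariance of the cubic functional, differentiated. -/
theorem sum_freq_mul_fourierCoeff_sq (N : ℕ) (a : ℤ → ℂ) :
    ∑ k ∈ band N, Complex.I * freq L k * a k
      * fourierCoeff (trigPoly L N a * trigPoly L N a : C(AddCircle L, ℂ)) (-k) = 0 := by
  set b : ℝ → ℤ → ℂ := fun σ k => Complex.exp (Complex.I * freq L k * σ) * a k with hb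
  have hd : ∀ k, HasDerivWithinAt (fun σ => b σ k) (Complex.I * freq L k * a k) Set.univ 0 :=
    fun k => by
      have h1 : HasDerivAt (fun σ : ℝ => Complex.I * freq L k * (σ : ℂ)) (Complex.I * freq L k) 0 := by
        simpa using (Complex.ofRealCLM.hasDerivAt (x := (0 : ℝ))).const_mul (Complex.I * freq L k)
      have h2 := (h1.cexp.mul_const (a k)).hasDerivWithinAt (s := Set.univ)
      simpa using h2
  have hb0 : b 0 = a := by
    funext k
    simp [hb]
  have h3 := hasDerivWithinAt_mean_cube (L := L) (N := N) hd
  have hconst : (fun σ => mean L (trigPoly L N (b σ) ^ 3)) = fun _ => mean L (trigPoly L N a ^ 3) := by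
    funext σ
    rw [mean_cube_trigPoly, mean_cube_trigPoly]
    refine Finset.sum_congr rfl fun k _ => Finset.sum_congr rfl fun j _ => ?_
    split_ifs
    · have h4 : Complex.exp (Complex.I * freq L k * σ) * (Complex.exp (Complex.I * freq L j * σ)
          * Complex.exp (Complex.I * freq L (-k - j) * σ)) = 1 := by
        rw [← Complex.exp_add, ← Complex.exp_add, ← Complex.exp_zero]
        congr 1
        simp only [freq]
        push_cast
        ring
      simp only [hb]
      linear_combination (a k * a j * a (-k - j)) * h4
    · simp
  rw [hconst, hb0] at h3
  have h5 := (hasDerivWithinAt_univ.1 h3).unique (hasDerivAt_const (0 : ℝ) _)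
  simpa using h5

theorem sum_band_odd {N : ℕ} {g : ℤ → ℂ} (h : ∀ k, g (-k) = -g k) : ∑ k ∈ band N, g k = 0 := by
  have h1 := sum_band_neg N g
  simp only [h, Finset.sum_neg_distrib] at h1
  exact self_eq_neg.1 h1.symm

theorem sum_band_swap {N : ℕ} {p q g : ℤ → ℂ} (h : ∀ k, g (-k) = g k) :
    ∑ k ∈ band N, g k * (p k * q (-k)) = ∑ k ∈ band N, g k * (p (-k) * q k) := by
  rw [← sum_band_neg]
  refine Finset.sum_congr rfl fun k _ => ?_
  rw [h, neg_neg]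

/-! ### Uniform bounds along smooth solutions -/

theorem exists_sobolevNorm_le {s : ℝ} {u : ℝ → L2per L} (hu : ContinuousInHs s u) (T : ℝ) :
    ∃ R, ∀ t, 0 ≤ t → t ≤ T → sobolevNorm s (u t) ≤ R := by
  have hc : ContinuousOn (fun t => sobolevNorm s (u t)) (Set.Icc 0 T) := by
    intro t₀ ht₀
    rw [ContinuousWithinAt, tendsto_iff_norm_sub_tendsto_zero]
    have h := (hu.2 t₀ ht₀.1).mono_left (nhdsWithin_mono t₀ fun x (hx : x ∈ Set.Icc 0 T) => hx.1)
    refine squeeze_zero' (Eventually.of_forall fun _ => norm_nonneg _) ?_ h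
    filter_upwards [self_mem_nhdsWithin] with t ht
    have h0 := hu.1 t₀ ht₀.1
    have h1 := hu.1 t ht.1
    have h2 := sobolevNorm_add_le (Hs_sub h1 h0) h0
    have h3 := sobolevNorm_add_le (Hs_sub h0 h1) h1
    rw [sub_add_cancel] at h2 h3
    rw [sobolevNorm_sub_comm] at h3
    rw [Real.norm_eq_abs, abs_le]
    constructor <;> linarith
  obtain ⟨R, hR⟩ := (isCompact_Icc.image_of_continuousOn hc).bddAbove
  exact ⟨R, fun t h0 hT => hR ⟨t, ⟨h0, hT⟩, rfl⟩⟩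

/-- The H^{2p} norm is bounded on [0, T], and a single coefficient is controlled by the square root
of the weight of order 2p. -/
theorem exists_norm_coeff_le {u : ℝ → L2per L} (hu : ∀ r, ContinuousInHs r u) (p T : ℝ) :
    ∃ C, 0 ≤ C ∧ ∀ t, 0 ≤ t → t ≤ T → ∀ k, ‖coeff (u t) k‖ ≤ C * weight (-p) k := by
  obtain ⟨R, hR⟩ := exists_sobolevNorm_le (hu (2 * p)) T
  have hL' := Real.sqrt_pos.2 (period_pos L)
  refine ⟨|R| / Real.sqrt L, by positivity, fun t h0 hT k => ?_⟩
  have h1 := norm_coeff_le_weight ((hu (2 * p)).1 t h0) k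
  rw [mul_div_cancel_left₀ p two_ne_zero] at h1
  refine h1.trans (mul_le_mul_of_nonneg_right ?_ (weight_pos _ k).le)
  exact div_le_div_of_nonneg_right ((hR t h0 hT).trans (le_abs_self R)) hL'.le

/-- The total mass of the weight `(1 + k²)⁻¹`. -/
def weightSum : ℝ := ∑' k, weight (-1) k

theorem weightSum_nonneg : 0 ≤ weightSum := tsum_nonneg fun k => (weight_pos (-1) k).le

theorem norm_smul_fourier (c : ℂ) (k : ℤ) : ‖c • (fourier k : C(AddCircle L, ℂ))‖ = ‖c‖ := by
  rw [norm_smul, fourier_norm, mul_one]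

theorem norm_trigPoly_le {C : ℝ} {a : ℤ → ℂ} (ha : ∀ k, ‖a k‖ ≤ C * weight (-1) k) (hC : 0 ≤ C)
    (N : ℕ) : ‖trigPoly L N a‖ ≤ C * weightSum := by
  refine (norm_sum_le _ _).trans ?_
  simp only [norm_smul_fourier]
  refine (Finset.sum_le_sum fun k _ => ha k).trans ?_
  rw [← Finset.mul_sum]
  exact mul_le_mul_of_nonneg_left (summable_weight_neg_one.sum_le_tsum _ fun k _ =>
    (weight_pos _ k).le) hC

/-- The decay of order −3 is split: order −1 gives summability, order −2 gives the tail factor (1 +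
N²)⁻². -/
theorem norm_sub_trigPoly_le {C : ℝ} {f : C(AddCircle L, ℝ)}
    (ha : ∀ k, ‖coeff (ofCont f) k‖ ≤ C * weight (-3) k) (hC : 0 ≤ C) (N : ℕ) :
    ‖toComplex f - trigPoly L N (coeff (ofCont f))‖ ≤ C * weightSum / (1 + (N : ℝ) ^ 2) ^ 2 := by
  have hs : Summable fun k => ‖coeff (ofCont f) k‖ :=
    Summable.of_nonneg_of_le (fun _ => norm_nonneg _) (fun k => (ha k).trans
      (mul_le_mul_of_nonneg_left (weight_mono (by norm_num) k) hC))
      (summable_weight_neg_one.mul_left C)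
  set D : ℝ := (1 + (N : ℝ) ^ 2) ^ 2 with hD
  have hD0 : 0 < D := by positivity
  have h1 := (hasSum_toComplex hs).sub (hasSum_sum_of_ne_finset_zero (s := band N)
    (f := fun k => if k ∈ band N then coeff (ofCont f) k • (fourier k : C(AddCircle L, ℂ)) else 0)
    (L := .unconditional ℤ) fun k hk => if_neg hk)
  rw [Finset.sum_congr rfl fun k hk => if_pos hk] at h1
  change HasSum _ (toComplex f - trigPoly L N (coeff (ofCont f))) at h1
  rw [← h1.tsum_eq]
  have h2 : ∀ k, ‖coeff (ofCont f) k • (fourier k : C(AddCircle L, ℂ))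
      - (if k ∈ band N then coeff (ofCont f) k • (fourier k : C(AddCircle L, ℂ)) else 0)‖
      ≤ C / D * weight (-1) k := fun k => by
    by_cases hk : k ∈ band N
    · rw [if_pos hk, sub_self, norm_zero]
      exact mul_nonneg (by positivity) (weight_pos _ k).le
    · rw [if_neg hk, sub_zero, norm_smul_fourier]
      refine (ha k).trans ?_
      have h3 : weight (-3) k = weight (-1) k * weight (-2) k := by
        rw [← weight_add]; norm_num
      have h4 : weight (-2) k ≤ 1 / D := by
        have h5 : (N : ℝ) ^ 2 ≤ (k : ℝ) ^ 2 := by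
          rw [mem_band, not_le] at hk
          have : ((N : ℤ) : ℝ) < |(k : ℝ)| := by exact_mod_cast hk
          rw [Int.cast_natCast] at this
          rw [← sq_abs (k : ℝ)]
          exact pow_le_pow_left₀ N.cast_nonneg this.le 2
        rw [weight, Real.rpow_neg (by positivity), one_div, hD]
        refine inv_anti₀ hD0 ?_
        rw [Real.rpow_two]
        exact pow_le_pow_left₀ (by positivity) (by linarith) 2
      rw [h3]
      have h6 := mul_le_mul_of_nonneg_left h4 (mul_nonneg hC (weight_pos (-1) k).le)
      calc C * (weight (-1) k * weight (-2) k) = C * weight (-1) k * weight (-2) k := by ring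
        _ ≤ C * weight (-1) k * (1 / D) := h6
        _ = C / D * weight (-1) k := by ring
  refine (tsum_of_norm_bounded (summable_weight_neg_one.hasSum.mul_left (C / D)) h2).trans_eq ?_
  rw [weightSum]
  ring

theorem norm_toComplex_le {C : ℝ} {f : C(AddCircle L, ℝ)}
    (ha : ∀ k, ‖coeff (ofCont f) k‖ ≤ C * weight (-1) k) (hC : 0 ≤ C) :
    ‖toComplex f‖ ≤ C * weightSum := by
  have hs : Summable fun k => ‖coeff (ofCont f) k‖ :=
    Summable.of_nonneg_of_le (fun _ => norm_nonneg _) ha (summable_weight_neg_one.mul_left C)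
  exact le_of_tendsto' (tendsto_trigPoly hs).norm fun N => norm_trigPoly_le ha hC N

/-- There are 2N + 1 terms with frequencies up to 2πN/L, a growth of order N², so two powers of (1 +
N²)⁻¹ in the error leave one. The 3 comes from (2N + 1)N ≤ 3(1 + N²). -/
theorem norm_sum_band_freq_le {N : ℕ} {r g : ℤ → ℂ} {a b : ℝ} (ha : 0 ≤ a)
    (hr : ∀ k, ‖r k‖ ≤ a / (1 + (N : ℝ) ^ 2) ^ 2) (hg : ∀ k, ‖g k‖ ≤ b) :
    ‖∑ k ∈ band N, Complex.I * freq L k * (r k * g k)‖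
      ≤ (2 * Real.pi / L * 3 * (a * b)) / (1 + (N : ℝ) ^ 2) := by
  have hL := period_pos L
  have hpi := Real.pi_pos
  have hb : 0 ≤ b := (norm_nonneg _).trans (hg 0)
  set D := 1 + (N : ℝ) ^ 2 with hD
  have hD0 : 0 < D := by positivity
  have h1 : ∀ k ∈ band N, ‖Complex.I * freq L k * (r k * g k)‖
      ≤ 2 * Real.pi / L * N * (a / D ^ 2 * b) := fun k hk => by
    rw [norm_mul, norm_mul, norm_mul, Complex.norm_I, one_mul, Complex.norm_real, Real.norm_eq_abs,
      abs_freq]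
    have h2 : |(k : ℝ)| ≤ N := by
      rw [mem_band] at hk
      exact_mod_cast hk
    gcongr
    · exact hr k
    · exact hg k
  refine (norm_sum_le _ _).trans ((Finset.sum_le_card_nsmul _ _ _ h1).trans ?_)
  have hcard : (band N).card = 2 * N + 1 := by
    rw [band, Int.card_Icc]
    omega
  rw [hcard, nsmul_eq_mul, le_div_iff₀ hD0]
  push_cast
  have h3 : (2 * (N : ℝ) + 1) * N ≤ 3 * D := by nlinarith [sq_nonneg ((N : ℝ) - 1)]
  have h4 : 0 ≤ 2 * Real.pi / L * (a * b) / D := by positivity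
  calc (2 * (N : ℝ) + 1) * (2 * Real.pi / L * N * (a / D ^ 2 * b)) * D
      = (2 * (N : ℝ) + 1) * N * (2 * Real.pi / L * (a * b) / D) := by field_simp
    _ ≤ 3 * D * (2 * Real.pi / L * (a * b) / D) := mul_le_mul_of_nonneg_right h3 h4
    _ = 2 * Real.pi / L * 3 * (a * b) := by field_simp

/-! ### Conservation laws for smooth solutions -/

theorem fourierCoeff_sub_cont (f g : C(AddCircle L, ℂ)) (k : ℤ) :
    fourierCoeff (f - g : C(AddCircle L, ℂ)) k = fourierCoeff f k - fourierCoeff g k := by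
  rw [fourierCoeff_eq_mean, fourierCoeff_eq_mean, fourierCoeff_eq_mean, mul_sub, map_sub]

/-- The Fourier coefficients of the variational derivative of the truncated energy. -/
def galerkinGradient (L : ℝ) [Fact (0 < L)] (θ : ℝ → ℝ) (N : ℕ) (a : ℤ → ℂ) (k : ℤ) : ℂ :=
  θ k * a k - 1 / 2 * fourierCoeff (trigPoly L N a * trigPoly L N a : C(AddCircle L, ℂ)) k

/-- The truncation error of the quadratic term. -/
def galerkinError (N : ℕ) (f : C(AddCircle L, ℝ)) (k : ℤ) : ℂ :=
  1 / 2 * fourierCoeff (toComplex f * toComplex f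
    - trigPoly L N (coeff (ofCont f)) * trigPoly L N (coeff (ofCont f)) : C(AddCircle L, ℂ)) k

theorem fourierCoeff_flux (f : C(AddCircle L, ℝ)) (k : ℤ) :
    fourierCoeff (fun x : AddCircle L => ((flux (ofCont f x) : ℝ) : ℂ)) k
      = 1 / 2 * fourierCoeff (toComplex f * toComplex f : C(AddCircle L, ℂ)) k := by
  rw [← fourierCoeff.const_mul]
  refine fourierCoeff_congr ?_ k
  filter_upwards [ofCont_ae f] with x hx
  rw [hx, flux, ContinuousMap.mul_apply, show toComplex f x = (f x : ℂ) from rfl]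
  push_cast
  ring

/-- Hamiltonian form of the equation: u_t is ∂ₓ of the energy gradient. The solution is the exact
one; only the functional is truncated, at an arbitrary N, and the discrepancy is put into the error
term. -/
theorem IsGlobalSolution.hasDerivWithinAt_coeff {θ : ℝ → ℝ} {s : ℝ} {u₀ : L2per L}
    {u : ℝ → L2per L} (hu : IsGlobalSolution θ s u₀ u) {t : ℝ} (ht : 0 ≤ t)
    {f : C(AddCircle L, ℝ)} (hf : u t = ofCont f) (N : ℕ) (k : ℤ) :
    HasDerivWithinAt (fun τ => coeff (u τ) k)
      (Complex.I * freq L k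
        * (galerkinGradient L θ N (coeff (ofCont f)) k - galerkinError N f k)) (Set.Ici 0) t := by
  refine (hu.equation k t ht).congr_deriv ?_
  rw [hf, fourierCoeff_flux, galerkinGradient, galerkinError, fourierCoeff_sub_cont, freq]
  push_cast
  ring

section Bounds

variable {C : ℝ} {f : C(AddCircle L, ℝ)}

theorem norm_galerkinError_le (ha : ∀ k, ‖coeff (ofCont f) k‖ ≤ C * weight (-3) k) (hC : 0 ≤ C)
    (N : ℕ) (k : ℤ) :
    ‖galerkinError N f k‖ ≤ (C * weightSum) ^ 2 / (1 + (N : ℝ) ^ 2) ^ 2 := by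
  have ha1 : ∀ k, ‖coeff (ofCont f) k‖ ≤ C * weight (-1) k := fun k => (ha k).trans
    (mul_le_mul_of_nonneg_left (weight_mono (by norm_num) k) hC)
  have hW := weightSum_nonneg
  have h1 := norm_sub_trigPoly_le ha hC N
  have h2 := norm_toComplex_le ha1 hC
  have h3 := norm_trigPoly_le (L := L) ha1 hC N
  set w := trigPoly L N (coeff (ofCont f))
  have h4 : toComplex f * toComplex f - w * w = (toComplex f - w) * (toComplex f + w) := by ring
  have h5 : ‖toComplex f + w‖ ≤ 2 * (C * weightSum) := (norm_add_le _ _).trans (by linarith)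
  rw [galerkinError, norm_mul, h4]
  have h6 := (norm_fourierCoeff_le ((toComplex f - w) * (toComplex f + w)) k).trans
    ((norm_mul_le _ _).trans (mul_le_mul h1 h5 (norm_nonneg _) (by positivity)))
  have h7 : ‖(1 / 2 : ℂ)‖ = 1 / 2 := by norm_num
  rw [h7]
  calc 1 / 2 * ‖fourierCoeff ((toComplex f - w) * (toComplex f + w) : C(AddCircle L, ℂ)) k‖
      ≤ 1 / 2 * (C * weightSum / (1 + (N : ℝ) ^ 2) ^ 2 * (2 * (C * weightSum))) :=
        mul_le_mul_of_nonneg_left h6 (by norm_num)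
    _ = (C * weightSum) ^ 2 / (1 + (N : ℝ) ^ 2) ^ 2 := by ring

/-- The extra decay m/2 compensates the growth of θ, so the bound is uniform in k and N. -/
theorem norm_galerkinGradient_le {θ : ℝ → ℝ} {m υ₁ υ₂ : ℝ} (hθ : SymbolBounds θ m υ₁ υ₂)
    (ha : ∀ k, ‖coeff (ofCont f) k‖ ≤ C * weight (-(m / 2 + 3)) k) (hC : 0 ≤ C) (N : ℕ) (k : ℤ) :
    ‖galerkinGradient L θ N (coeff (ofCont f)) k‖ ≤ |υ₂| * C + (C * weightSum) ^ 2 := by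
  have hm := hθ.pos
  have ha1 : ∀ k, ‖coeff (ofCont f) k‖ ≤ C * weight (-1) k := fun k => (ha k).trans
    (mul_le_mul_of_nonneg_left (weight_mono (by linarith) k) hC)
  have h3 := norm_trigPoly_le (L := L) ha1 hC N
  set w := trigPoly L N (coeff (ofCont f)) with hw
  have hW := weightSum_nonneg
  have h1 : ‖(θ k : ℂ) * coeff (ofCont f) k‖ ≤ |υ₂| * C := by
    rw [norm_mul, Complex.norm_real, Real.norm_eq_abs]
    have h4 : weight (m / 2) k * weight (-(m / 2 + 3)) k ≤ 1 := by
      rw [← weight_add]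
      have := weight_mono (show m / 2 + -(m / 2 + 3) ≤ 0 by linarith) k
      rwa [show weight 0 k = 1 by simp [weight]] at this
    calc |θ k| * ‖coeff (ofCont f) k‖
        ≤ |υ₂| * weight (m / 2) k * (C * weight (-(m / 2 + 3)) k) :=
          mul_le_mul (hθ.abs_le k) (ha k) (norm_nonneg _)
            (mul_nonneg (abs_nonneg _) (weight_pos _ k).le)
      _ = |υ₂| * C * (weight (m / 2) k * weight (-(m / 2 + 3)) k) := by ring
      _ ≤ |υ₂| * C * 1 := mul_le_mul_of_nonneg_left h4 (by positivity)
      _ = |υ₂| * C := mul_one _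
  have h2 : ‖1 / 2 * fourierCoeff (w * w : C(AddCircle L, ℂ)) k‖ ≤ (C * weightSum) ^ 2 := by
    have h6 := (norm_fourierCoeff_le (w * w) k).trans
      ((norm_mul_le _ _).trans (mul_le_mul h3 h3 (norm_nonneg _) (by positivity)))
    have h7 : ‖(1 / 2 : ℂ)‖ = 1 / 2 := by norm_num
    rw [norm_mul, h7]
    nlinarith [norm_nonneg (fourierCoeff (w * w : C(AddCircle L, ℂ)) k)]
  rw [galerkinGradient]
  exact (norm_sub_le _ _).trans (add_le_add h1 h2)

end Bounds

/-- A limit of functions with derivatives tending to zero is constant. -/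
theorem eq_of_tendsto_of_deriv_le {J : ℕ → ℝ → ℂ} {J₀ J₁ : ℂ} {T C : ℝ} (hT : 0 ≤ T)
    (hd : ∀ N, ∀ t, 0 ≤ t → t ≤ T → ∃ e, HasDerivWithinAt (J N) e (Set.Ici 0) t ∧
      ‖e‖ ≤ C / (1 + (N : ℝ) ^ 2))
    (h0 : Tendsto (fun N => J N 0) atTop (𝓝 J₀)) (h1 : Tendsto (fun N => J N T) atTop (𝓝 J₁)) :
    J₁ = J₀ := by
  have hb : ∀ N, ‖J N T - J N 0‖ ≤ C / (1 + (N : ℝ) ^ 2) * T := fun N => by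
    choose! e he hle using hd N
    have h := Convex.norm_image_sub_le_of_norm_hasDerivWithin_le (f := J N) (f' := e)
      (s := Set.Icc 0 T) (x := 0) (y := T) (C := C / (1 + (N : ℝ) ^ 2))
      (fun t ht => (he t ht.1 ht.2).mono fun x hx => hx.1)
      (fun t ht => hle t ht.1 ht.2) (convex_Icc 0 T) ⟨le_rfl, hT⟩ ⟨hT, le_rfl⟩
    rwa [sub_zero, Real.norm_of_nonneg hT] at h
  have hz : Tendsto (fun N : ℕ => C / (1 + (N : ℝ) ^ 2) * T) atTop (𝓝 0) := by
    have h2 : Tendsto (fun N : ℕ => 1 + (N : ℝ) ^ 2) atTop atTop :=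
      tendsto_atTop_add_const_left _ _
        ((tendsto_pow_atTop two_ne_zero).comp tendsto_natCast_atTop_atTop)
    simpa using (h2.const_div_atTop C).mul_const T
  have h3 := squeeze_zero_norm hb hz
  exact sub_eq_zero.1 (tendsto_nhds_unique (h1.sub h0) h3)

/-- The energy `½ (𝓜 u, u) - ⅙ ∫ u³`. -/
def energy (θ : ℝ → ℝ) (u : L2per L) : ℝ :=
  1 / 2 * symbolForm (fun k : ℤ => θ k) u u - 1 / 6 * cube u

theorem coeff_mul_coeff_neg (u : L2per L) (k : ℤ) :
    coeff u k * coeff u (-k) = ((‖coeff u k‖ ^ 2 : ℝ) : ℂ) := by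
  rw [coeff_neg, Complex.mul_conj, Complex.normSq_eq_norm_sq]

theorem tendsto_sum_band_symbol {w : ℤ → ℝ} {u : L2per L} {S : ℝ}
    (h : HasSum (fun k => L * (w k * ‖coeff u k‖ ^ 2)) S) :
    Tendsto (fun N => ∑ k ∈ band N, (w k : ℂ) * (coeff u k * coeff u (-k))) atTop
      (𝓝 ((L⁻¹ * S : ℝ) : ℂ)) := by
  have h1 := (Complex.continuous_ofReal.tendsto _).comp ((h.mul_left L⁻¹).comp tendsto_band)
  refine h1.congr fun N => ?_
  simp only [Function.comp, inv_mul_cancel_left₀ (period_pos L).ne']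
  push_cast
  refine Finset.sum_congr rfl fun k _ => ?_
  rw [coeff_mul_coeff_neg]
  push_cast
  ring

/-- Since `w` is even, the reflection k ↦ −k identifies the two terms of the product rule. -/
theorem hasDerivWithinAt_sum_band {N : ℕ} {w : ℤ → ℝ} (hw : ∀ k, w (-k) = w k) {a : ℝ → ℤ → ℂ}
    {a' : ℤ → ℂ} {s : Set ℝ} {t : ℝ} (h : ∀ k, HasDerivWithinAt (fun τ => a τ k) (a' k) s t) :
    HasDerivWithinAt (fun τ => ∑ k ∈ band N, (w k : ℂ) * (a τ k * a τ (-k)))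
      (2 * ∑ k ∈ band N, (w k : ℂ) * (a' k * a t (-k))) s t := by
  have h1 := HasDerivWithinAt.fun_sum fun k (_ : k ∈ band N) =>
    ((h k).mul (h (-k))).const_mul (w k : ℂ)
  refine h1.congr_deriv ?_
  have h2 := sum_band_swap (N := N) (p := a t) (q := a') (g := fun k => (w k : ℂ))
    fun k => by rw [hw]
  simp only [mul_add, Finset.sum_add_distrib]
  rw [h2]
  simp only [mul_comm (a t (-_)) (a' _)]
  ring

namespace SymbolBounds

variable {θ : ℝ → ℝ} {m υ₁ υ₂ : ℝ} (hθ : SymbolBounds θ m υ₁ υ₂) {s : ℝ} {u₀ : L2per L}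
  {u : ℝ → L2per L} (hu : IsGlobalSolution θ s u₀ u) (hreg : ∀ r, ContinuousInHs r u)

include hu in
omit hθ in
-- The equation is in divergence form, so the zero mode has zero derivative.
theorem _root_.PeriodicWave.inner_oneL2_conserved {t : ℝ} (ht : 0 ≤ t) :
    inner ℝ (u t) (oneL2 L) = inner ℝ u₀ (oneL2 L) := by
  have h : coeff (u t) 0 = coeff (u 0) 0 := by
    have h1 := Convex.norm_image_sub_le_of_norm_hasDerivWithin_le
      (f := fun τ => coeff (u τ) 0) (f' := fun _ => 0)
      (s := Set.Ici 0) (x := 0) (y := t) (C := 0)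
      (fun τ hτ => (hu.equation 0 τ hτ).congr_deriv (by simp))
      (fun _ _ => by simp) (convex_Ici 0) (Set.mem_Ici.2 le_rfl) ht
    rw [zero_mul] at h1
    exact sub_eq_zero.1 (norm_le_zero_iff.1 h1)
  rw [inner_oneL2_eq_coeff, inner_oneL2_eq_coeff, h, hu.initial]

include hθ hu hreg

/-- In the derivative of the truncated norm the dispersive part is odd in k, and the quadratic part
vanishes by translation invariance of the truncated cubic functional. Only the truncation error
survives, and it tends to zero uniformly on [0, t]. -/
theorem norm_sq_conserved {t : ℝ} (ht : 0 ≤ t) : ‖u t‖ ^ 2 = ‖u₀‖ ^ 2 := by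
  obtain ⟨C, hC, hb⟩ := exists_norm_coeff_le hreg 3 t
  set J : ℕ → ℝ → ℂ := fun N τ =>
    ∑ k ∈ band N, ((1 : ℝ) : ℂ) * (coeff (u τ) k * coeff (u τ) (-k)) with hJ
  have hlim : ∀ τ, Tendsto (fun N => J N τ) atTop (𝓝 ((L⁻¹ * ‖u τ‖ ^ 2 : ℝ) : ℂ)) := fun τ =>
    tendsto_sum_band_symbol (w := fun _ => 1) (by simpa using hasSum_normSq_coeff (u τ))
  have key : ((L⁻¹ * ‖u t‖ ^ 2 : ℝ) : ℂ) = ((L⁻¹ * ‖u 0‖ ^ 2 : ℝ) : ℂ) := by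
    refine eq_of_tendsto_of_deriv_le (J := J)
      (C := 2 * (2 * Real.pi / L * 3 * ((C * weightSum) ^ 2 * C))) ht (fun N τ h0 hτ => ?_)
      (hlim 0) (hlim t)
    obtain ⟨f, hf⟩ := exists_eq_ofCont (summable_norm_coeff ((hreg 2).1 τ h0))
    have ha := hb τ h0 hτ
    have hd := hasDerivWithinAt_sum_band (N := N) (w := fun _ => 1) (fun _ => rfl)
      fun k => hu.hasDerivWithinAt_coeff h0 hf N k
    refine ⟨_, hd, ?_⟩
    rw [hf] at ha ⊢
    set a := coeff (ofCont f)
    have e1 : ∑ k ∈ band N, Complex.I * freq L k * (θ k * a k * a (-k)) = 0 :=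
      sum_band_odd fun k => by
        rw [freq_neg, hθ.even, neg_neg]
        push_cast
        ring
    have e2 : ∑ k ∈ band N, Complex.I * freq L k
        * (fourierCoeff (trigPoly L N a * trigPoly L N a : C(AddCircle L, ℂ)) k * a (-k)) = 0 := by
      rw [← sum_band_neg]
      refine Eq.trans ?_ (neg_eq_zero.2 (sum_freq_mul_fourierCoeff_sq (L := L) N a))
      rw [← Finset.sum_neg_distrib]
      refine Finset.sum_congr rfl fun k _ => ?_
      rw [freq_neg, neg_neg]
      push_cast
      ring
    have e3 : ∑ k ∈ band N, ((1 : ℝ) : ℂ) * (Complex.I * freq L k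
        * (galerkinGradient L θ N a k - galerkinError N f k) * a (-k))
        = -∑ k ∈ band N, Complex.I * freq L k * (galerkinError N f k * a (-k)) := by
      have : ∀ k, ((1 : ℝ) : ℂ) * (Complex.I * freq L k
          * (galerkinGradient L θ N a k - galerkinError N f k) * a (-k))
          = Complex.I * freq L k * (θ k * a k * a (-k))
            - 1 / 2 * (Complex.I * freq L k
              * (fourierCoeff (trigPoly L N a * trigPoly L N a : C(AddCircle L, ℂ)) k * a (-k)))
            - Complex.I * freq L k * (galerkinError N f k * a (-k)) := fun k => by
        rw [galerkinGradient]
        push_cast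
        ring
      simp only [this]
      rw [Finset.sum_sub_distrib, Finset.sum_sub_distrib, ← Finset.mul_sum, e1, e2]
      ring
    rw [e3, norm_mul, norm_neg, Complex.norm_ofNat, mul_div_assoc]
    refine mul_le_mul_of_nonneg_left ?_ two_pos.le
    refine norm_sum_band_freq_le (sq_nonneg _) (norm_galerkinError_le ha hC N) fun k => ?_
    refine (ha (-k)).trans (mul_le_of_le_one_right hC ?_)
    have := weight_mono (show (-3 : ℝ) ≤ 0 by norm_num) (-k)
    rwa [show weight 0 (-k) = 1 by simp [weight]] at this
  rw [← hu.initial]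
  exact mul_left_cancel₀ (inv_ne_zero (period_pos L).ne') (Complex.ofReal_injective key)

/-- With G the truncated gradient, the derivative pairs G with ∂ₓ(G − error). Skew-symmetry of ∂ₓ
removes the pairing of G with itself, and G is bounded, so the rest is as small as the error. The
decay m/2 + 3 used below serves G through m/2 and the error through 3. -/
theorem energy_conserved {t : ℝ} (ht : 0 ≤ t) : energy θ (u t) = energy θ u₀ := by
  have hm := hθ.pos
  obtain ⟨C, hC, hb⟩ := exists_norm_coeff_le hreg (m / 2 + 3) t
  set J : ℕ → ℝ → ℂ := fun N τ =>
    1 / 2 * ∑ k ∈ band N, ((θ k : ℝ) : ℂ) * (coeff (u τ) k * coeff (u τ) (-k))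
      - 1 / 6 * mean L (trigPoly L N (coeff (u τ)) ^ 3) with hJ
  have hlim : ∀ τ, 0 ≤ τ → Tendsto (fun N => J N τ) atTop (𝓝 ((L⁻¹ * energy θ (u τ) : ℝ) : ℂ)) := by
    intro τ hτ
    have hs := summable_norm_coeff ((hreg 2).1 τ hτ)
    have h1 := tendsto_sum_band_symbol (hasSum_symbolForm_self hθ.abs_le ((hreg (m / 2)).1 τ hτ))
    obtain ⟨f, hf⟩ := exists_eq_ofCont hs
    rw [hf] at hs h1
    have h2 := ((mean L).continuous.tendsto _).comp ((tendsto_trigPoly hs).pow 3)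
    rw [mean_toComplex_cube] at h2
    have h3 := (h1.const_mul (1 / 2 : ℂ)).sub (h2.const_mul (1 / 6 : ℂ))
    simp only [hJ]
    rw [hf]
    refine (h3.congr fun N => rfl).trans_eq ?_
    rw [energy]
    congr 1
    push_cast
    ring
  have key : ((L⁻¹ * energy θ (u t) : ℝ) : ℂ) = ((L⁻¹ * energy θ (u 0) : ℝ) : ℂ) := by
    refine eq_of_tendsto_of_deriv_le (J := J)
      (C := 2 * Real.pi / L * 3 * ((C * weightSum) ^ 2 * (|υ₂| * C + (C * weightSum) ^ 2)))
      ht (fun N τ h0 hτ => ?_) (hlim 0 le_rfl) (hlim t ht)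
    obtain ⟨f, hf⟩ := exists_eq_ofCont (summable_norm_coeff ((hreg 2).1 τ h0))
    have ha := hb τ h0 hτ
    have hda := fun k => hu.hasDerivWithinAt_coeff h0 hf N k
    have hd := ((hasDerivWithinAt_sum_band (N := N) (w := fun k => θ k) hθ.even hda).const_mul
      (1 / 2 : ℂ)).sub ((hasDerivWithinAt_mean_cube (L := L) (N := N) hda).const_mul (1 / 6 : ℂ))
    refine ⟨_, hd, ?_⟩
    rw [hf] at ha ⊢
    set a := coeff (ofCont f)
    set G := galerkinGradient L θ N a with hG
    have e1 : ∑ k ∈ band N, Complex.I * freq L k * (G k * G (-k)) = 0 :=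
      sum_band_odd fun k => by
        rw [freq_neg, neg_neg]
        push_cast
        ring
    have e2 : ∀ X Y : ℂ, 1 / 2 * (2 * X) - 1 / 6 * (3 * Y) = X - 1 / 2 * Y := fun X Y => by ring
    have e3 : ∑ k ∈ band N, ((θ k : ℝ) : ℂ) * (Complex.I * freq L k
          * (G k - galerkinError N f k) * a (-k))
        - 1 / 2 * ∑ k ∈ band N, Complex.I * freq L k * (G k - galerkinError N f k)
          * fourierCoeff (trigPoly L N a * trigPoly L N a : C(AddCircle L, ℂ)) (-k)
        = -∑ k ∈ band N, Complex.I * freq L k * (galerkinError N f k * G (-k)) := by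
      rw [Finset.mul_sum, ← Finset.sum_sub_distrib]
      have : ∀ k : ℤ, ((θ k : ℝ) : ℂ) * (Complex.I * freq L k * (G k - galerkinError N f k) * a (-k))
          - 1 / 2 * (Complex.I * freq L k * (G k - galerkinError N f k)
            * fourierCoeff (trigPoly L N a * trigPoly L N a : C(AddCircle L, ℂ)) (-k))
          = Complex.I * freq L k * (G k * G (-k))
            - Complex.I * freq L k * (galerkinError N f k * G (-k)) := fun k => by
        have : G (-k) = θ k * a (-k) - 1 / 2
            * fourierCoeff (trigPoly L N a * trigPoly L N a : C(AddCircle L, ℂ)) (-k) := by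
          rw [hG, galerkinGradient, hθ.even]
        rw [this]
        ring
      simp only [this]
      rw [Finset.sum_sub_distrib, e1, zero_sub]
    rw [e2, e3, norm_neg]
    refine norm_sum_band_freq_le (sq_nonneg _) (norm_galerkinError_le (fun k => (ha k).trans
      (mul_le_mul_of_nonneg_left (weight_mono (by linarith) k) hC)) hC N) fun k => ?_
    exact norm_galerkinGradient_le hθ ha hC N (-k)
  rw [← hu.initial]
  exact mul_left_cancel₀ (inv_ne_zero (period_pos L).ne') (Complex.ofReal_injective key)

end SymbolBounds

/-! ### The distance to the orbit -/

theorem translate_zero_toL2 (φ : SmoothPer L) : (φ.translate 0).toL2 = φ.toL2 :=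
  ext_coeff fun k => by rw [SmoothPer.coeff_translate]; simp

omit [Fact (0 < L)] in
theorem SmoothPer.eq_of_toFun_eq {φ ψ : SmoothPer L} (h : φ.toFun = ψ.toFun) : φ = ψ := by
  obtain ⟨f, _, _⟩ := φ
  obtain ⟨g, _, _⟩ := ψ
  obtain rfl : f = g := h
  rfl

theorem translate_period_toL2 (φ : SmoothPer L) (r : ℝ) :
    (φ.translate (r + L)).toL2 = (φ.translate r).toL2 := by
  have h : φ.translate (r + L) = φ.translate r := SmoothPer.eq_of_toFun_eq <| funext fun x => by
    change φ.toFun (x + (r + L)) = φ.toFun (x + r)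
    rw [← add_assoc]
    exact φ.periodic (x + r)
  rw [h]

theorem sobolevNorm_sub_sq {s : ℝ} {u v : L2per L} (hu : u ∈ Hs L s) (hv : v ∈ Hs L s) :
    sobolevNorm s (u - v) ^ 2
      = sobolevNorm s u ^ 2 + sobolevNorm s v ^ 2 - 2 * symbolForm (weight s) u v := by
  refine (hasSum_sobolevNorm_sq (Hs_sub hu hv)).unique ?_
  have h := ((hasSum_sobolevNorm_sq hu).add (hasSum_sobolevNorm_sq hv)).sub
    ((hasSum_symbolForm (C := 1) (fun k => by rw [one_mul, abs_of_pos (weight_pos s k)])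
      hu hv).mul_left 2)
  refine h.congr_fun fun k => ?_
  rw [coeff_sub, re_mul_conj_eq]
  have : ‖coeff u k - coeff v k‖ ^ 2 = 2 * ‖coeff u k‖ ^ 2 + 2 * ‖coeff v k‖ ^ 2
      - ‖coeff u k + coeff v k‖ ^ 2 := by
    simp only [← Complex.normSq_eq_norm_sq, Complex.normSq_apply, Complex.sub_re, Complex.sub_im,
      Complex.add_re, Complex.add_im]
    ring
  rw [this]
  ring

theorem sobolevNorm_translate (s : ℝ) (φ : SmoothPer L) (r : ℝ) :
    sobolevNorm s (φ.translate r).toL2 = sobolevNorm s φ.toL2 := by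
  simp only [sobolevNorm, SmoothPer.coeff_translate, norm_mul, norm_exp_freq, one_mul]

theorem sobolevNorm_shift_sub (s : ℝ) (u : L2per L) (φ : SmoothPer L) (r : ℝ) :
    sobolevNorm s (shift (-r) u - φ.toL2) = sobolevNorm s (u - (φ.translate r).toL2) := by
  have h : ∀ k, ‖coeff (shift (-r) u - φ.toL2) k‖ = ‖coeff (u - (φ.translate r).toL2) k‖ := fun k => by
    rw [coeff_sub, coeff_sub, coeff_shift, SmoothPer.coeff_translate]
    have h1 : Complex.exp (Complex.I * freq L k * ((-r : ℝ) : ℂ))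
        * Complex.exp (Complex.I * freq L k * r) = 1 := by
      rw [← Complex.exp_add, ← Complex.exp_zero]
      congr 1
      push_cast
      ring
    have h2 : Complex.exp (Complex.I * freq L k * ((-r : ℝ) : ℂ)) * coeff u k - coeff φ.toL2 k
        = Complex.exp (Complex.I * freq L k * ((-r : ℝ) : ℂ))
          * (coeff u k - Complex.exp (Complex.I * freq L k * r) * coeff φ.toL2 k) := by
      rw [mul_sub, ← mul_assoc, h1, one_mul]
    rw [h2, norm_mul, norm_exp_freq, one_mul]
  simp only [sobolevNorm, h]

theorem hasDerivAt_re_mul_conj_exp (a b : ℂ) (κ y : ℝ) :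
    HasDerivAt (fun y : ℝ => (a * (starRingEnd ℂ) (Complex.exp (Complex.I * κ * y) * b)).re)
      (a * (starRingEnd ℂ) (Complex.exp (Complex.I * κ * y) * (Complex.I * κ * b))).re y := by
  have h1 : HasDerivAt (fun y : ℝ => Complex.I * κ * (y : ℂ)) (Complex.I * κ) y := by
    simpa using (Complex.ofRealCLM.hasDerivAt (x := y)).const_mul (Complex.I * κ)
  have h2 : HasDerivAt (fun y : ℝ => Complex.exp (Complex.I * κ * y) * b)
      (Complex.exp (Complex.I * κ * y) * (Complex.I * κ * b)) y :=
    (h1.cexp.mul_const b).congr_deriv (by ring)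
  have h3 : HasDerivAt
      (fun y : ℝ => a * (starRingEnd ℂ) (Complex.exp (Complex.I * κ * y) * b))
      (a * (starRingEnd ℂ) (Complex.exp (Complex.I * κ * y) * (Complex.I * κ * b))) y :=
    (Complex.conjCLE.toContinuousLinearMap.hasFDerivAt.comp_hasDerivAt y h2).const_mul a
  exact Complex.reCLM.hasFDerivAt.comp_hasDerivAt y h3

/-- Termwise differentiation: translation changes only phases, so the differentiated series has a
summable majorant independent of the translation. -/
theorem hasDerivAt_symbolForm_translate {s : ℝ} {u : L2per L} (hu : u ∈ Hs L s) (φ : SmoothPer L)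
    (r : ℝ) : HasDerivAt (fun r => symbolForm (weight s) u (φ.translate r).toL2)
      (symbolForm (weight s) u (φ.derivative.translate r).toL2) r := by
  have hL := period_pos L
  have hw : ∀ k, |weight s k| ≤ 1 * weight s k := fun k => by
    rw [one_mul, abs_of_pos (weight_pos s k)]
  have hb := ((mem_Hs.1 hu).add (mem_Hs.1 (φ.derivative.toL2_mem_Hs s))).mul_left L
  have key := hasDerivAt_tsum (y₀ := 0) (y := r) hb
    (g := fun k y => L * (weight s k
      * (coeff u k * (starRingEnd ℂ) (coeff (φ.translate y).toL2 k)).re))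
    (g' := fun k y => L * (weight s k
      * (coeff u k * (starRingEnd ℂ) (coeff (φ.derivative.translate y).toL2 k)).re))
    (fun k y => by
      simp only [SmoothPer.coeff_translate, SmoothPer.coeff_derivative]
      exact ((hasDerivAt_re_mul_conj_exp _ _ _ y).const_mul (weight s k)).const_mul L)
    (fun k y => by
      rw [Real.norm_eq_abs, abs_mul, abs_mul, abs_of_pos hL, abs_of_pos (weight_pos s k), ← mul_add]
      refine mul_le_mul_of_nonneg_left (mul_le_mul_of_nonneg_left ?_ (weight_pos s k).le) hL.le
      refine (abs_re_mul_conj_le _ _).trans_eq ?_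
      rw [SmoothPer.coeff_translate, norm_mul, norm_exp_freq, one_mul])
    (summable_symbolForm hw hu ((φ.translate 0).toL2_mem_Hs s))
  exact key

theorem orbitDist_le {s : ℝ} (u : L2per L) (φ : SmoothPer L) (r : ℝ) :
    orbitDist s u φ ≤ sobolevNorm s (u - (φ.translate r).toL2) :=
  ciInf_le ⟨0, by rintro _ ⟨r, rfl⟩; exact sobolevNorm_nonneg _ _⟩ r

/-- The distance to the orbit is attained, and there the displacement satisfies the orthogonality
condition. -/
theorem exists_orbitDist_eq {s : ℝ} {u : L2per L} (hu : u ∈ Hs L s) (φ : SmoothPer L) :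
    ∃ r, orbitDist s u φ = sobolevNorm s (u - (φ.translate r).toL2) ∧
      symbolForm (weight s) u (φ.derivative.translate r).toL2 = 0 := by
  have hL := period_pos L
  -- All translates of φ have the same norm, so minimising the distance is maximising this pairing,
  -- a differentiable periodic function of r.
  set p : ℝ → ℝ := fun r => symbolForm (weight s) u (φ.translate r).toL2 with hp
  have hd : ∀ r, HasDerivAt p (symbolForm (weight s) u (φ.derivative.translate r).toL2) r :=
    hasDerivAt_symbolForm_translate hu φ
  have hper : Function.Periodic p L := fun r => by simp only [hp]; rw [translate_period_toL2]
  have hc : Continuous p := continuous_iff_continuousAt.2 fun r => (hd r).continuousAt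
  obtain ⟨r, -, hr⟩ := isCompact_Icc.exists_isMaxOn (Set.nonempty_Icc.2 hL.le)
    (hc.continuousOn (s := Set.Icc 0 L))
  have hmax : ∀ y, p y ≤ p r := fun y => by
    obtain ⟨z, hz, hyz⟩ := hper.exists_mem_Ico₀ hL y
    rw [hyz]
    exact hr ⟨hz.1, hz.2.le⟩
  refine ⟨r, le_antisymm (orbitDist_le u φ r) (le_ciInf fun y => ?_), ?_⟩
  · refine (sq_le_sq₀ (sobolevNorm_nonneg _ _) (sobolevNorm_nonneg _ _)).1 ?_
    rw [sobolevNorm_sub_sq hu ((φ.translate r).toL2_mem_Hs s),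
      sobolevNorm_sub_sq hu ((φ.translate y).toL2_mem_Hs s), sobolevNorm_translate,
      sobolevNorm_translate]
    have := hmax y
    simp only [hp] at this
    linarith
  · exact IsLocalMax.hasDerivAt_eq_zero (Filter.Eventually.of_forall hmax) (hd r)

theorem orbitDist_le_add {s : ℝ} {u v : L2per L} (hu : u ∈ Hs L s) (hv : v ∈ Hs L s)
    (φ : SmoothPer L) : orbitDist s u φ ≤ sobolevNorm s (u - v) + orbitDist s v φ := by
  obtain ⟨r, hr, -⟩ := exists_orbitDist_eq hv φ
  rw [hr]
  exact (orbitDist_le u φ r).trans (sobolevNorm_sub_le hu hv ((φ.translate r).toL2_mem_Hs s))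

theorem continuousOn_orbitDist {s : ℝ} {u : ℝ → L2per L} (hu : ContinuousInHs s u)
    (φ : SmoothPer L) : ContinuousOn (fun t => orbitDist s (u t) φ) (Set.Ici 0) := by
  intro t₀ ht₀
  rw [ContinuousWithinAt, tendsto_iff_norm_sub_tendsto_zero]
  refine squeeze_zero' (Eventually.of_forall fun _ => norm_nonneg _) ?_ (hu.2 t₀ ht₀)
  filter_upwards [self_mem_nhdsWithin] with t ht
  have h2 := orbitDist_le_add (hu.1 t ht) (hu.1 t₀ ht₀) φ
  have h3 := orbitDist_le_add (hu.1 t₀ ht₀) (hu.1 t ht) φ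
  rw [sobolevNorm_sub_comm] at h3
  rw [Real.norm_eq_abs, abs_le]
  constructor <;> linarith

/-! ### The conserved functionals near the wave -/

/-- The conserved functional with gradient `u - ω`. -/
def momentum (ω : ℝ) (u : L2per L) : ℝ := 1 / 2 * ‖u‖ ^ 2 - ω * inner ℝ u (oneL2 L)

/-- The conserved functional of which `φ` is a critical point. -/
def augmentedEnergy (θ : ℝ → ℝ) (ω A : ℝ) (u : L2per L) : ℝ :=
  energy θ u + ω / 2 * ‖u‖ ^ 2 + A * inner ℝ u (oneL2 L)

theorem momentum_shift (ω r : ℝ) (u : L2per L) : momentum ω (shift r u) = momentum ω u := by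
  rw [momentum, momentum, norm_shift, inner_oneL2_shift]

theorem augmentedEnergy_shift (θ : ℝ → ℝ) (ω A r : ℝ) (u : L2per L) :
    augmentedEnergy θ ω A (shift r u) = augmentedEnergy θ ω A u := by
  rw [augmentedEnergy, augmentedEnergy, norm_shift, inner_oneL2_shift, energy, energy,
    symbolForm_shift, cube_shift]

/-- At u = φ the linear term is −(𝓛1, h). Nearly constant momentum therefore makes (𝓛1, h) small of
second order, an approximate form of the coercivity constraint. -/
theorem momentum_add (ω : ℝ) (u h : L2per L) :
    momentum ω (u + h) - momentum ω u = -inner ℝ (ω • oneL2 L - u) h + 1 / 2 * ‖h‖ ^ 2 := by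
  rw [momentum, momentum, norm_add_sq_real, inner_add_left, inner_sub_left, real_inner_smul_left,
    real_inner_comm h (oneL2 L)]
  ring

theorem inner_one_one : inner ℝ (oneL2 L) (oneL2 L) = L := by
  rw [inner_oneL2_eq_coeff, coeff_oneL2]
  simp

theorem inner_toL2_one (φ : SmoothPer L) : inner ℝ φ.toL2 (oneL2 L) = mass φ := by
  rw [inner_oneL2]
  have h1 : ∫ x : AddCircle L, φ.toL2 x = ∫ x : AddCircle L, φ.toCircle x := by
    refine integral_congr_ae ?_
    exact ofCont_ae φ.toCircle
  rw [h1, ← AddCircle.intervalIntegral_preimage L 0 (fun x => φ.toCircle x), zero_add]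
  rfl

namespace SymbolBounds

variable {θ : ℝ → ℝ} {m υ₁ υ₂ : ℝ} (hθ : SymbolBounds θ m υ₁ υ₂) {ω A : ℝ} {φ : SmoothPer L}

omit [Fact (0 < L)] in
theorem _root_.PeriodicWave.IsWaveProfile.isMultiplier [Fact (0 < L)]
    (h : IsWaveProfile θ ω A φ) :
    IsMultiplier θ φ.toL2
      ((1 / 2 : ℝ) • ofCont (φ.toCircle * φ.toCircle) - ω • φ.toL2 - A • oneL2 L) := by
  obtain ⟨g, hg, hgx⟩ := h
  have : (1 / 2 : ℝ) • ofCont (φ.toCircle * φ.toCircle) - ω • φ.toL2 - A • oneL2 L = g := by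
    refine eq_of_ae ?_
    filter_upwards [hgx, ofCont_ae (φ.toCircle * φ.toCircle), ofCont_ae φ.toCircle,
      oneL2_ae (L := L), Lp.coeFn_smul (1 / 2 : ℝ) (ofCont (φ.toCircle * φ.toCircle)),
      Lp.coeFn_smul ω φ.toL2, Lp.coeFn_smul A (oneL2 L),
      Lp.coeFn_sub ((1 / 2 : ℝ) • ofCont (φ.toCircle * φ.toCircle)) (ω • φ.toL2),
      Lp.coeFn_sub ((1 / 2 : ℝ) • ofCont (φ.toCircle * φ.toCircle) - ω • φ.toL2) (A • oneL2 L)]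
      with x h1 h2 h3 h4 h5 h6 h7 h8 h9
    rw [h9, Pi.sub_apply, h8, Pi.sub_apply, h7, h6, h5, Pi.smul_apply, Pi.smul_apply, Pi.smul_apply,
      h2, h4, SmoothPer.toL2_eq_ofCont, h3, ContinuousMap.mul_apply, smul_eq_mul, smul_eq_mul,
      smul_eq_mul]
    rw [flux] at h1
    linarith
  rwa [this]

include hθ

/-- The functional is a cubic polynomial, so the expansion is exact; the profile equation removes
the linear term. -/
theorem augmentedEnergy_add (hφ : IsWaveProfile θ ω A φ) {h : L2per L} (h2 : h ∈ Hs L 2)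
    (hm : h ∈ Hs L (m / 2)) :
    augmentedEnergy θ ω A (φ.toL2 + h) - augmentedEnergy θ ω A φ.toL2
      = 1 / 2 * hθ.energyForm ω φ ⟨h, hm⟩ ⟨h, hm⟩ - 1 / 6 * cube h := by
  have hφm := φ.toL2_mem_Hs (m / 2)
  obtain ⟨f, rfl⟩ := exists_eq_ofCont (summable_norm_coeff h2)
  have e1 := symbolForm_of_isMultiplier hφ.isMultiplier (ofCont f)
  have e2 : symbolForm (fun k : ℤ => θ k) (φ.toL2 + ofCont f) (φ.toL2 + ofCont f)
      = symbolForm (fun k : ℤ => θ k) φ.toL2 φ.toL2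
        + 2 * symbolForm (fun k : ℤ => θ k) φ.toL2 (ofCont f)
        + symbolForm (fun k : ℤ => θ k) (ofCont f) (ofCont f) := by
    rw [symbolForm_add_left hθ.abs_le hφm hm (Hs_add hφm hm), symbolForm_comm,
      symbolForm_add_left hθ.abs_le hφm hm hφm, symbolForm_comm (ofCont f) (φ.toL2 + ofCont f),
      symbolForm_add_left hθ.abs_le hφm hm hm, symbolForm_comm (ofCont f) φ.toL2]
    ring
  rw [augmentedEnergy, augmentedEnergy, energy, energy, e2, e1, energyForm_apply,
    SmoothPer.toL2_eq_ofCont, cube_add_ofCont, norm_add_sq_real, inner_add_left, potential_apply]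
  simp only [inner_sub_left, real_inner_smul_left, real_inner_self_eq_norm_sq]
  rw [real_inner_comm (ofCont f) (oneL2 L)]
  ring

omit hθ in
-- The condition m ≥ 1/3 says that H^{m/2} is contained in H^{1/6}.
theorem _root_.PeriodicWave.abs_cube_le_mul (hm : 1 / 3 ≤ m) {h : L2per L} (h2 : h ∈ Hs L 2)
    (hh : h ∈ Hs L (m / 2)) :
    |cube h| ≤ 6 * L / Real.sqrt L ^ 3 * sobolevNorm (m / 2) h ^ 3 := by
  refine (abs_cube_le h2).trans ?_
  rw [div_pow, mul_div_assoc', div_mul_eq_mul_div]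
  have hL := period_pos L
  have := sobolevNorm_mono (show (1 / 6 : ℝ) ≤ m / 2 by linarith) hh
  have h0 := sobolevNorm_nonneg (1 / 6) h
  gcongr

/-- The conserved functionals are continuous at the wave. -/
theorem exists_functionals_lt (hm : 1 / 3 ≤ m) (hφ : IsWaveProfile θ ω A φ) {δ' : ℝ}
    (hδ' : 0 < δ') : ∃ δ > 0, ∀ h : L2per L, h ∈ Hs L 2 → h ∈ Hs L (m / 2) →
      sobolevNorm (m / 2) h < δ →
      |momentum ω (φ.toL2 + h) - momentum ω φ.toL2| < δ' ∧
      |augmentedEnergy θ ω A (φ.toL2 + h) - augmentedEnergy θ ω A φ.toL2| < δ' := by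
  have hL := period_pos L
  set z := ω • oneL2 L - φ.toL2 with hz
  set S := potential ω φ.toCircle with hS
  set c := 6 * L / Real.sqrt L ^ 3 with hc
  have hc0 : 0 ≤ c := by positivity
  -- D collects the coefficients of the linear, quadratic and cubic terms; for η ≤ 1 all powers of η
  -- are at most η, so both differences are at most ηD.
  set D := ‖z‖ + 1 + |υ₂| + ‖S‖ + c with hD
  have hD0 : 0 < D := by positivity
  refine ⟨min 1 (δ' / D), lt_min one_pos (div_pos hδ' hD0), fun h h2 hh hlt => ?_⟩
  set η := sobolevNorm (m / 2) h with hη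
  have hη0 : 0 ≤ η := sobolevNorm_nonneg _ _
  have hη1 : η ≤ 1 := (hlt.trans_le (min_le_left _ _)).le
  have hηD : η * D < δ' := (lt_div_iff₀ hD0).1 (hlt.trans_le (min_le_right _ _))
  have hn : ‖h‖ ≤ η := norm_le_sobolevNorm (by linarith) hh
  have hη2 : η ^ 2 ≤ η := by nlinarith
  have hη3 : η ^ 3 ≤ η := by nlinarith [mul_nonneg hη0 (sub_nonneg.2 hη2)]
  have hn2 : ‖h‖ ^ 2 ≤ η := (pow_le_pow_left₀ (norm_nonneg _) hn 2).trans hη2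
  constructor
  · rw [momentum_add, ← hz]
    refine lt_of_le_of_lt ?_ hηD
    have h3 := abs_real_inner_le_norm z h
    have h4 := mul_le_mul_of_nonneg_left hn (norm_nonneg z)
    have h5 : |-inner ℝ z h + 1 / 2 * ‖h‖ ^ 2| ≤ |inner ℝ z h| + 1 / 2 * ‖h‖ ^ 2 := by
      refine (abs_add_le _ _).trans_eq ?_
      rw [abs_neg, abs_of_nonneg (by positivity : 0 ≤ 1 / 2 * ‖h‖ ^ 2)]
    have h6 : 0 ≤ η * (|υ₂| + ‖S‖ + c) := by positivity
    have h7 : η * D = ‖z‖ * η + η + η * (|υ₂| + ‖S‖ + c) := by rw [hD]; ring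
    linarith
  · rw [hθ.augmentedEnergy_add hφ h2 hh, energyForm_apply, ← hS]
    refine lt_of_le_of_lt ?_ hηD
    have h3 := abs_symbolForm_self_le hθ.abs_le hh
    have h4 := abs_inner_apply_le S h
    have h5 := abs_cube_le_mul hm h2 hh
    rw [← hη] at h3 h5
    have h6 := mul_le_mul_of_nonneg_left hη2 (abs_nonneg υ₂)
    have h7 := mul_le_mul_of_nonneg_left hn2 (norm_nonneg S)
    have h8 := mul_le_mul_of_nonneg_left hη3 hc0
    have h9 : η * D = |υ₂| * η + ‖S‖ * η + c * η + η * (‖z‖ + 1) := by rw [hD]; ring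
    have h10 : 0 ≤ η * (‖z‖ + 1) := by positivity
    have g1 := _root_.abs_le.1 (h3.trans h6)
    have g2 := _root_.abs_le.1 (h4.trans h7)
    have g3 := _root_.abs_le.1 (h5.trans h8)
    have g4 : 0 ≤ |υ₂| * η := by positivity
    have g5 : 0 ≤ ‖S‖ * η := by positivity
    have g6 : 0 ≤ c * η := by positivity
    rw [_root_.abs_le]
    constructor <;> linarith [g1.1, g1.2, g2.1, g2.2, g3.1, g3.2]

omit hθ in
/-- The vector `(1 - ∂²)^{m/2} φ'`, which represents the condition of orthogonality to `φ'` in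
`H^{m/2}`. -/
theorem _root_.PeriodicWave.exists_orthogonality_vector (φ : SmoothPer L) (s : ℝ) :
    ∃ ψ : L2per L, ∀ k, coeff ψ k = (weight s k : ℝ) * coeff φ.derivative.toL2 k := by
  refine exists_coeff_eq _ (fun k => by
    rw [weight_neg_index, coeff_neg, map_mul, Complex.conj_ofReal]) ?_
  refine (mem_Hs.1 (φ.derivative.toL2_mem_Hs (s + s))).congr fun k => ?_
  rw [norm_mul, mul_pow, Complex.norm_real, Real.norm_eq_abs, sq_abs, weight_add, sq (weight s k)]

section Orthogonality

variable {s : ℝ} {ψ : L2per L} (hψ : ∀ k, coeff ψ k = (weight s k : ℝ) * coeff φ.derivative.toL2 k)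

include hψ
omit hθ

theorem _root_.PeriodicWave.inner_orthogonality_one : inner ℝ ψ (oneL2 L) = 0 := by
  rw [inner_oneL2_eq_coeff, hψ, SmoothPer.coeff_derivative, freq_zero]
  simp

/-- Each term of the pairing is the real part of an imaginary number. Together with
`inner_orthogonality_one` this makes ω − φ orthogonal to ψ, so the two constraints can be corrected
independently. -/
theorem _root_.PeriodicWave.inner_orthogonality_wave : inner ℝ ψ φ.toL2 = 0 := by
  refine (hasSum_inner_coeff ψ φ.toL2).unique ?_
  have h : ∀ k, L * (coeff ψ k * (starRingEnd ℂ) (coeff φ.toL2 k)).re = 0 := fun k => by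
    rw [hψ, SmoothPer.coeff_derivative, mul_assoc, mul_assoc, Complex.mul_conj]
    simp
  simp only [h]
  exact hasSum_zero

theorem _root_.PeriodicWave.inner_orthogonality_derivative (hs : 0 ≤ s)
    (h0 : φ.derivative.toL2 ≠ 0) : inner ℝ ψ φ.derivative.toL2 ≠ 0 := by
  have h1 : ‖φ.derivative.toL2‖ ^ 2 ≤ inner ℝ ψ φ.derivative.toL2 := by
    refine hasSum_le (fun k => ?_) (hasSum_normSq_coeff φ.derivative.toL2)
      (hasSum_inner_coeff ψ φ.derivative.toL2)
    rw [hψ, mul_assoc, Complex.re_ofReal_mul, re_mul_conj_self]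
    exact mul_le_mul_of_nonneg_left (le_mul_of_one_le_left (sq_nonneg _) (one_le_weight hs k))
      (period_pos L).le
  have h2 : 0 < ‖φ.derivative.toL2‖ ^ 2 := by positivity
  linarith

/-- Moving the translation from φ' to u turns stationarity of the distance at the nearest translate
into a constraint against the fixed vector ψ. -/
theorem _root_.PeriodicWave.inner_orthogonality_shift (u : L2per L) (r : ℝ) :
    inner ℝ ψ (shift (-r) u) = symbolForm (weight s) u (φ.derivative.translate r).toL2 := by
  rw [← (hasSum_inner_coeff ψ (shift (-r) u)).tsum_eq, symbolForm]
  refine tsum_congr fun k => ?_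
  rw [hψ, re_mul_conj_comm, coeff_shift, SmoothPer.coeff_translate, map_mul, map_mul,
    Complex.conj_ofReal]
  have h1 : (starRingEnd ℂ) (Complex.exp (Complex.I * freq L k * r))
      = Complex.exp (Complex.I * freq L k * ((-r : ℝ) : ℂ)) := by
    rw [← Complex.exp_conj]
    congr 1
    simp only [map_mul, Complex.conj_I, Complex.conj_ofReal]
    push_cast
    ring
  rw [h1, ← Complex.re_ofReal_mul (weight s k)]
  congr 2
  ring

end Orthogonality

omit [Fact (0 < L)] hθ in
-- In the application α = |a| and n = ‖h − az‖_{m/2}, where ‖h‖_{m/2} = ε, while q is the energy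
-- form at h and κ = ∫h³. As α = O(ε²), all corrections are O(ε³) and ½q − κ/6 ≥ cε²/2 − O(ε³). The
-- bound on ε keeps this above cε²/4; the summand 1 in it gives strictness.
theorem _root_.PeriodicWave.barrier_arithmetic {b c d Y Z ε α n q κ : ℝ} (hc : 0 < c)
    (hZ : 0 ≤ Z) (hY : 0 ≤ Y) (hε : 0 < ε) (hε1 : ε ≤ 1)
    (hεP : ε * (((2 * c * Z + 2 * Y) / b + Y * Z / b ^ 2) / 2 + d / 6 + 1) ≤ c / 4)
    (hα0 : 0 ≤ α) (hα : α ≤ ε ^ 2 / b) (hn : ε - α * Z ≤ n)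
    (hq : c * n ^ 2 ≤ q + 2 * α * (Y * ε) + α ^ 2 * (Y * Z)) (hκ : κ ≤ d * ε ^ 3)
    (hlt : 1 / 2 * q - 1 / 6 * κ < c * ε ^ 2 / 4) : False := by
  set P := (2 * c * Z + 2 * Y) / b + Y * Z / b ^ 2 with hP
  have hαZ : 0 ≤ α * Z := mul_nonneg hα0 hZ
  have h6 : ε ^ 2 - 2 * α * Z * ε ≤ n ^ 2 := by
    by_cases hle : 0 ≤ ε - α * Z
    · have := pow_le_pow_left₀ hle hn 2
      nlinarith [sq_nonneg (α * Z)]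
    · push Not at hle
      nlinarith [sq_nonneg n]
  have h18 : 0 < ε ^ 3 := pow_pos hε 3
  have h11 : α ^ 2 ≤ ε ^ 3 / b ^ 2 := by
    refine (pow_le_pow_left₀ hα0 hα 2).trans ?_
    rw [div_pow]
    refine div_le_div_of_nonneg_right ?_ (sq_nonneg b)
    have := mul_le_mul_of_nonneg_left hε1 h18.le
    linarith [show (ε ^ 2) ^ 2 = ε ^ 3 * ε by ring]
  have h12 : α * ε ≤ ε ^ 3 / b := by
    refine (mul_le_mul_of_nonneg_right hα hε.le).trans_eq ?_
    ring
  have g1 := mul_le_mul_of_nonneg_left h6 hc.le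
  have g2 := mul_le_mul_of_nonneg_left h12 (show 0 ≤ 2 * c * Z + 2 * Y by positivity)
  have g3 := mul_le_mul_of_nonneg_left h11 (show 0 ≤ Y * Z by positivity)
  have g4 : ε ^ 3 * P = (2 * c * Z + 2 * Y) * (ε ^ 3 / b) + Y * Z * (ε ^ 3 / b ^ 2) := by
    rw [hP]
    ring
  have h16 := mul_le_mul_of_nonneg_left hεP (sq_nonneg ε)
  have h17 : ε ^ 2 * (ε * (P / 2 + d / 6 + 1)) = ε ^ 3 * P / 2 + d * ε ^ 3 / 6 + ε ^ 3 := by ring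
  linarith

/-- The wave is a strict local minimiser of the augmented energy, subject to conservation of
momentum and modulo translations: there is an energy barrier on every small sphere. -/
theorem exists_barrier (hm : 1 / 3 ≤ m) (h0 : HypH0 θ m ω A φ) (hM : ω * L < mass φ)
    {ψ : L2per L} (hψ : ∀ k, coeff ψ k = (weight (m / 2) k : ℝ) * coeff φ.derivative.toL2 k) :
    ∃ ε₀ > 0, ∀ ε, 0 < ε → ε ≤ ε₀ → ∃ δ' > 0, ∀ h : L2per L, h ∈ Hs L 2 → h ∈ Hs L (m / 2) →
      inner ℝ ψ h = 0 → |momentum ω (φ.toL2 + h) - momentum ω φ.toL2| < δ' →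
      |augmentedEnergy θ ω A (φ.toL2 + h) - augmentedEnergy θ ω A φ.toL2| < δ' →
      sobolevNorm (m / 2) h ≠ ε := by
  have hL := period_pos L
  -- This is (𝓛1, 1) = ωL − M(φ), negative because the mean of φ exceeds ω.
  have hneg : inner ℝ (ω • oneL2 L - φ.toL2) (oneL2 L) < 0 := by
    rw [inner_sub_left, real_inner_smul_left, inner_one_one, inner_toL2_one]
    linarith
  obtain ⟨c, hc, hcoer⟩ := hθ.energyForm_coercive h0 hneg
    (inner_orthogonality_derivative hψ (by linarith) h0.kernel.1)
  set z := ω • oneL2 L - φ.toL2 with hz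
  have hzψ : inner ℝ ψ z = 0 := by
    rw [hz, inner_sub_right, real_inner_smul_right, inner_orthogonality_one hψ,
      inner_orthogonality_wave hψ]
    ring
  have hzm : z ∈ Hs L (m / 2) := Hs_sub (Hs_smul ω (oneL2_mem_Hs _)) (φ.toL2_mem_Hs _)
  have hb : 0 < ‖z‖ ^ 2 := by
    have : z ≠ 0 := fun h => by
      rw [h, inner_zero_left] at hneg
      exact lt_irrefl _ hneg
    positivity
  -- 𝓛z is an L² function: 𝓜1 = 0 and the profile equation expresses 𝓜φ. Cross terms between z and h
  -- then cost only L² norms.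
  obtain ⟨y, hy⟩ : ∃ y : L2per L, ∀ w : sobolevSpace L (m / 2),
      hθ.energyForm ω φ ⟨z, hzm⟩ w = inner ℝ y (w : L2per L) := by
    have hmul : IsMultiplier θ z (-((1 / 2 : ℝ) • ofCont (φ.toCircle * φ.toCircle) - ω • φ.toL2
        - A • oneL2 L)) := fun k => by
      have h1 := hθ.isMultiplier_one (L := L) k
      rw [coeff_zero_fun] at h1
      rw [coeff_neg_fun, h0.profile.isMultiplier k, hz, coeff_sub, coeff_smul]
      linear_combination (ω : ℂ) * h1
    refine ⟨-((1 / 2 : ℝ) • ofCont (φ.toCircle * φ.toCircle) - ω • φ.toL2 - A • oneL2 L)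
      + potential ω φ.toCircle z, fun w => ?_⟩
    rw [energyForm_apply, symbolForm_of_isMultiplier hmul, ← inner_add_left]
  set b := ‖z‖ ^ 2 with hbdef
  set Z := sobolevNorm (m / 2) z with hZ
  have hZ0 : 0 ≤ Z := sobolevNorm_nonneg _ _
  set Y := ‖y‖ with hY
  have hY0 : 0 ≤ Y := norm_nonneg _
  set d := 6 * L / Real.sqrt L ^ 3 with hd
  have hd0 : 0 ≤ d := by positivity
  set P := (2 * c * Z + 2 * Y) / b + Y * Z / b ^ 2 with hP
  have hP0 : 0 ≤ P := by positivity
  set P' := P / 2 + d / 6 + 1 with hP'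
  have hP'0 : 0 < P' := by positivity
  refine ⟨min 1 (c / (4 * P')), lt_min one_pos (by positivity), fun ε hε hεle => ?_⟩
  have hε1 : ε ≤ 1 := hεle.trans (min_le_left _ _)
  have hεP : ε * P' ≤ c / 4 := by
    have := (le_div_iff₀ (by positivity)).1 (hεle.trans (min_le_right _ _))
    linarith
  -- The first threshold, added to ½‖h‖² ≤ ε²/2, yields |(z, h)| ≤ ε²; the second is the height of
  -- the barrier.
  refine ⟨min (ε ^ 2 / 2) (c * ε ^ 2 / 4), by positivity, fun h h2 hh hhψ hK hG hη => ?_⟩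
  have hn : ‖h‖ ≤ ε := (norm_le_sobolevNorm (by linarith) hh).trans_eq hη
  set a := inner ℝ z h / b with ha
  have hab : a * b = inner ℝ z h := div_mul_cancel₀ _ hb.ne'
  have hea : |a| ≤ ε ^ 2 / b := by
    rw [le_div_iff₀ hb, ← abs_of_pos hb, ← abs_mul, hab]
    have h3 := hK.trans_le (min_le_left _ _)
    rw [momentum_add, ← hz] at h3
    have h4 := pow_le_pow_left₀ (norm_nonneg _) hn 2
    have h5 := abs_lt.1 h3
    rw [_root_.abs_le]
    constructor <;> linarith [h5.1, h5.2, sq_nonneg ‖h‖]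
  -- The exact constraint is restored by subtracting the component along z, which keeps
  -- orthogonality to ψ.
  set h' : sobolevSpace L (m / 2) := ⟨h, hh⟩ - a • ⟨z, hzm⟩ with hh'
  have hh'v : (h' : L2per L) = h - a • z := rfl
  have c1 : inner ℝ z (h' : L2per L) = 0 := by
    rw [hh'v, inner_sub_right, real_inner_smul_right, real_inner_self_eq_norm_sq, ← hbdef, hab,
      sub_self]
  have c2 : inner ℝ ψ (h' : L2per L) = 0 := by
    rw [hh'v, inner_sub_right, real_inner_smul_right, hhψ, hzψ]
    ring
  have h3 := hcoer h' c1 c2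
  have h4 : hθ.energyForm ω φ h' h' = hθ.energyForm ω φ ⟨h, hh⟩ ⟨h, hh⟩
      - 2 * a * inner ℝ y h + a ^ 2 * inner ℝ y z := by
    rw [hh']
    simp only [map_sub, map_smul, LinearMap.sub_apply, LinearMap.smul_apply, smul_eq_mul]
    rw [hθ.energyForm_symm ω φ ⟨h, hh⟩ ⟨z, hzm⟩, hy, hy]
    ring
  have h5 : ε - |a| * Z ≤ sobolevNorm (m / 2) (h' : L2per L) := by
    have h6 := sobolevNorm_add_le h'.2 (Hs_smul a hzm)
    rw [sobolevNorm_smul a hzm, hh'v, sub_add_cancel, hη] at h6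
    rw [hh'v]
    linarith
  have h7 : |inner ℝ y h| ≤ Y * ε :=
    (abs_real_inner_le_norm y h).trans (mul_le_mul_of_nonneg_left hn hY0)
  have h8 : |inner ℝ y z| ≤ Y * Z := (abs_real_inner_le_norm y z).trans
    (mul_le_mul_of_nonneg_left (norm_le_sobolevNorm (by linarith) hzm) hY0)
  have h9 : -(2 * |a| * (Y * ε)) ≤ 2 * a * inner ℝ y h := by
    have g1 := neg_abs_le (a * inner ℝ y h)
    have g2 := mul_le_mul_of_nonneg_left h7 (abs_nonneg a)
    rw [abs_mul] at g1
    linarith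
  have h10 : a ^ 2 * inner ℝ y z ≤ |a| ^ 2 * (Y * Z) := by
    rw [sq_abs]
    exact mul_le_mul_of_nonneg_left ((le_abs_self _).trans h8) (sq_nonneg a)
  have h14 := (_root_.abs_le.1 (abs_cube_le_mul hm h2 hh)).2
  rw [hη, ← hd] at h14
  have h15 := (abs_lt.1 hG).2.trans_le (min_le_right _ _)
  rw [hθ.augmentedEnergy_add h0.profile h2 hh] at h15
  exact barrier_arithmetic hc hZ0 hY0 hε hε1 hεP (abs_nonneg a) hea h5 (by linarith) h14 h15

/-! ### Orbital stability -/

/-- To leave the tube around the orbit, the continuous distance must take the value ε' at some time.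
Translated back at that time, the displacement satisfies the orthogonality condition and lies on the
barrier sphere, while the conserved functionals still have their initial values near those of φ,
which the barrier forbids. -/
theorem orbitDist_lt_of_smooth (hm : 1 / 3 ≤ m) (h0 : HypH0 θ m ω A φ) (hM : ω * L < mass φ)
    {ε : ℝ} (hε : 0 < ε) : ∃ δ > 0, ∀ u₀ : L2per L, (∀ r, u₀ ∈ Hs L r) →
      sobolevNorm (m / 2) (u₀ - φ.toL2) < δ → ∀ (s : ℝ) (u : ℝ → L2per L),
      IsGlobalSolution θ s u₀ u → (∀ r, ContinuousInHs r u) →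
      ∀ t, 0 ≤ t → orbitDist (m / 2) (u t) φ < ε := by
  obtain ⟨ψ, hψ⟩ := exists_orthogonality_vector φ (m / 2)
  obtain ⟨ε₀, hε₀, hbar⟩ := hθ.exists_barrier hm h0 hM hψ
  set ε' := min ε ε₀ with hε'
  have hε'0 : 0 < ε' := lt_min hε hε₀
  obtain ⟨δ', hδ', hbar'⟩ := hbar ε' hε'0 (min_le_right _ _)
  obtain ⟨δ, hδ, hcont⟩ := hθ.exists_functionals_lt hm h0.profile hδ'
  refine ⟨min δ ε', lt_min hδ hε'0, fun u₀ hu₀ hlt s u hu hreg t ht => ?_⟩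
  by_contra hge
  push Not at hge
  have hd0 : orbitDist (m / 2) (u 0) φ ≤ ε' := by
    refine (orbitDist_le _ φ 0).trans ?_
    rw [hu.initial, translate_zero_toL2]
    exact (hlt.trans_le (min_le_right _ _)).le
  obtain ⟨τ, hτ, hdτ⟩ := intermediate_value_Icc ht
    ((continuousOn_orbitDist (hreg (m / 2)) φ).mono fun x hx => hx.1)
    (show ε' ∈ Set.Icc _ _ from ⟨hd0, (min_le_left _ _).trans hge⟩)
  obtain ⟨r, hr, hort⟩ := exists_orbitDist_eq ((hreg (m / 2)).1 τ hτ.1) φ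
  have hmem : ∀ p, shift (-r) (u τ) - φ.toL2 ∈ Hs L p := fun p =>
    Hs_sub (shift_mem_Hs ((hreg p).1 τ hτ.1)) (φ.toL2_mem_Hs p)
  have hc := hcont (u₀ - φ.toL2) (Hs_sub (hu₀ 2) (φ.toL2_mem_Hs 2))
    (Hs_sub (hu₀ _) (φ.toL2_mem_Hs _)) (hlt.trans_le (min_le_left _ _))
  rw [add_sub_cancel] at hc
  have hnorm := hθ.norm_sq_conserved hu hreg hτ.1
  have hmass := inner_oneL2_conserved hu hτ.1
  have hen := hθ.energy_conserved hu hreg hτ.1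
  refine hbar' (shift (-r) (u τ) - φ.toL2) (hmem 2) (hmem _) ?_ ?_ ?_ ?_
  · rw [inner_sub_right, inner_orthogonality_shift hψ, hort, inner_orthogonality_wave hψ, sub_self]
  · rw [add_sub_cancel, momentum_shift, momentum, hnorm, hmass]
    exact hc.1
  · rw [add_sub_cancel, augmentedEnergy_shift, augmentedEnergy, hnorm, hmass, hen]
    exact hc.2
  · rw [sobolevNorm_shift_sub, ← hr]
    exact hdτ

end SymbolBounds

/-- Trigonometric polynomials are dense in `Hˢ`. -/
theorem exists_smooth_approx {s : ℝ} {u : L2per L} (hu : u ∈ Hs L s) {ε : ℝ} (hε : 0 < ε) :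
    ∃ v : L2per L, (∀ r, v ∈ Hs L r) ∧ sobolevNorm s (v - u) < ε := by
  have h := hasSum_sobolevNorm_sq hu
  have hlt : sobolevNorm s u ^ 2 - ε ^ 2 < sobolevNorm s u ^ 2 := by
    have : 0 < ε ^ 2 := by positivity
    linarith
  obtain ⟨N, hN⟩ := ((h.comp tendsto_band).eventually (lt_mem_nhds hlt)).exists
  set c : ℤ → ℂ := fun k => if k ∈ band N then coeff u k else 0 with hc
  have hc0 : ∀ k ∉ band N, c k = 0 := fun k hk => if_neg hk
  obtain ⟨v, hv⟩ := exists_coeff_eq (L := L) c (fun k => by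
    simp only [hc, neg_mem_band]
    split_ifs
    · exact coeff_neg u k
    · simp) (summable_of_ne_finset_zero (s := band N) fun k hk => by simp [hc0 k hk])
  have hvm : ∀ r, v ∈ Hs L r := mem_Hs_of_finite (F := band N) fun k hk => by rw [hv, hc0 k hk]
  refine ⟨v, hvm, ?_⟩
  have h1 : HasSum (fun k => if k ∈ band N then L * (weight s k * ‖coeff u k‖ ^ 2) else 0)
      (∑ k ∈ band N, if k ∈ band N then L * (weight s k * ‖coeff u k‖ ^ 2) else 0) :=
    hasSum_sum_of_ne_finset_zero fun k hk => if_neg hk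
  rw [Finset.sum_congr rfl fun k hk => if_pos hk] at h1
  have h2 : sobolevNorm s (v - u) ^ 2
      = sobolevNorm s u ^ 2 - ∑ k ∈ band N, L * (weight s k * ‖coeff u k‖ ^ 2) := by
    refine (hasSum_sobolevNorm_sq (Hs_sub (hvm s) hu)).unique ((h.sub h1).congr_fun fun k => ?_)
    rw [coeff_sub, hv]
    by_cases hk : k ∈ band N
    · simp [hc, hk]
    · simp [hc, hk]
  refine (sq_lt_sq₀ (sobolevNorm_nonneg _ _) hε.le).1 ?_
  rw [h2]
  simp only [Function.comp] at hN
  linarith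

/-- Stability for smooth data extends to rough data by continuous dependence. -/
theorem SymbolBounds.orbitallyStable {θ : ℝ → ℝ} {m υ₁ υ₂ : ℝ} (hθ : SymbolBounds θ m υ₁ υ₂)
    {ω A : ℝ} {φ : SmoothPer L} {s : ℝ} (hs : m / 2 ≤ s) (hwp : GloballyWellPosed L θ s)
    (hm : 1 / 3 ≤ m) (h0 : HypH0 θ m ω A φ) (hM : ω * L < mass φ) : OrbitallyStable θ m s φ := by
  intro ε hε
  obtain ⟨δ, hδ, hstab⟩ := hθ.orbitDist_lt_of_smooth hm h0 hM (half_pos hε)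
  refine ⟨δ, hδ, fun u₀ hu₀ hlt => ⟨hwp.exist u₀ hu₀, fun u hu t ht => ?_⟩⟩
  -- Continuous dependence needs a positive horizon, and t may be 0.
  obtain ⟨δ₂, hδ₂, hdep⟩ := hwp.dependence u₀ hu₀ u hu (t + 1) (by linarith) (ε / 2) (half_pos hε)
  -- The smooth datum may depend on t, but δ does not. The second bound keeps `v₀` within δ of φ,
  -- the first keeps the solutions ε/2-close at time t.
  obtain ⟨v₀, hv₀, hvlt⟩ := exists_smooth_approx hu₀ (lt_min hδ₂ (sub_pos.2 hlt))
  obtain ⟨v, hv⟩ := hwp.exist v₀ (hv₀ s)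
  have hreg := hwp.persistence v₀ hv₀ v hv
  have hclose := hdep v₀ (hv₀ s) v hv (hvlt.trans_le (min_le_left _ _)) t ht (by linarith)
  have hφm := φ.toL2_mem_Hs (m / 2)
  have hv₀φ : sobolevNorm (m / 2) (v₀ - φ.toL2) < δ := by
    have h1 := sobolevNorm_sub_le (hv₀ (m / 2)) (Hs_mono hs hu₀) hφm
    have h2 := sobolevNorm_mono hs (Hs_sub (hv₀ s) hu₀)
    have h3 := hvlt.trans_le (min_le_right _ _)
    linarith
  have h4 := hstab v₀ hv₀ hv₀φ s v hv hreg t ht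
  have hus := hu.continuous.1 t ht
  have hvs := (hreg s).1 t ht
  have h5 := orbitDist_le_add (Hs_mono hs hus) (Hs_mono hs hvs) φ
  have h6 := sobolevNorm_mono hs (Hs_sub hvs hus)
  rw [sobolevNorm_sub_comm] at h5
  linarith

end

end PeriodicWave

theorem corollary4p1 {L : ℝ} [Fact (0 < L)] (θ : ℝ → ℝ) (m υ₁ υ₂ : ℝ)
    (hθc : Continuous θ) (hθe : Function.Even θ) (hm : 1 / 3 ≤ m)
    (hυ₁ : 0 < υ₁) (hυ₂ : 0 < υ₂)
    (hθ : ∀ κ : ℝ, υ₁ * |κ| ^ m ≤ θ κ ∧ θ κ ≤ υ₂ * |κ| ^ m)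
    (s : ℝ) (hs : m / 2 ≤ s) (hwp : PeriodicWave.GloballyWellPosed L θ s)
    (ω A : ℝ) (φ : PeriodicWave.SmoothPer L)
    (h0 : PeriodicWave.HypH0 θ m ω A φ) (h1 : PeriodicWave.HypH1 θ m ω φ)
    (hM : ω * L < PeriodicWave.mass φ) :
    PeriodicWave.OrbitallyStable θ m s φ := by
  have hbounds : PeriodicWave.SymbolBounds θ m υ₁ υ₂ :=
    { even := fun k => by rw [Int.cast_neg, hθe]
      pos := by linarith
      lower_pos := hυ₁
      lower := fun k => (hθ k).1
      upper := fun k => (hθ k).2 }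
  exact hbounds.orbitallyStable hs hwp hm h0 hM
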